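/- **Theorem (High SNR).** Let $q\ge 2$ be an integer and $\lambda\in[-\frac1{q-1},1]$. Let the branching number $b$ be either a constant $d\in\mathbb Z_{\ge0}$ (regular tree) or $\mathrm{Pois}(d)$-distributed with $d\in\mathbb R_{\ge 0}$ (Poisson tree). Let $P_\lambda(j|i)=\lambda\mathbb 1\{i=j\}+\frac{1-\lambda}q$ be the Potts channel on $[q]$. *Channels.* A $q$-FMS channel is a channel $P:[q]\to\mathcal Y$ for which there is a group homomorphism $\iota:\mathrm{Aut}([q])\to\mathrm{Aut}(\mathcal Y)$ with $P(E|x)=P(\iota(\tau)E|\tau(x))$ for all measurable $E$, all $x\in[q]$ and all $\tau\in\mathrm{Aut}([q])$. It is non-trivial if $P(\cdot|x)$ is not the same for all $x$. For a channel $W$ with input alphabet $[q]$, $W^R$ denotes its restriction to two distinct input letters (for an FMS channel it does not matter which two, up to equivalence). For a binary-input channel, $Z=\mathbb E[2\sqrt{\Delta(1-\Delta)}]$ is the Bhattacharyya coefficient, where $\Delta\in[0,\frac12]$ is the smaller posterior probability of the two inputs given the output, under the uniform prior. *Broadcasting on trees with survey $W$.* The root $\rho$ has a uniform color $\sigma_\rho\in[q]$;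 every vertex has an independent number of children distributed as $b$; given $\sigma_u$, the colors of the children of $u$ are i.i.d. from $P_\lambda(\cdot|\sigma_u)$; and $\omega_v\sim W(\cdot|\sigma_v)$ independently at every vertex $v$. Let $L_k$ (resp. $T_k$) be the set of vertices at distance exactly $k$ (resp. the tree of vertices at distance at most $k$) from $\rho$. *Boundary irrelevance with respect to $W$* means $\lim_{k\to\infty}I(\sigma_\rho;\sigma_{L_k}\mid T_k,\omega_{T_k})=0$. *Boundary irrelevance* means that this holds for every non-trivial $q$-FMS channel $W$. *Belief propagation.* For a channel $M$ with input alphabet $[q]$ let $\mathrm{BP}(M)=\mathbb E_b\,(M\circ P_\lambda)^{\star b}$, i.e. the output is $b$ together with the outputs of $b$ conditionally independent uses of $M\circ P_\lambda$ on the same input. Channels converge weakly if the laws on $\mathcal P([q])$ of the posterior distribution of the input given the output, under the uniform prior, converge weakly. *Stability of the BP fixed point* means that for every non-trivial $q$-FMS channel $P$, $\mathrm{BP}^k(P)$ and $\mathrm{BP}^k(\mathrm{Id})$ converge weakly, as $k\to\infty$, to the same limit (an FMS channel). *Constants.* Put $$c^H(q,\lambda,d)=\Big(\frac2q+\frac{q-2}q\cdot\frac{d\lambda^2-1}{d\lambda-1}\Big)^{-1},\qquad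 C^H(q,\lambda)=\sup_{\pi,v}\frac{f^H(\lambda\pi+\frac{1-\lambda}q,v)}{f^H(\pi,v)},$$ $$f^H(\pi,v)=\Big(\sum_i\pi_i^{1/2}\Big)\Big(\sum_i\pi_i^{-3/2}v_i^2\Big)-\Big(\sum_i\pi_i^{-1/2}v_i\Big)^2,$$ the supremum being over the probability vectors $\pi$ on $[q]$ with positive entries and the nonzero $v\in\mathbb R^q$ with $\sum_iv_i=0$. Assume $d\lambda^2>1$. 1. If $d\lambda^2\exp\big(-c^H(q,\lambda,d)\cdot\frac{d\lambda^2-1}2\big)\,C^H(q,\lambda)<1$, then boundary irrelevance and stability of the BP fixed point hold. 2. Let $W$ be a non-trivial $q$-FMS channel. If $d\lambda^2\exp\big(-c^H(q,\lambda,d)\cdot\frac{d\lambda^2-1}2\big)\,C^H(q,\lambda)\,Z(W^R)<1$, then boundary irrelevance holds with respect to $W$. -/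

import Mathlib

open MeasureTheory ProbabilityTheory Filter Topology
open scoped ENNReal NNReal

namespace PottsBP

universe u v

noncomputable section

/-! ### Memoryless channels with input alphabet `[q]` -/

/-- A channel with input alphabet `Fin q`: a Markov kernel to some measurable output space. -/
structure Channel (q : ℕ) where
  Out : Type u
  [mOut : MeasurableSpace Out]
  ker : Kernel (Fin q) Out
  [markov : IsMarkovKernel ker]

attribute [instance] Channel.mOut Channel.markov

/-- The identity channel. -/
def Channel.ident (q : ℕ) : Channel.{0} q where
  Out := Fin q
  ker := Kernel.id

/-- A fully memoryless symmetric channel: the full symmetric group of the input alphabet acts on the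
output space by measurable automorphisms (the inverse of `ι τ` is `ι τ⁻¹`), and
`P(E | x) = P(ι(τ) E | τ(x))`. -/
def Channel.IsFMS {q : ℕ} (P : Channel.{u} q) : Prop :=
  ∃ ι : Equiv.Perm (Fin q) →* Equiv.Perm P.Out,
    (∀ τ, Measurable (ι τ)) ∧
    ∀ E : Set P.Out, MeasurableSet E → ∀ (x : Fin q) (τ : Equiv.Perm (Fin q)),
      P.ker x E = P.ker (τ x) (ι τ '' E)

/-- A channel is trivial if the law of its output does not depend on the input. -/
def Channel.IsTrivial {q : ℕ} (P : Channel.{u} q) : Prop := ∀ x y : Fin q, P.ker x = P.ker y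

/-- The uniform distribution on `[q]`. -/
def unif (q : ℕ) [NeZero q] : Measure (Fin q) := (PMF.uniformOfFintype (Fin q)).toMeasure

instance (q : ℕ) [NeZero q] : IsProbabilityMeasure (unif q) := by
  unfold unif; infer_instance

/-- The posterior distribution of a uniform input given the output `y`, as a point of the simplex. -/
def Channel.post {q : ℕ} [NeZero q] (P : Channel.{u} q) (y : P.Out) : stdSimplex ℝ (Fin q) :=
  ⟨fun i => (posterior P.ker (unif q) y).real {i}, fun _ => measureReal_nonneg, by
    rw [sum_measureReal_singleton]; simp⟩

theorem Channel.measurable_post {q : ℕ} [NeZero q] (P : Channel.{u} q) : Measurable P.post :=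
  Measurable.subtype_mk <| measurable_pi_lambda _ fun i =>
    ((posterior P.ker (unif q)).measurable_coe (measurableSet_singleton i)).ennreal_toReal

/-- The law, on the simplex `𝒫([q])`, of the posterior distribution of a uniform input given the
output of the channel. -/
def Channel.postLaw {q : ℕ} [NeZero q] (P : Channel.{u} q) :
    ProbabilityMeasure (stdSimplex ℝ (Fin q)) :=
  ⟨(P.ker ∘ₘ unif q).map P.post, Measure.isProbabilityMeasure_map P.measurable_post.aemeasurable⟩

/-- Weak convergence of channels: weak convergence of the laws of the posterior distributions. -/
def WeakTendsto {q : ℕ} [NeZero q] (P : ℕ → Channel.{u} q) (Q : Channel.{v} q) : Prop :=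
  Tendsto (fun k => (P k).postLaw) atTop (𝓝 Q.postLaw)

/-- Restriction of the input alphabet to the two letters `e 0`, `e 1`. -/
def Channel.restrict {q : ℕ} (P : Channel.{u} q) (e : Fin 2 ↪ Fin q) : Channel.{u} 2 where
  Out := P.Out
  ker := P.ker.comap e .of_discrete

/-- The Bhattacharyya coefficient `E[2 √(Δ (1 - Δ))]` of a binary-input channel, where `Δ ∈ [0, 1/2]`
is the smaller of the two posterior probabilities. -/
def Channel.bhattacharyya (P : Channel.{u} 2) : ℝ :=
  ∫ π : stdSimplex ℝ (Fin 2),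
    2 * √(min (π.1 0) (π.1 1) * (1 - min (π.1 0) (π.1 1))) ∂(P.postLaw : Measure _)

/-! ### Potts channels, branching laws, and the belief propagation operator -/

/-- The admissible range `[-1/(q-1), 1]` of `λ`. -/
abbrev PottsParam (q : ℕ) : Type := Set.Icc (-(1 / ((q : ℝ) - 1))) (1 : ℝ)

theorem potts_nonneg {q : ℕ} [NeZero q] (lam : PottsParam q) (i j : Fin q) :
    0 ≤ (lam : ℝ) * (if i = j then 1 else 0) + (1 - lam) / q := by
  obtain ⟨l, hl, hu⟩ := lam
  have hq : (0 : ℝ) < q := by exact_mod_cast Nat.pos_of_ne_zero (NeZero.ne q)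
  have h1 : (1 : ℝ) ≤ q := by exact_mod_cast Nat.one_le_iff_ne_zero.mpr (NeZero.ne q)
  split_ifs
  · have h3 : 0 ≤ l * (q - 1) + 1 := by
      rcases h1.eq_or_lt with h | h
      · simp [← h]
      · have h2 : 0 < (q : ℝ) - 1 := by linarith
        have := mul_le_mul_of_nonneg_right hl h2.le
        rw [neg_mul, one_div, inv_mul_cancel₀ h2.ne'] at this
        linarith
    have : l * 1 + (1 - l) / q = (l * (q - 1) + 1) / q := by field_simp; ring
    rw [this]; positivity
  · have : 0 ≤ 1 - l := by linarith
    simp only [mul_zero, zero_add]; positivity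

/-- The row `P_λ(· | i) = λ 1{i = ·} + (1 - λ)/q` of the Potts channel. -/
def pottsPMF {q : ℕ} [NeZero q] (lam : PottsParam q) (i : Fin q) : PMF (Fin q) :=
  PMF.ofFintype
    (fun j => ENNReal.ofReal ((lam : ℝ) * (if i = j then 1 else 0) + (1 - (lam : ℝ)) / q)) <| by
      rw [← ENNReal.ofReal_sum_of_nonneg fun j _ => potts_nonneg lam i j]
      have hq : (q : ℝ) ≠ 0 := by exact_mod_cast NeZero.ne q
      simp [Finset.sum_add_distrib, mul_div_cancel₀ _ hq]

/-- The Potts channel `P_λ`. -/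
def potts {q : ℕ} [NeZero q] (lam : PottsParam q) : Kernel (Fin q) (Fin q) :=
  Kernel.ofFunOfCountable fun i => (pottsPMF lam i).toMeasure

instance {q : ℕ} [NeZero q] (lam : PottsParam q) : IsMarkovKernel (potts lam) :=
  ⟨fun i => by change IsProbabilityMeasure (pottsPMF lam i).toMeasure; infer_instance⟩

/-- The offspring distribution: constant (regular tree), or Poisson (Galton–Watson tree). -/
inductive Branching
  | regular (d : ℕ)
  | poisson (d : ℝ≥0)

/-- The expected offspring. -/
def Branching.mean : Branching → ℝ
  | .regular d => d
  | .poisson d => d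

/-- The offspring law. -/
def Branching.law : Branching → Measure ℕ
  | .regular d => Measure.dirac d
  | .poisson d => poissonMeasure d

instance (b : Branching) : IsProbabilityMeasure b.law := by
  cases b <;> (unfold Branching.law; infer_instance)

/-- The `b`-th `⋆`-power: `b` conditionally independent uses of the channel on the same input (for
`b = 0` the output carries no information). -/
def starPow {q : ℕ} {Y : Type u} [MeasurableSpace Y] (κ : Kernel (Fin q) Y) (b : ℕ) :
    Kernel (Fin q) (Fin b → Y) :=
  Kernel.ofFunOfCountable fun x => Measure.pi fun _ : Fin b => κ x

instance {q : ℕ} {Y : Type u} [MeasurableSpace Y] (κ : Kernel (Fin q) Y) [IsMarkovKernel κ] (b : ℕ) :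
    IsMarkovKernel (starPow κ b) :=
  ⟨fun x => by change IsProbabilityMeasure (Measure.pi fun _ : Fin b => κ x); infer_instance⟩

/-- The mixture `E_b κ_b`: draw `b ∼ ν` independently of the input and output `b` together with the
output of `κ_b`. -/
def mixture {q : ℕ} (ν : Measure ℕ) {Y : ℕ → Type u} [∀ b, MeasurableSpace (Y b)]
    (κ : ∀ b, Kernel (Fin q) (Y b)) : Kernel (Fin q) (Σ b, Y b) :=
  Kernel.ofFunOfCountable fun x => ν.bind fun b => (κ b x).map (Sigma.mk b)

theorem measurable_sigmaMk' {Y : ℕ → Type u} [∀ b, MeasurableSpace (Y b)] (b : ℕ) :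
    Measurable (Sigma.mk b : Y b → Σ b, Y b) :=
  measurable_iff_le_map.mpr (iInf_le _ b)

instance {q : ℕ} (ν : Measure ℕ) [IsProbabilityMeasure ν] {Y : ℕ → Type u}
    [∀ b, MeasurableSpace (Y b)] (κ : ∀ b, Kernel (Fin q) (Y b)) [∀ b, IsMarkovKernel (κ b)] :
    IsMarkovKernel (mixture ν κ) :=
  ⟨fun x => by
    have h (b : ℕ) : IsProbabilityMeasure ((κ b x).map (Sigma.mk b : Y b → Σ b, Y b)) :=
      Measure.isProbabilityMeasure_map (measurable_sigmaMk' b).aemeasurable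
    change IsProbabilityMeasure (ν.bind fun b => (κ b x).map (Sigma.mk b))
    exact isProbabilityMeasure_bind (Measurable.of_discrete).aemeasurable (ae_of_all _ h)⟩

/-- The belief propagation operator `BP(M) = E_b (M ∘ P_λ)^{⋆b}`. -/
def bp {q : ℕ} [NeZero q] (lam : PottsParam q) (br : Branching) (M : Channel.{u} q) :
    Channel.{u} q where
  Out := Σ b : ℕ, (Fin b → M.Out)
  ker := mixture br.law fun b => starPow (M.ker ∘ₖ potts lam) b

/-- Stability of the BP fixed point: for every non-trivial FMS channel `P`, `BP^k(P)` and `BP^k(Id)`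
converge weakly to the same limit (an FMS channel). -/
def BPStable (q : ℕ) [NeZero q] (lam : PottsParam q) (br : Branching) : Prop :=
  ∃ Minf : Channel.{0} q, Minf.IsFMS ∧
    WeakTendsto (fun k => (bp lam br)^[k] (Channel.ident q)) Minf ∧
    ∀ P : Channel.{u} q, P.IsFMS → ¬ P.IsTrivial →
      WeakTendsto (fun k => (bp lam br)^[k] P) Minf

/-! ### Broadcasting on trees with survey -/

/-- Rooted ordered trees of depth at most `k`, where every vertex at distance `< k` from the root has
finitely many children. Vertices at distance `< k` carry a label in `A`, and those at distance exactly
`k` carry a label in `B`. -/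
def Tree (A B : Type u) : ℕ → Type u
  | 0 => B
  | k + 1 => A × Σ b : ℕ, (Fin b → Tree A B k)

instance Tree.instMeasurableSpace (A B : Type u) [MeasurableSpace A] [mB : MeasurableSpace B] :
    (k : ℕ) → MeasurableSpace (Tree A B k)
  | 0 => mB
  | k + 1 =>
    letI := Tree.instMeasurableSpace A B k
    inferInstanceAs (MeasurableSpace (A × Σ b : ℕ, (Fin b → Tree A B k)))

/-- Relabelling of a tree. -/
def Tree.map {A B : Type u} {A' B' : Type v} (f : A → A') (g : B → B') :
    (k : ℕ) → Tree A B k → Tree A' B' k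
  | 0, t => g t
  | k + 1, (a, ⟨b, c⟩) => (f a, ⟨b, fun i => Tree.map f g k (c i)⟩)

/-- The label of the root. -/
def Tree.root {A : Type u} : (k : ℕ) → Tree A A k → A
  | 0, t => t
  | _ + 1, t => t.1

/-- The BOTS model up to depth `k`. Given the color `x` of the root, this is the law of `T_k` with
each vertex `v` labelled by `(σ_v, ω_v)`. The survey observation `ω_v` is drawn from `W(· | σ_v)`, the
number of children is drawn from the offspring law, and the colors of the children are i.i.d. from
`P_λ(· | σ_v)`, independently. -/
def botsKernel {q : ℕ} [NeZero q] (lam : PottsParam q) (br : Branching) (W : Channel.{u} q) :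
    (k : ℕ) → Kernel (Fin q) (Tree (Fin q × W.Out) (Fin q × W.Out) k)
  | 0 => (Kernel.id ×ₖ W.ker : Kernel (Fin q) (Fin q × W.Out))
  | k + 1 =>
    ((Kernel.id ×ₖ W.ker) ×ₖ
      mixture br.law (fun b => starPow (botsKernel lam br W k ∘ₖ potts lam) b) :
        Kernel (Fin q) ((Fin q × W.Out) ×
          Σ b : ℕ, (Fin b → Tree (Fin q × W.Out) (Fin q × W.Out) k)))

instance {q : ℕ} [NeZero q] (lam : PottsParam q) (br : Branching) (W : Channel.{u} q) (k : ℕ) :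
    IsMarkovKernel (botsKernel lam br W k) := by
  induction k with
  | zero =>
    exact inferInstanceAs (IsMarkovKernel (Kernel.id ×ₖ W.ker : Kernel (Fin q) (Fin q × W.Out)))
  | succ k ih =>
    exact inferInstanceAs (IsMarkovKernel ((Kernel.id ×ₖ W.ker) ×ₖ
      mixture br.law (fun b => starPow (botsKernel lam br W k ∘ₖ potts lam) b)))

/-- The law of `(T_k, σ_{T_k}, ω_{T_k})` when `σ_ρ` is uniform on `[q]`. -/
def botsLaw {q : ℕ} [NeZero q] (lam : PottsParam q) (br : Branching) (W : Channel.{u} q) (k : ℕ) :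
    Measure (Tree (Fin q × W.Out) (Fin q × W.Out) k) :=
  botsKernel lam br W k ∘ₘ unif q

instance {q : ℕ} [NeZero q] (lam : PottsParam q) (br : Branching) (W : Channel.{u} q) (k : ℕ) :
    IsProbabilityMeasure (botsLaw lam br W k) := by
  unfold botsLaw; infer_instance

theorem Tree.measurable_map {A B : Type u} {A' B' : Type v} [MeasurableSpace A] [MeasurableSpace B]
    [MeasurableSpace A'] [MeasurableSpace B'] {f : A → A'} {g : B → B'} (hf : Measurable f)
    (hg : Measurable g) (k : ℕ) : Measurable (Tree.map f g k) := by
  induction k with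
  | zero => exact hg
  | succ k ih =>
    have h2 : Measurable (fun s : Σ b : ℕ, (Fin b → Tree A B k) =>
        (⟨s.1, fun i => Tree.map f g k (s.2 i)⟩ : Σ b : ℕ, (Fin b → Tree A' B' k))) := by
      intro S hS
      refine MeasurableSpace.measurableSet_iInf.mpr fun b => ?_
      have h3 : Measurable fun c : Fin b → Tree A B k => fun i => Tree.map f g k (c i) :=
        measurable_pi_lambda _ fun i => ih.comp (measurable_pi_apply i)
      exact ((measurable_sigmaMk' b).comp h3) hS
    exact (hf.comp measurable_fst).prodMk (h2.comp measurable_snd)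

/-- The color `σ_ρ` of the root. -/
def rootColor {q : ℕ} (W : Channel.{u} q) (k : ℕ)
    (t : Tree (Fin q × W.Out) (Fin q × W.Out) k) : Fin q :=
  (Tree.root k t).1

/-- The tree `T_k` together with the colors `σ_{L_k}` of the vertices at distance `k`. -/
def leafColors {q : ℕ} (W : Channel.{u} q) (k : ℕ) :
    Tree (Fin q × W.Out) (Fin q × W.Out) k → Tree Unit (Fin q) k :=
  Tree.map (fun _ => ()) Prod.fst k

/-- The tree `T_k` together with the survey observations `ω_{T_k}`. -/
def surveys {q : ℕ} (W : Channel.{u} q) (k : ℕ) :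
    Tree (Fin q × W.Out) (Fin q × W.Out) k → Tree W.Out W.Out k :=
  Tree.map Prod.snd Prod.snd k

theorem measurable_rootColor {q : ℕ} (W : Channel.{u} q) (k : ℕ) : Measurable (rootColor W k) := by
  cases k with
  | zero => exact measurable_fst
  | succ k => exact measurable_fst.comp measurable_fst

theorem measurable_leafColors {q : ℕ} (W : Channel.{u} q) (k : ℕ) : Measurable (leafColors W k) :=
  Tree.measurable_map measurable_const measurable_fst k

theorem measurable_surveys {q : ℕ} (W : Channel.{u} q) (k : ℕ) : Measurable (surveys W k) :=
  Tree.measurable_map measurable_snd measurable_snd k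

/-- The conditional entropy `H(X | Z)` (natural logarithm) of a `[q]`-valued random variable. -/
def condEntropy {q : ℕ} [NeZero q] {Ω : Type u} {β : Type v} [MeasurableSpace Ω]
    [MeasurableSpace β] (μ : Measure Ω) [IsFiniteMeasure μ] (X : Ω → Fin q) (Z : Ω → β) : ℝ :=
  ∫ z, ∑ i, Real.negMulLog ((condDistrib X Z μ z).real {i}) ∂(μ.map Z)

/-- `I(σ_ρ ; σ_{L_k} | T_k, ω_{T_k}) = H(σ_ρ | T_k, ω_{T_k}) - H(σ_ρ | T_k, ω_{T_k}, σ_{L_k})`. -/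
def boundaryInfo {q : ℕ} [NeZero q] (lam : PottsParam q) (br : Branching) (W : Channel.{u} q)
    (k : ℕ) : ℝ :=
  condEntropy (botsLaw lam br W k) (rootColor W k) (surveys W k) -
    condEntropy (botsLaw lam br W k) (rootColor W k) (fun t => (surveys W k t, leafColors W k t))

/-- Boundary irrelevance with respect to the survey channel `W`. -/
def BoundaryIrrelevantFor {q : ℕ} [NeZero q] (lam : PottsParam q) (br : Branching)
    (W : Channel.{u} q) : Prop :=
  Tendsto (boundaryInfo lam br W) atTop (𝓝 0)

/-- Boundary irrelevance: with respect to every non-trivial FMS survey channel. -/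
def BoundaryIrrelevance (q : ℕ) [NeZero q] (lam : PottsParam q) (br : Branching) : Prop :=
  ∀ W : Channel.{u} q, W.IsFMS → ¬ W.IsTrivial → BoundaryIrrelevantFor lam br W

/-! ### The constants -/

/-- `f^H(π, v) = ‖π^{1/4}‖² ‖π^{-3/4} v‖² - ⟨π^{1/4}, π^{-3/4} v⟩²`. -/
def fH {q : ℕ} (π v : Fin q → ℝ) : ℝ :=
  (∑ i, (π i ^ (1 / 4 : ℝ)) ^ 2) * (∑ i, (π i ^ (-3 / 4 : ℝ) * v i) ^ 2) -
    (∑ i, π i ^ (1 / 4 : ℝ) * (π i ^ (-3 / 4 : ℝ) * v i)) ^ 2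

/-- The supremum `C^H(q, λ)` of `f^H(λ π + (1 - λ)/q, v) / f^H(π, v)`, over the pairs at which every
term is defined: `π` with positive entries, and `v ≠ 0` orthogonal to the all-ones vector. The
quotients are nonnegative. -/
def CH (q : ℕ) (lam : ℝ) : ℝ≥0∞ :=
  ⨆ (π : Fin q → ℝ) (v : Fin q → ℝ) (_ : ∀ i, 0 < π i) (_ : ∑ i, π i = 1) (_ : v ≠ 0)
    (_ : ∑ i, v i = 0),
    ENNReal.ofReal (fH (fun i => lam * π i + (1 - lam) / q) v / fH π v)

/-- `c^H(q, λ, d)`. -/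
def cH (q : ℕ) (lam d : ℝ) : ℝ :=
  (2 / q + (q - 2) / q * ((d * lam ^ 2 - 1) / (d * lam - 1)))⁻¹

/-- `d λ² exp(-c^H(q, λ, d) (d λ² - 1) / 2) C^H(q, λ)`. -/
def highSNR (q : ℕ) (lam d : ℝ) : ℝ≥0∞ :=
  ENNReal.ofReal (d * lam ^ 2 * Real.exp (-(cH q lam d * ((d * lam ^ 2 - 1) / 2)))) * CH q lam

end

end PottsBP

/-!
The proof compares two sequences of channels from the color of the root. One starts from a channel
`P` and iterates belief propagation, possibly with a survey observation `W` added at every step; the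
other does the same from a channel `Q` that `P` is a degradation of. For boundary irrelevance, `P`
is the survey at the root and `Q` reveals in addition the color of the root, so that after `k` steps
the two channels are the tree with its surveys, without and with the colors at distance `k`
(`treeView_succ`). For the stability of the fixed point, `Q` is the identity and there are no
surveys.

Every input of belief propagation is used through the affinity `M.bc i j`, the Bhattacharyya
coefficient of two input letters. It is antitone along degradations, multiplicative over
conditionally independent observations (`bc_star`), and is turned by the offspring distribution into
its generating function (`bc_bp`). By symmetry it does not depend on the two letters, and it is the
expectation of the concave potential `phi π = (∑ √π_i)²` of the posterior, up to an affine map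
(`Channel.IsSymm.integral_phi`).

The gap between the affinities of the two channels contracts in each step.
* The Potts channel acts on posteriors by `π ↦ λ π + (1 - λ)/q`, and the Hessian of `phi` is
  `-f^H/2`. By definition of `C^H`, the function `λ² C^H phi π - phi (λ π + (1 - λ)/q)` is therefore
  concave (`concaveOn_phi_sub`), and Jensen's inequality for the martingale of posteriors bounds the
  gap after the Potts channel by `λ² C^H` times the gap before (`bc_noisy_sub_le`).
* The mean value bound for the generating function (`Branching.gen_sub_le`) produces the factor
  `d exp (-(E[b (b - 1)] / d) (1 - z))`, where `z` is the larger of the two affinities.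
* A signed count of the vertices at distance `k` bounds `1 - z` from below, by the Cauchy–Schwarz
  inequality. Its first two moments satisfy a linear recursion, which converges when `d λ² > 1`, and
  the limiting bound is exactly `c^H (d λ² - 1)/2` after multiplication by `E[b (b - 1)] / d`
  (`exists_affinity_bound`).

Altogether the gap tends to zero (`tendsto_bc_sub`). As `phi` is strongly concave
(`concaveOn_phi_add`), the gap controls the mean square increment of the martingale of posteriors,
hence the difference of the expectations of any continuous functional (`tendsto_integral_sub`). The
entropy gives boundary irrelevance. For the stability, the iterates from the identity are decreasing
for degradation, so the second moment of the posterior converges, and with it the expectation of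
every continuous functional; compactness supplies the limit (`exists_limit_iterate_bp`).
-/

namespace PottsBP

universe u v w

noncomputable section

/-! ### Densities and posteriors -/

theorem unif_singleton {q : ℕ} [NeZero q] (i : Fin q) : unif q {i} = (q : ℝ≥0∞)⁻¹ := by
  simp [unif]

theorem comp_unif {q : ℕ} [NeZero q] {Y : Type*} [MeasurableSpace Y] (κ : Kernel (Fin q) Y) :
    κ ∘ₘ unif q = (q : ℝ≥0∞)⁻¹ • ∑ i, κ i := by
  ext E hE
  rw [Measure.bind_apply hE κ.measurable.aemeasurable, lintegral_fintype]
  simp [unif_singleton, Finset.mul_sum, mul_comm]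

/-- The law of the output of a channel under a uniform input. -/
def Channel.outLaw {q : ℕ} [NeZero q] (P : Channel.{u} q) : Measure P.Out := P.ker ∘ₘ unif q

instance {q : ℕ} [NeZero q] (P : Channel.{u} q) : IsProbabilityMeasure P.outLaw := by
  unfold Channel.outLaw; infer_instance

theorem Channel.outLaw_eq {q : ℕ} [NeZero q] (P : Channel.{u} q) :
    P.outLaw = (q : ℝ≥0∞)⁻¹ • ∑ i, P.ker i := comp_unif _

theorem cast_ne_zero {q : ℕ} [NeZero q] : (q : ℝ≥0∞) ≠ 0 := by
  exact_mod_cast NeZero.ne q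

theorem posterior_apply_singleton {q : ℕ} [NeZero q] (P : Channel.{u} q) (y : P.Out) (i : Fin q) :
    posterior P.ker (unif q) y {i} = ENNReal.ofReal ((P.post y).1 i) := by
  simp [Channel.post]

/-- Bayes' rule: the law of the output for the input `i` has density `q · π_i` with respect to the
output law of the uniform input, `π` being the posterior. -/
theorem Channel.ker_eq_withDensity {q : ℕ} [NeZero q] (P : Channel.{u} q) (i : Fin q) :
    P.ker i = P.outLaw.withDensity fun y => q * ENNReal.ofReal ((P.post y).1 i) := by
  ext E hE
  have hm : Measurable fun y => posterior P.ker (unif q) y {i} :=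
    (posterior P.ker (unif q)).measurable_coe (measurableSet_singleton i)
  have h := congrArg (fun μ => μ (E ×ˢ {i}))
    (compProd_posterior_eq_map_swap (κ := P.ker) (μ := unif q))
  rw [Measure.compProd_apply_prod hE (measurableSet_singleton i),
    Measure.map_apply measurable_swap (hE.prod (measurableSet_singleton i)),
    Set.preimage_swap_prod, Measure.compProd_apply_prod (measurableSet_singleton i) hE,
    lintegral_singleton, unif_singleton] at h
  simp only [← posterior_apply_singleton]
  rw [withDensity_apply _ hE, lintegral_const_mul _ hm, Channel.outLaw, h, mul_comm (P.ker i E),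
    ← mul_assoc, ENNReal.mul_inv_cancel cast_ne_zero (ENNReal.natCast_ne_top q), one_mul]

theorem Channel.measurable_post_apply {q : ℕ} [NeZero q] (P : Channel.{u} q) (i : Fin q) :
    Measurable fun y => (P.post y).1 i :=
  (measurable_pi_apply i).comp (measurable_subtype_coe.comp P.measurable_post)

theorem continuous_coord {q : ℕ} (i : Fin q) : Continuous fun x : stdSimplex ℝ (Fin q) => x.1 i :=
  (continuous_apply i).comp continuous_subtype_val

section Densities

variable {q : ℕ} [NeZero q] (P : Channel.{u} q) {μ : Measure P.Out}
  {f : Fin q → P.Out → ℝ≥0∞}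

theorem Channel.outLaw_eq_withDensity (hf : ∀ i, Measurable (f i))
    (h : ∀ i, P.ker i = μ.withDensity (f i)) :
    P.outLaw = μ.withDensity fun y => (q : ℝ≥0∞)⁻¹ * ∑ i, f i y := by
  rw [P.outLaw_eq]
  ext E hE
  rw [withDensity_apply _ hE, lintegral_const_mul _ (Finset.measurable_sum _ fun i _ => hf i),
    lintegral_finsetSum _ fun i _ => hf i]
  simp [h, withDensity_apply _ hE]

/-- Posteriors are determined by the densities with respect to any common dominating measure. -/
theorem Channel.density_ae_eq [SigmaFinite μ] (hf : ∀ i, Measurable (f i))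
    (h : ∀ i, P.ker i = μ.withDensity (f i)) (i : Fin q) :
    f i =ᵐ[μ] fun y => ENNReal.ofReal ((P.post y).1 i) * ∑ j, f j y := by
  have hs : Measurable fun y => ∑ j, f j y := Finset.measurable_sum _ fun i _ => hf i
  have hp : Measurable fun y => ENNReal.ofReal ((P.post y).1 i) :=
    (P.measurable_post_apply i).ennreal_ofReal
  have h1 := P.ker_eq_withDensity i
  rw [P.outLaw_eq_withDensity hf h, ← withDensity_mul _ (hs.const_mul _) (hp.const_mul _), h i]
    at h1
  have h2 := (withDensity_eq_iff (hf i).aemeasurable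
    ((hs.const_mul _).mul (hp.const_mul _)).aemeasurable (by
      rw [← setLIntegral_univ, ← withDensity_apply _ MeasurableSet.univ, ← h i]
      exact measure_ne_top _ _)).1 h1
  filter_upwards [h2] with y hy
  rw [hy, Pi.mul_apply, mul_comm, mul_assoc, mul_left_comm, ← mul_assoc (q : ℝ≥0∞),
    ENNReal.mul_inv_cancel cast_ne_zero (ENNReal.natCast_ne_top q), one_mul]

theorem Channel.post_ae_eq {π : P.Out → stdSimplex ℝ (Fin q)} (hπ : Measurable π)
    (h : ∀ i, P.ker i = P.outLaw.withDensity fun y => q * ENNReal.ofReal ((π y).1 i)) :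
    P.post =ᵐ[P.outLaw] π := by
  have hm (i) : Measurable fun y => (q : ℝ≥0∞) * ENNReal.ofReal ((π y).1 i) :=
    (((measurable_pi_apply i).comp
      (measurable_subtype_coe.comp hπ)).ennreal_ofReal).const_mul _
  have h1 := fun i => P.density_ae_eq hm h i
  filter_upwards [ae_all_iff.2 h1] with y hy
  refine Subtype.ext (funext fun i => ?_)
  have h2 := hy i
  rw [← Finset.mul_sum, ← ENNReal.ofReal_sum_of_nonneg (fun j _ => (π y).2.1 j), (π y).2.2,
    ENNReal.ofReal_one, mul_one, mul_comm,
    ENNReal.mul_left_inj cast_ne_zero (ENNReal.natCast_ne_top q),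
    ENNReal.ofReal_eq_ofReal_iff ((π y).2.1 i) ((P.post y).2.1 i)] at h2
  exact h2.symm

theorem Channel.integral_postLaw (h : stdSimplex ℝ (Fin q) → ℝ) (hh : Measurable h) :
    ∫ x, h x ∂(P.postLaw : Measure (stdSimplex ℝ (Fin q))) = ∫ y, h (P.post y) ∂P.outLaw := by
  change ∫ x, h x ∂(P.outLaw.map P.post) = _
  exact integral_map P.measurable_post.aemeasurable hh.aestronglyMeasurable

/-- The Bhattacharyya coefficient of the pair of input letters `i`, `j`, i.e. the Hellinger affinity
of the two output laws. -/
def Channel.bc (i j : Fin q) : ℝ :=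
  q * ∫ x, √(x.1 i * x.1 j) ∂(P.postLaw : Measure (stdSimplex ℝ (Fin q)))

theorem Channel.bc_nonneg (i j : Fin q) : 0 ≤ P.bc i j :=
  mul_nonneg (Nat.cast_nonneg _) (integral_nonneg fun _ => Real.sqrt_nonneg _)

/-- The affinity as a Hellinger integral, with respect to any common dominating measure. -/
theorem Channel.ofReal_bc [SigmaFinite μ] (hf : ∀ i, Measurable (f i))
    (h : ∀ i, P.ker i = μ.withDensity (f i)) (i j : Fin q) :
    ENNReal.ofReal (P.bc i j) = ∫⁻ y, (f i y * f j y) ^ (1 / 2 : ℝ) ∂μ := by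
  have hc : Continuous fun x : stdSimplex ℝ (Fin q) => √(x.1 i * x.1 j) :=
    ((continuous_coord i).mul (continuous_coord j)).sqrt
  have hs : Measurable fun y => ∑ j, f j y := Finset.measurable_sum _ fun i _ => hf i
  have hb (x : stdSimplex ℝ (Fin q)) (i : Fin q) : x.1 i ≤ 1 := by
    rw [← x.2.2]; exact Finset.single_le_sum (fun j _ => x.2.1 j) (Finset.mem_univ i)
  have hint : Integrable (fun y => √((P.post y).1 i * (P.post y).1 j)) P.outLaw := by
    refine Integrable.of_bound (hc.measurable.comp P.measurable_post).aestronglyMeasurable 1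
      (ae_of_all _ fun y => ?_)
    rw [Real.norm_of_nonneg (Real.sqrt_nonneg _), Real.sqrt_le_one]
    exact mul_le_one₀ (hb _ _) ((P.post y).2.1 j) (hb _ _)
  have hm : Measurable fun y => ENNReal.ofReal √((P.post y).1 i * (P.post y).1 j) :=
    (hc.measurable.comp P.measurable_post).ennreal_ofReal
  rw [Channel.bc, P.integral_postLaw _ hc.measurable, ENNReal.ofReal_mul (Nat.cast_nonneg _),
    ofReal_integral_eq_lintegral_ofReal hint (ae_of_all _ fun _ => Real.sqrt_nonneg _),
    P.outLaw_eq_withDensity hf h, lintegral_withDensity_eq_lintegral_mul _ (hs.const_mul _) hm,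
    ENNReal.ofReal_natCast, ← lintegral_const_mul _ ((hs.const_mul _).mul hm)]
  refine lintegral_congr_ae ?_
  filter_upwards [P.density_ae_eq hf h i, P.density_ae_eq hf h j] with y hi hj
  rw [hi, hj, Pi.mul_apply, ← mul_assoc, ← mul_assoc,
    ENNReal.mul_inv_cancel cast_ne_zero (ENNReal.natCast_ne_top q), one_mul, mul_mul_mul_comm,
    ENNReal.mul_rpow_of_nonneg _ _ (by norm_num), ← sq (∑ j, f j y), ← ENNReal.rpow_natCast,
    ← ENNReal.rpow_mul, ← ENNReal.ofReal_mul ((P.post y).2.1 i),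
    ENNReal.ofReal_rpow_of_nonneg (mul_nonneg ((P.post y).2.1 i) ((P.post y).2.1 j)) (by norm_num),
    ← Real.sqrt_eq_rpow, mul_comm]
  norm_num

end Densities

/-! ### Degradation and Jensen's inequality -/

/-- `P` is a degradation of `Q` if it is obtained by processing the output of `Q`. -/
def Degraded {q : ℕ} (P : Channel.{u} q) (Q : Channel.{v} q) : Prop :=
  ∃ D : Kernel Q.Out P.Out, IsMarkovKernel D ∧ P.ker = D ∘ₖ Q.ker

theorem integrable_of_continuous {X : Type*} [TopologicalSpace X] [CompactSpace X]
    [MeasurableSpace X] [OpensMeasurableSpace X] (μ : Measure X) [IsFiniteMeasure μ] {f : X → ℝ}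
    (hf : Continuous f) : Integrable f μ := by
  obtain ⟨C, hC⟩ := isCompact_univ.exists_bound_of_continuousOn (f := f) hf.continuousOn
  exact Integrable.of_bound hf.measurable.aestronglyMeasurable C
    (ae_of_all _ fun x => hC x (Set.mem_univ x))

theorem integral_measure_comp {X Y : Type*} [MeasurableSpace X] [MeasurableSpace Y] {μ : Measure X}
    [SFinite μ] {κ : Kernel X Y} [IsSFiniteKernel κ] {f : Y → ℝ} (hf : Integrable f (κ ∘ₘ μ)) :
    Integrable (fun x => ∫ z, f z ∂κ x) μ ∧ ∫ x, f x ∂(κ ∘ₘ μ) = ∫ x, ∫ z, f z ∂κ x ∂μ := by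
  rw [Measure.comp_eq_comp_const_apply] at hf ⊢
  have h1 := hf.integral_comp
  have h2 := Kernel.integral_comp hf
  rw [Kernel.const_apply] at h1 h2
  exact ⟨h1, h2⟩

theorem integral_of_comp_eq {X : Type*} [TopologicalSpace X] [CompactSpace X]
    [MeasurableSpace X] [OpensMeasurableSpace X] {μ ν : Measure X} [IsFiniteMeasure μ]
    [IsFiniteMeasure ν] {κ : Kernel X X} [IsMarkovKernel κ] (h : κ ∘ₘ μ = ν) {f : X → ℝ}
    (hf : Continuous f) :
    Integrable (fun x => ∫ z, f z ∂κ x) μ ∧ ∫ x, f x ∂ν = ∫ x, ∫ z, f z ∂κ x ∂μ := by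
  subst h
  exact integral_measure_comp (integrable_of_continuous _ hf)

theorem continuous_sum_sq {q : ℕ} :
    Continuous fun x : stdSimplex ℝ (Fin q) => ∑ i, x.1 i ^ 2 :=
  continuous_finsetSum _ fun i _ => (continuous_coord i).pow 2

section Jensen

variable {q : ℕ} [NeZero q] {P : Channel.{u} q} {Q : Channel.{v} q}

/-- If `P` is a degradation of `Q`, then the posterior of `P` is the conditional expectation of the
posterior of `Q`: the two laws are the marginals of a one-step martingale. -/
theorem Degraded.exists_martingale (h : Degraded P Q) :
    ∃ κ : Kernel (stdSimplex ℝ (Fin q)) (stdSimplex ℝ (Fin q)), IsMarkovKernel κ ∧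
      κ ∘ₘ (P.postLaw : Measure (stdSimplex ℝ (Fin q))) = Q.postLaw ∧
      ∀ᵐ x ∂(P.postLaw : Measure (stdSimplex ℝ (Fin q))), ∀ i, ∫ z, z.1 i ∂κ x = x.1 i := by
  obtain ⟨D, hD, hPQ⟩ := h
  have hout : D ∘ₘ Q.outLaw = P.outLaw := by
    rw [Channel.outLaw, Channel.outLaw, Measure.comp_assoc, hPQ]
  let F : Q.Out × P.Out → stdSimplex ℝ (Fin q) × stdSimplex ℝ (Fin q) :=
    fun z => (P.post z.2, Q.post z.1)
  have hF : Measurable F :=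
    (P.measurable_post.comp measurable_snd).prodMk (Q.measurable_post.comp measurable_fst)
  let γ := (Q.outLaw ⊗ₘ D).map F
  have hγ : IsProbabilityMeasure γ := Measure.isProbabilityMeasure_map hF.aemeasurable
  have hfst : γ.fst = P.postLaw := by
    change γ.fst = P.outLaw.map P.post
    rw [Measure.fst, Measure.map_map measurable_fst hF, ← hout, ← Measure.snd_compProd,
      Measure.snd, Measure.map_map P.measurable_post measurable_snd]
    rfl
  have hsnd : γ.snd = Q.postLaw := by
    change γ.snd = Q.outLaw.map Q.post
    rw [Measure.snd, Measure.map_map measurable_snd hF]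
    conv_rhs => rw [← Measure.fst_compProd Q.outLaw D, Measure.fst,
      Measure.map_map Q.measurable_post measurable_fst]
    rfl
  have hdis : γ.fst ⊗ₘ γ.condKernel = γ := γ.disintegrate γ.condKernel
  have hne : Nonempty (stdSimplex ℝ (Fin q)) := inferInstance
  refine ⟨γ.condKernel, inferInstance, ?_, ?_⟩
  · rw [← hfst, ← Measure.snd_compProd, hdis, hsnd]
  · refine ae_all_iff.2 fun i => ?_
    have hc : Measurable fun x : stdSimplex ℝ (Fin q) => ENNReal.ofReal (x.1 i) :=
      (continuous_coord i).measurable.ennreal_ofReal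
    have key : ∀ A : Set (stdSimplex ℝ (Fin q)), MeasurableSet A →
        ∫⁻ x in A, ∫⁻ z, ENNReal.ofReal (z.1 i) ∂γ.condKernel x ∂γ.fst
          = ∫⁻ x in A, ENNReal.ofReal (x.1 i) ∂γ.fst := by
      intro A hA
      have h1 : ∫⁻ x in A, ∫⁻ z, ENNReal.ofReal (z.1 i) ∂γ.condKernel x ∂γ.fst
          = ∫⁻ p in A ×ˢ Set.univ, ENNReal.ofReal (p.2.1 i) ∂γ := by
        conv_rhs => rw [← hdis]
        rw [Measure.setLIntegral_compProd
          (f := fun p : stdSimplex ℝ (Fin q) × stdSimplex ℝ (Fin q) => ENNReal.ofReal (p.2.1 i))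
          (hc.comp measurable_snd) hA MeasurableSet.univ]
        simp
      have hB : MeasurableSet (P.post ⁻¹' A) := P.measurable_post hA
      have h2 : ∫⁻ p in A ×ˢ Set.univ, ENNReal.ofReal (p.2.1 i) ∂γ
          = ∫⁻ y, ENNReal.ofReal ((Q.post y).1 i) * D y (P.post ⁻¹' A) ∂Q.outLaw := by
        rw [setLIntegral_map
          (f := fun p : stdSimplex ℝ (Fin q) × stdSimplex ℝ (Fin q) => ENNReal.ofReal (p.2.1 i))
          (hA.prod MeasurableSet.univ) (hc.comp measurable_snd) hF]
        have : F ⁻¹' (A ×ˢ Set.univ) = Set.univ ×ˢ (P.post ⁻¹' A) := by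
          ext z; simp [F]
        rw [this, Measure.setLIntegral_compProd
          (f := fun z => ENNReal.ofReal ((F z).2.1 i)) ((hc.comp measurable_snd).comp hF)
          MeasurableSet.univ hB]
        simp [F]
      have h3 : q * ∫⁻ y, ENNReal.ofReal ((Q.post y).1 i) * D y (P.post ⁻¹' A) ∂Q.outLaw
          = q * ∫⁻ x in A, ENNReal.ofReal (x.1 i) ∂γ.fst := by
        have e1 : P.ker i (P.post ⁻¹' A) = ∫⁻ y, D y (P.post ⁻¹' A) ∂Q.ker i := by
          rw [hPQ, Kernel.comp_apply' _ _ _ hB]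
        have hm := (Q.measurable_post_apply i).ennreal_ofReal
        rw [Q.ker_eq_withDensity i, lintegral_withDensity_eq_lintegral_mul _ (hm.const_mul _)
          (D.measurable_coe hB), P.ker_eq_withDensity i, withDensity_apply _ hB,
          lintegral_const_mul _ (P.measurable_post_apply i).ennreal_ofReal] at e1
        simp only [Pi.mul_apply, mul_assoc] at e1
        rw [lintegral_const_mul (f := fun a => ENNReal.ofReal ((Q.post a).1 i) * D a (P.post ⁻¹' A))
          _ (hm.mul (D.measurable_coe hB))] at e1
        rw [← e1, hfst]
        change _ = _ * ∫⁻ x in A, ENNReal.ofReal (x.1 i) ∂(P.outLaw.map P.post)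
        rw [setLIntegral_map hA hc P.measurable_post]
      rw [h1, h2]
      exact (ENNReal.mul_right_inj cast_ne_zero (ENNReal.natCast_ne_top q)).1 h3
    have hmk : Measurable fun x => ∫⁻ z, ENNReal.ofReal (z.1 i) ∂γ.condKernel x :=
      hc.lintegral_kernel
    have hae := ae_eq_of_forall_setLIntegral_eq_of_sigmaFinite hmk hc
      (fun A hA _ => key A hA)
    rw [← hfst]
    filter_upwards [hae] with x hx
    rw [integral_eq_lintegral_of_nonneg_ae (ae_of_all _ fun z => z.2.1 i)
      (continuous_coord i).measurable.aestronglyMeasurable, hx, ENNReal.toReal_ofReal (x.2.1 i)]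

/-- The data processing inequality for concave functionals of the posterior. -/
theorem Degraded.integral_le (h : Degraded P Q) {f : (Fin q → ℝ) → ℝ}
    (hf : ConcaveOn ℝ (stdSimplex ℝ (Fin q)) f) (hc : ContinuousOn f (stdSimplex ℝ (Fin q))) :
    ∫ x, f x.1 ∂(Q.postLaw : Measure (stdSimplex ℝ (Fin q)))
      ≤ ∫ x, f x.1 ∂(P.postLaw : Measure (stdSimplex ℝ (Fin q))) := by
  obtain ⟨κ, hκ, hcomp, hmart⟩ := h.exists_martingale
  have hc' : Continuous fun x : stdSimplex ℝ (Fin q) => f x.1 := hc.domRestrict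
  obtain ⟨h1, h2⟩ := integral_of_comp_eq hcomp hc'
  rw [h2]
  refine integral_mono_ae h1 (integrable_of_continuous _ hc') ?_
  filter_upwards [hmart] with x hx
  have hint : Integrable (fun z : stdSimplex ℝ (Fin q) => z.1) (κ x) :=
    Integrable.of_eval fun i => integrable_of_continuous _ (continuous_coord i)
  have hj := hf.le_map_integral hc (isClosed_stdSimplex _ _)
    (ae_of_all (κ x) fun z => z.2) hint (integrable_of_continuous _ hc')
  have hx' : ∫ z, z.1 ∂κ x = x.1 := by
    funext i
    rw [eval_integral fun i => integrable_of_continuous _ (continuous_coord i), hx i]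
  rwa [hx'] at hj

/-- The second moment of the posterior. -/
def Channel.sqMoment (P : Channel.{u} q) : ℝ :=
  ∫ x, ∑ i, x.1 i ^ 2 ∂(P.postLaw : Measure (stdSimplex ℝ (Fin q)))

/-- A uniform modulus of continuity in quadratic form, on a compact simplex. -/
theorem exists_modulus (f : stdSimplex ℝ (Fin q) → ℝ) (hf : Continuous f) {ε : ℝ} (hε : 0 < ε) :
    ∃ K : ℝ, 0 ≤ K ∧ ∀ x z, |f z - f x| ≤ ε + K * ∑ i, (z.1 i - x.1 i) ^ 2 := by
  obtain ⟨C, hC⟩ := isCompact_univ.exists_bound_of_continuousOn (f := f) hf.continuousOn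
  have hC (x) : |f x| ≤ C := hC x (Set.mem_univ x)
  obtain ⟨δ, hδ, hu⟩ := Metric.uniformContinuous_iff.1
    (CompactSpace.uniformContinuous_of_continuous hf) ε hε
  have hC0 : 0 ≤ C := by
    obtain ⟨x⟩ : Nonempty (stdSimplex ℝ (Fin q)) := inferInstance
    exact (abs_nonneg _).trans (hC x)
  refine ⟨2 * C / δ ^ 2, by positivity, fun x z => ?_⟩
  have hs : 0 ≤ ∑ i, (z.1 i - x.1 i) ^ 2 := Finset.sum_nonneg fun i _ => sq_nonneg _
  rcases lt_or_ge (dist z x) δ with h | h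
  · have := (hu h).le
    rw [Real.dist_eq] at this
    exact this.trans (le_add_of_nonneg_right (by positivity))
  · have h1 : δ ^ 2 ≤ ∑ i, (z.1 i - x.1 i) ^ 2 := by
      by_contra! hlt
      have : dist z.1 x.1 < δ := by
        refine (dist_pi_lt_iff hδ).2 fun i => ?_
        rw [Real.dist_eq]
        refine abs_lt_of_sq_lt_sq (lt_of_le_of_lt ?_ hlt) hδ.le
        exact Finset.single_le_sum (f := fun i => (z.1 i - x.1 i) ^ 2)
          (fun j _ => sq_nonneg _) (Finset.mem_univ i)
      exact absurd this (not_lt.2 h)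
    have h2 : 2 * C ≤ 2 * C / δ ^ 2 * ∑ i, (z.1 i - x.1 i) ^ 2 := by
      rw [div_mul_eq_mul_div, le_div_iff₀ (by positivity)]
      exact mul_le_mul_of_nonneg_left h1 (by positivity)
    have h3 : |f z - f x| ≤ 2 * C := by linarith [hC x, hC z, abs_sub (f z) (f x)]
    linarith

/-- Along a degradation, a small increment of the second moment of the posterior forces the
expectations of a continuous functional to be close. By orthogonality of martingale increments, the
increment is the mean square distance of the coupled posteriors. -/
theorem exists_integral_sub_le (f : stdSimplex ℝ (Fin q) → ℝ) (hf : Continuous f) {ε : ℝ}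
    (hε : 0 < ε) : ∃ K : ℝ, 0 ≤ K ∧ ∀ (P : Channel.{u} q) (Q : Channel.{v} q), Degraded P Q →
      |∫ x, f x ∂(Q.postLaw : Measure (stdSimplex ℝ (Fin q)))
        - ∫ x, f x ∂(P.postLaw : Measure (stdSimplex ℝ (Fin q)))|
        ≤ ε + K * (Q.sqMoment - P.sqMoment) := by
  obtain ⟨K, hK, hmod⟩ := exists_modulus f hf hε
  refine ⟨K, hK, fun P Q h => ?_⟩
  obtain ⟨κ, hκ, hcomp, hmart⟩ := h.exists_martingale
  obtain ⟨h1, h2⟩ := integral_of_comp_eq hcomp hf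
  obtain ⟨h3, h4⟩ := integral_of_comp_eq hcomp continuous_sum_sq
  have hb : Integrable (fun x => K * (∫ z, ∑ i, z.1 i ^ 2 ∂κ x - ∑ i, x.1 i ^ 2))
      (P.postLaw : Measure (stdSimplex ℝ (Fin q))) :=
    (h3.sub (integrable_of_continuous _ continuous_sum_sq)).const_mul K
  have e3 : ε + K * (Q.sqMoment - P.sqMoment)
      = ∫ x, (ε + K * (∫ z, ∑ i, z.1 i ^ 2 ∂κ x - ∑ i, x.1 i ^ 2))
          ∂(P.postLaw : Measure (stdSimplex ℝ (Fin q))) := by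
    rw [integral_add (integrable_const _) hb, integral_const_mul,
      integral_sub h3 (integrable_of_continuous _ continuous_sum_sq), Channel.sqMoment,
      Channel.sqMoment, h4]
    simp
  rw [e3, h2, ← integral_sub h1 (integrable_of_continuous _ hf)]
  refine (abs_integral_le_integral_abs).trans (integral_mono_ae
    (h1.sub (integrable_of_continuous _ hf)).abs ((integrable_const _).add hb) ?_)
  filter_upwards [hmart] with x hx
  have hi (i : Fin q) : Integrable (fun z : stdSimplex ℝ (Fin q) => z.1 i) (κ x) :=
    integrable_of_continuous _ (continuous_coord i)
  have hi2 (i : Fin q) : Integrable (fun z : stdSimplex ℝ (Fin q) => z.1 i ^ 2) (κ x) :=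
    integrable_of_continuous _ ((continuous_coord i).pow 2)
  have hi3 (i : Fin q) : Integrable (fun z : stdSimplex ℝ (Fin q) => (z.1 i - x.1 i) ^ 2) (κ x) :=
    integrable_of_continuous _ (((continuous_coord i).sub continuous_const).pow 2)
  have hd : Continuous fun z : stdSimplex ℝ (Fin q) => ∑ i, (z.1 i - x.1 i) ^ 2 :=
    continuous_finsetSum _ fun i _ => ((continuous_coord i).sub continuous_const).pow 2
  have e1 : ∫ z, ∑ i, (z.1 i - x.1 i) ^ 2 ∂κ x
      = ∫ z, ∑ i, z.1 i ^ 2 ∂κ x - ∑ i, x.1 i ^ 2 := by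
    rw [integral_finsetSum _ fun i _ => hi3 i, integral_finsetSum _ fun i _ => hi2 i,
      ← Finset.sum_sub_distrib]
    refine Finset.sum_congr rfl fun i _ => ?_
    have : (fun z : stdSimplex ℝ (Fin q) => (z.1 i - x.1 i) ^ 2)
        = fun z => z.1 i ^ 2 - 2 * x.1 i * z.1 i + x.1 i ^ 2 := by funext z; ring
    have hs : Integrable (fun z : stdSimplex ℝ (Fin q) => z.1 i ^ 2 - 2 * x.1 i * z.1 i) (κ x) :=
      (hi2 i).sub ((hi i).const_mul _)
    rw [this, integral_add hs (integrable_const _),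
      integral_sub (hi2 i) ((hi i).const_mul _), integral_const_mul, hx i]
    simp
    ring
  have e2 : ∫ z, f z ∂κ x - f x = ∫ z, (f z - f x) ∂κ x := by
    rw [integral_sub (integrable_of_continuous _ hf) (integrable_const _)]; simp
  change |∫ z, f z ∂κ x - f x| ≤ ε + K * (∫ z, ∑ i, z.1 i ^ 2 ∂κ x - ∑ i, x.1 i ^ 2)
  rw [e2, ← e1]
  calc |∫ z, (f z - f x) ∂κ x| ≤ ∫ z, |f z - f x| ∂κ x := abs_integral_le_integral_abs
    _ ≤ ∫ z, (ε + K * ∑ i, (z.1 i - x.1 i) ^ 2) ∂κ x :=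
        integral_mono (integrable_of_continuous _ (hf.sub continuous_const).abs)
          (integrable_of_continuous _ (continuous_const.add (continuous_const.mul hd)))
          fun z => hmod x z
    _ = ε + K * ∫ z, ∑ i, (z.1 i - x.1 i) ^ 2 ∂κ x := by
        rw [integral_add (integrable_const _) ((integrable_of_continuous _ hd).const_mul _),
          integral_const_mul]
        simp

end Jensen

/-! ### Concavity of the Bhattacharyya potential -/

/-- The potential `(∑ √π_i)²`. Its Hessian at `π` is `-f^H(π, ·)/2`. -/
def phi {q : ℕ} (x : Fin q → ℝ) : ℝ := (∑ i, √(x i)) ^ 2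

theorem continuous_phi {q : ℕ} : Continuous (phi : (Fin q → ℝ) → ℝ) :=
  (continuous_finsetSum _ fun i _ => (continuous_apply i).sqrt).pow 2

theorem fH_eq {q : ℕ} {x : Fin q → ℝ} (hx : ∀ i, 0 < x i) (v : Fin q → ℝ) :
    fH x v = (∑ i, √(x i)) * (∑ i, v i ^ 2 / (x i * √(x i))) - (∑ i, v i / √(x i)) ^ 2 := by
  have h1 (i) : (x i ^ (1 / 4 : ℝ)) ^ 2 = √(x i) := by
    rw [← Real.rpow_natCast, ← Real.rpow_mul (hx i).le, Real.sqrt_eq_rpow]; norm_num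
  have h2 (i) : (x i ^ (-3 / 4 : ℝ) * v i) ^ 2 = v i ^ 2 / (x i * √(x i)) := by
    have : (x i ^ (-3 / 4 : ℝ)) ^ 2 = (x i * √(x i))⁻¹ := by
      nth_rewrite 2 [← Real.rpow_one (x i)]
      rw [Real.sqrt_eq_rpow, ← Real.rpow_add (hx i), ← Real.rpow_neg (hx i).le,
        ← Real.rpow_natCast, ← Real.rpow_mul (hx i).le]
      norm_num
    rw [mul_pow, this, div_eq_inv_mul]
  have h3 (i) : x i ^ (1 / 4 : ℝ) * (x i ^ (-3 / 4 : ℝ) * v i) = v i / √(x i) := by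
    rw [← mul_assoc, ← Real.rpow_add (hx i), Real.sqrt_eq_rpow, div_eq_inv_mul (v i),
      ← Real.rpow_neg (hx i).le]
    norm_num
  simp only [fH, h1, h2, h3]

theorem lagrange_identity {q : ℕ} (a r : Fin q → ℝ) :
    (∑ i, a i) * (∑ i, a i * r i ^ 2) - (∑ i, a i * r i) ^ 2
      = (∑ i, ∑ j, a i * a j * (r i - r j) ^ 2) / 2 := by
  have h (i j : Fin q) : a i * a j * (r i - r j) ^ 2
      = a i * r i ^ 2 * a j + a i * (a j * r j ^ 2) - 2 * (a i * r i * (a j * r j)) := by ring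
  simp only [h, Finset.sum_sub_distrib, Finset.sum_add_distrib, ← Finset.mul_sum,
    ← Finset.sum_mul]
  ring

/-- Strong concavity of the potential: `f^H(π, v) ≥ ‖v‖²`. -/
theorem sum_sq_le_fH {q : ℕ} {x : Fin q → ℝ} (hx : ∀ i, 0 < x i) (hs : ∑ i, x i = 1)
    {v : Fin q → ℝ} (hv : ∑ i, v i = 0) : ∑ i, v i ^ 2 ≤ fH x v := by
  have hle (i) : x i ≤ 1 := by
    rw [← hs]; exact Finset.single_le_sum (fun j _ => (hx j).le) (Finset.mem_univ i)
  have e1 : fH x v = (∑ i, ∑ j, √(x i) * √(x j) * (v i / x i - v j / x j) ^ 2) / 2 := by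
    rw [← lagrange_identity, fH_eq hx]
    have hq (i) : √(x i) ^ 2 = x i := Real.sq_sqrt (hx i).le
    have hp (i) : 0 < √(x i) := Real.sqrt_pos.2 (hx i)
    have e3 : ∑ i, v i ^ 2 / (x i * √(x i)) = ∑ i, √(x i) * (v i / x i) ^ 2 := by
      refine Finset.sum_congr rfl fun i _ => ?_
      have := hp i; have := hx i
      field_simp
      rw [hq]
    have e4 : ∑ i, v i / √(x i) = ∑ i, √(x i) * (v i / x i) := by
      refine Finset.sum_congr rfl fun i _ => ?_
      have := hp i; have := hx i
      field_simp
      rw [hq]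
    rw [e3, e4]
  have e2 : ∑ i, x i * (v i / x i) ^ 2
      = (∑ i, ∑ j, x i * x j * (v i / x i - v j / x j) ^ 2) / 2 := by
    have h0 : ∑ i, x i * (v i / x i) = 0 := by
      rw [← hv]; exact Finset.sum_congr rfl fun i _ => mul_div_cancel₀ _ (hx i).ne'
    rw [← lagrange_identity, hs, h0]; ring
  calc ∑ i, v i ^ 2 ≤ ∑ i, x i * (v i / x i) ^ 2 := by
        refine Finset.sum_le_sum fun i _ => ?_
        have : x i * (v i / x i) ^ 2 = v i ^ 2 / x i := by
          have := (hx i).ne'; field_simp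
        rw [this]
        exact le_div_self (sq_nonneg _) (hx i) (hle i)
    _ ≤ fH x v := by
        rw [e1, e2]
        have hsq (i) : x i ≤ √(x i) := Real.le_sqrt_of_sq_le (by nlinarith [hle i, hx i])
        exact div_le_div_of_nonneg_right (Finset.sum_le_sum fun i _ => Finset.sum_le_sum fun j _ =>
          mul_le_mul_of_nonneg_right (mul_le_mul (hsq i) (hsq j) (hx j).le (Real.sqrt_nonneg _))
            (sq_nonneg _)) zero_le_two

/-- The action `π ↦ λ π + (1 - λ)/q` of the Potts channel, extended linearly. -/
def pottsMap {q : ℕ} (lam : ℝ) (x : Fin q → ℝ) (i : Fin q) : ℝ :=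
  lam * x i + (1 - lam) / q * ∑ j, x j

theorem pottsMap_pos {q : ℕ} (hq : 2 ≤ q) (lam : PottsParam q) {x : Fin q → ℝ}
    (hx : ∀ i, 0 < x i) (i : Fin q) : 0 < pottsMap lam x i := by
  have : NeZero q := ⟨by omega⟩
  have hi (j : Fin q) := potts_nonneg lam i j
  have hqp : (0 : ℝ) < q := by exact_mod_cast (by omega : 0 < q)
  have e : pottsMap lam x i
      = ∑ j, ((lam : ℝ) * (if i = j then 1 else 0) + (1 - lam) / q) * x j := by
    simp [pottsMap, add_mul, Finset.sum_add_distrib, Finset.mul_sum]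
  rw [e]
  refine lt_of_le_of_ne (Finset.sum_nonneg fun j _ => mul_nonneg (hi j) (hx j).le) fun h0 => ?_
  have h1 := (Finset.sum_eq_zero_iff_of_nonneg
    fun j _ => mul_nonneg (hi j) (hx j).le).1 h0.symm
  have h2 (j : Fin q) : (lam : ℝ) * (if i = j then 1 else 0) + (1 - lam) / q = 0 :=
    (mul_eq_zero.1 (h1 j (Finset.mem_univ j))).resolve_right (hx j).ne'
  obtain ⟨j, hj⟩ : ∃ j : Fin q, i ≠ j := by
    have : Nontrivial (Fin q) := Fin.nontrivial_iff_two_le.2 hq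
    obtain ⟨j, hj⟩ := exists_ne i
    exact ⟨j, hj.symm⟩
  have h3 := h2 i
  have h4 := h2 j
  simp only [if_true, hj, if_false, mul_one, mul_zero, zero_add] at h3 h4
  have h5 : (lam : ℝ) = 0 := by linarith
  rw [h5] at h4
  simp [hqp.ne'] at h4

theorem sum_pottsMap {q : ℕ} [NeZero q] (lam : ℝ) (x : Fin q → ℝ) :
    ∑ i, pottsMap lam x i = ∑ i, x i := by
  have hq : (q : ℝ) ≠ 0 := by exact_mod_cast NeZero.ne q
  simp only [pottsMap, Finset.sum_add_distrib, ← Finset.mul_sum, Finset.sum_const,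
    Finset.card_univ, Fintype.card_fin, nsmul_eq_mul]
  field_simp
  ring

theorem fH_pottsMap_le {q : ℕ} (lam : ℝ) (hC : CH q lam ≠ ⊤) {x : Fin q → ℝ} (hx : ∀ i, 0 < x i)
    (hs : ∑ i, x i = 1) {v : Fin q → ℝ} (hv : ∑ i, v i = 0) :
    fH (pottsMap lam x) v ≤ (CH q lam).toReal * fH x v := by
  by_cases h0 : v = 0
  · subst h0; simp [fH]
  have hpos : 0 < fH x v := by
    refine lt_of_lt_of_le ?_ (sum_sq_le_fH hx hs hv)
    obtain ⟨i, hi⟩ := Function.ne_iff.1 h0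
    exact Finset.sum_pos' (fun _ _ => sq_nonneg _) ⟨i, Finset.mem_univ i, by
      have : v i ≠ 0 := hi
      positivity⟩
  have h1 : ENNReal.ofReal (fH (fun i => lam * x i + (1 - lam) / q) v / fH x v) ≤ CH q lam := by
    unfold CH
    exact le_iSup_of_le x (le_iSup_of_le v (le_iSup_of_le hx (le_iSup_of_le hs
      (le_iSup_of_le h0 (le_iSup_of_le hv le_rfl)))))
  have h2 := (ENNReal.ofReal_le_iff_le_toReal hC).1 h1
  have h3 : pottsMap lam x = fun i => lam * x i + (1 - lam) / q := by
    funext i; rw [pottsMap, hs, mul_one]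
  rw [h3]
  exact (div_le_iff₀ hpos).1 h2

/-- The first derivative of the potential along a line. -/
theorem hasDerivAt_phi {q : ℕ} {x v : Fin q → ℝ} {t : ℝ} (h : ∀ i, 0 < x i + t * v i) :
    HasDerivAt (fun s => phi fun i => x i + s * v i)
      ((∑ i, √(x i + t * v i)) * ∑ i, v i / √(x i + t * v i)) t := by
  have h1 (i : Fin q) : HasDerivAt (fun s => √(x i + s * v i)) (v i / (2 * √(x i + t * v i))) t :=
    (((hasDerivAt_id t).mul_const (v i)).const_add (x i)).sqrt (h i).ne' |>.congr_deriv (by simp)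
  refine ((HasDerivAt.fun_sum fun i _ => h1 i).fun_pow 2).congr_deriv ?_
  have : ∑ i, v i / (2 * √(x i + t * v i)) = (∑ i, v i / √(x i + t * v i)) / 2 := by
    rw [Finset.sum_div]; exact Finset.sum_congr rfl fun i _ => by rw [div_div, mul_comm 2]
  rw [this]; norm_num; ring

/-- The second derivative of the potential along a line. -/
theorem hasDerivAt_deriv_phi {q : ℕ} {x v : Fin q → ℝ} {t : ℝ} (h : ∀ i, 0 < x i + t * v i) :
    HasDerivAt (fun s => (∑ i, √(x i + s * v i)) * ∑ i, v i / √(x i + s * v i))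
      (-(fH (fun i => x i + t * v i) v / 2)) t := by
  have h1 (i : Fin q) : HasDerivAt (fun s => √(x i + s * v i)) (v i / (2 * √(x i + t * v i))) t :=
    (((hasDerivAt_id t).mul_const (v i)).const_add (x i)).sqrt (h i).ne' |>.congr_deriv (by simp)
  have hp (i) : 0 < √(x i + t * v i) := Real.sqrt_pos.2 (h i)
  have h2 (i : Fin q) : HasDerivAt (fun s => v i / √(x i + s * v i))
      (-(v i ^ 2 / ((x i + t * v i) * √(x i + t * v i)) / 2)) t := by
    refine ((hasDerivAt_const t (v i)).div (h1 i) (hp i).ne').congr_deriv ?_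
    rw [Real.sq_sqrt (h i).le]
    have := hp i; have := h i
    field_simp
    simp
  refine ((HasDerivAt.fun_sum fun i _ => h1 i).mul
    (HasDerivAt.fun_sum fun i _ => h2 i)).congr_deriv ?_
  have e1 : ∑ i, v i / (2 * √(x i + t * v i)) = (∑ i, v i / √(x i + t * v i)) / 2 := by
    rw [Finset.sum_div]; exact Finset.sum_congr rfl fun i _ => by rw [div_div, mul_comm 2]
  rw [fH_eq h, e1, Finset.sum_neg_distrib, ← Finset.sum_div]
  ring

/-- Concavity on the simplex can be checked on segments between points with positive entries. -/
theorem concaveOn_stdSimplex {q : ℕ} [NeZero q] {f : (Fin q → ℝ) → ℝ} (hf : Continuous f)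
    (h : ∀ x v : Fin q → ℝ, (∑ i, x i = 1) → (∑ i, v i = 0) →
      (∀ t ∈ Set.Icc (0 : ℝ) 1, ∀ i, 0 < x i + t * v i) →
      ConcaveOn ℝ (Set.Icc (0 : ℝ) 1) fun t => f fun i => x i + t * v i) :
    ConcaveOn ℝ (stdSimplex ℝ (Fin q)) f := by
  have hq : (0 : ℝ) < q := by exact_mod_cast Nat.pos_of_ne_zero (NeZero.ne q)
  have hint : ∀ x y : Fin q → ℝ, (∀ i, 0 < x i) → (∑ i, x i = 1) → (∀ i, 0 < y i) →
      (∑ i, y i = 1) → ∀ a b : ℝ, 0 ≤ a → 0 ≤ b → a + b = 1 →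
      a * f x + b * f y ≤ f (a • x + b • y) := by
    intro x y hx hxs hy hys a b ha hb hab
    have hc := h x (fun i => y i - x i) hxs (by rw [Finset.sum_sub_distrib, hxs, hys, sub_self])
      (fun t ht i => by
        have e : x i + t * (y i - x i) = (1 - t) * x i + t * y i := by ring
        rw [e]
        rcases ht.1.eq_or_lt with h0 | h0
        · rw [← h0]; simpa using hx i
        · have := mul_pos h0 (hy i)
          have := mul_nonneg (sub_nonneg.2 ht.2) (hx i).le
          linarith)
    have := hc.2 (Set.left_mem_Icc.2 zero_le_one) (Set.right_mem_Icc.2 zero_le_one) ha hb hab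
    simp only [smul_eq_mul, mul_zero, zero_mul, add_zero, mul_one, one_mul, zero_add,
      add_sub_cancel] at this
    have e : a • x + b • y = fun i => x i + b * (y i - x i) := by
      funext i
      simp only [Pi.add_apply, Pi.smul_apply, smul_eq_mul, eq_sub_of_add_eq hab]
      ring
    rw [e]
    exact this
  refine ⟨convex_stdSimplex ℝ _, fun x hx y hy a b ha hb hab => ?_⟩
  -- Points of the boundary are reached by moving from the barycentre.
  let p : ℝ → (Fin q → ℝ) → Fin q → ℝ := fun ε x i => (1 - ε) * x i + ε * (1 / q)
  have hp (z : Fin q → ℝ) : Tendsto (fun ε => p ε z) (𝓝[>] 0) (𝓝 z) := by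
    have : Continuous fun ε => p ε z := by fun_prop
    have h0 : p 0 z = z := by funext i; simp [p]
    exact (h0 ▸ this.tendsto 0).mono_left nhdsWithin_le_nhds
  have hl : Tendsto (fun ε => a * f (p ε x) + b * f (p ε y)) (𝓝[>] 0) (𝓝 (a * f x + b * f y)) :=
    (((hf.tendsto x).comp (hp x)).const_mul a).add (((hf.tendsto y).comp (hp y)).const_mul b)
  have hr : Tendsto (fun ε => f (a • p ε x + b • p ε y)) (𝓝[>] 0) (𝓝 (f (a • x + b • y))) :=
    (hf.tendsto _).comp (((hp x).const_smul a).add ((hp y).const_smul b))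
  refine le_of_tendsto_of_tendsto hl hr ?_
  have hmem : Set.Ioo (0 : ℝ) 1 ∈ 𝓝[>] (0 : ℝ) := Ioo_mem_nhdsGT zero_lt_one
  filter_upwards [hmem] with ε hε
  have hpos (z : Fin q → ℝ) (hz : z ∈ stdSimplex ℝ (Fin q)) (i) : 0 < p ε z i := by
    have h1 := mul_nonneg (sub_nonneg.2 hε.2.le) (hz.1 i)
    have h2 : 0 < ε * (1 / q) := mul_pos hε.1 (by positivity)
    simp only [p]; linarith
  have hsum (z : Fin q → ℝ) (hz : z ∈ stdSimplex ℝ (Fin q)) : ∑ i, p ε z i = 1 := by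
    simp only [p, Finset.sum_add_distrib, ← Finset.mul_sum, hz.2, Finset.sum_const,
      Finset.card_univ, Fintype.card_fin, nsmul_eq_mul]
    field_simp
    ring
  exact hint _ _ (hpos x hx) (hsum x hx) (hpos y hy) (hsum y hy) a b ha hb hab

/-- The potential stays concave after adding a multiple of the squared norm. -/
theorem concaveOn_phi_add {q : ℕ} [NeZero q] :
    ConcaveOn ℝ (stdSimplex ℝ (Fin q)) fun x => phi x + (∑ i, x i ^ 2) / 4 := by
  refine concaveOn_stdSimplex (continuous_phi.add ((continuous_finsetSum _ fun i _ =>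
    (continuous_apply i).pow 2).div_const 4)) fun x v hx hv hpos => ?_
  have hlin (i : Fin q) (t : ℝ) : HasDerivAt (fun s => x i + s * v i) (v i) t :=
    (((hasDerivAt_id t).mul_const (v i)).const_add (x i)).congr_deriv (by simp)
  refine concaveOn_of_hasDerivWithinAt2_nonpos (convex_Icc 0 1)
    (f' := fun t => (∑ i, √(x i + t * v i)) * (∑ i, v i / √(x i + t * v i))
      + (∑ i, 2 * (x i + t * v i) * v i) / 4)
    (f'' := fun t => -(fH (fun i => x i + t * v i) v / 2) + (∑ i, 2 * v i * v i) / 4) ?_ ?_ ?_ ?_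
  · refine Continuous.continuousOn ?_
    exact (continuous_phi.comp (by fun_prop)).add (by fun_prop)
  · intro t ht
    have ht' := interior_subset ht
    refine ((hasDerivAt_phi (hpos t ht')).add ((HasDerivAt.fun_sum fun i _ =>
      ((hlin i t).fun_pow 2).congr_deriv ?_).div_const 4)).hasDerivWithinAt
    norm_num
  · intro t ht
    have ht' := interior_subset ht
    exact ((hasDerivAt_deriv_phi (hpos t ht')).add ((HasDerivAt.fun_sum fun i _ =>
      (((hlin i t).const_mul 2).mul_const (v i))).div_const 4)).hasDerivWithinAt
  · intro t ht
    have ht' := interior_subset ht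
    have hsum : ∑ i, (x i + t * v i) = 1 := by
      rw [Finset.sum_add_distrib, ← Finset.mul_sum, hx, hv]; ring
    have h1 := sum_sq_le_fH (hpos t ht') hsum hv
    have h2 : ∑ i, 2 * v i * v i = 2 * ∑ i, v i ^ 2 := by
      rw [Finset.mul_sum]; exact Finset.sum_congr rfl fun i _ => by ring
    rw [h2]; linarith

/-- The contraction of the Hessian of the potential under the Potts channel, integrated. -/
theorem concaveOn_phi_sub {q : ℕ} [NeZero q] (hq : 2 ≤ q) (lam : PottsParam q)
    (hC : CH q lam ≠ ⊤) :
    ConcaveOn ℝ (stdSimplex ℝ (Fin q))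
      fun x => (lam : ℝ) ^ 2 * (CH q lam).toReal * phi x - phi (pottsMap lam x) := by
  have hK : Continuous (pottsMap (q := q) lam) := by unfold pottsMap; fun_prop
  refine concaveOn_stdSimplex ((continuous_const.mul continuous_phi).sub
    (continuous_phi.comp hK)) fun x v hx hv hpos => ?_
  have hKl (t : ℝ) : pottsMap lam (fun i => x i + t * v i)
      = fun i => pottsMap lam x i + t * (lam * v i) := by
    funext i
    simp only [pottsMap, Finset.sum_add_distrib, ← Finset.mul_sum, hv]
    ring
  have hsum (t : ℝ) : ∑ i, (x i + t * v i) = 1 := by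
    rw [Finset.sum_add_distrib, ← Finset.mul_sum, hx, hv]; ring
  have hposK (t : ℝ) (ht : t ∈ Set.Icc (0 : ℝ) 1) (i : Fin q) :
      0 < pottsMap lam x i + t * (lam * v i) := by
    have := pottsMap_pos hq lam (hpos t ht) i
    rwa [hKl] at this
  simp only [hKl]
  have hd1 (t) (ht : t ∈ interior (Set.Icc (0 : ℝ) 1)) :=
    ((hasDerivAt_phi (hpos t (interior_subset ht))).const_mul
      ((lam : ℝ) ^ 2 * (CH q lam).toReal)).sub (hasDerivAt_phi (hposK t (interior_subset ht)))
  have hd2 (t) (ht : t ∈ interior (Set.Icc (0 : ℝ) 1)) :=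
    ((hasDerivAt_deriv_phi (hpos t (interior_subset ht))).const_mul
      ((lam : ℝ) ^ 2 * (CH q lam).toReal)).sub
        (hasDerivAt_deriv_phi (hposK t (interior_subset ht)))
  refine concaveOn_of_hasDerivWithinAt2_nonpos (convex_Icc 0 1) ?_
    (fun t ht => (hd1 t ht).hasDerivWithinAt) (fun t ht => (hd2 t ht).hasDerivWithinAt) ?_
  · exact ((continuous_const.mul (continuous_phi.comp (by fun_prop))).sub
      (continuous_phi.comp (by fun_prop))).continuousOn
  · intro t ht
    have ht' := interior_subset ht
    have h1 := fH_pottsMap_le lam hC (hpos t ht') (hsum t) hv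
    have h2 (z : Fin q → ℝ) : fH z (fun i => lam * v i) = (lam : ℝ) ^ 2 * fH z v := by
      simp only [fH, mul_sub, mul_left_comm _ (lam : ℝ), ← Finset.mul_sum, mul_pow]
      ring
    rw [h2, ← hKl]
    have h3 := mul_le_mul_of_nonneg_left h1 (sq_nonneg (lam : ℝ))
    linarith

theorem concaveOn_sqrt_mul {q : ℕ} (i j : Fin q) :
    ConcaveOn ℝ (stdSimplex ℝ (Fin q)) fun x => √(x i * x j) := by
  refine ⟨convex_stdSimplex ℝ _, fun x hx y hy a b ha hb _ => ?_⟩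
  simp only [smul_eq_mul, Pi.add_apply, Pi.smul_apply]
  have hxi := hx.1 i; have hxj := hx.1 j; have hyi := hy.1 i; have hyj := hy.1 j
  refine Real.le_sqrt_of_sq_le ?_
  have h1 := Real.sq_sqrt (mul_nonneg hxi hxj)
  have h2 := Real.sq_sqrt (mul_nonneg hyi hyj)
  have h3 : 2 * (√(x i * x j) * √(y i * y j)) ≤ x i * y j + x j * y i := by
    rw [← Real.sqrt_mul (mul_nonneg hxi hxj)]
    have e : x i * x j * (y i * y j) = (x i * y j) * (x j * y i) := by ring
    rw [e, Real.sqrt_mul (mul_nonneg hxi hyj)]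
    have h4 := Real.sq_sqrt (mul_nonneg hxi hyj)
    have h5 := Real.sq_sqrt (mul_nonneg hxj hyi)
    nlinarith [sq_nonneg (√(x i * y j) - √(x j * y i))]
  have h6 := mul_le_mul_of_nonneg_left h3 (mul_nonneg ha hb)
  calc (a * √(x i * x j) + b * √(y i * y j)) ^ 2
      = a ^ 2 * √(x i * x j) ^ 2 + b ^ 2 * √(y i * y j) ^ 2
        + a * b * (2 * (√(x i * x j) * √(y i * y j))) := by ring
    _ ≤ _ := by rw [h1, h2]; linarith

/-! ### Densities and affinities of products and mixtures -/

theorem lintegral_pi_prod {Y : Type*} [MeasurableSpace Y] {b : ℕ} (μ : Fin b → Measure Y)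
    [∀ k, IsProbabilityMeasure (μ k)] {f : Fin b → Y → ℝ≥0∞} (hf : ∀ k, Measurable (f k)) :
    ∫⁻ c, ∏ k, f k (c k) ∂Measure.pi μ = ∏ k, ∫⁻ y, f k y ∂μ k := by
  refine (lintegral_prod_eq_prod_lintegral_of_indepFun Finset.univ
    (fun k (c : Fin b → Y) => f k (c k)) (iIndepFun_pi fun k => (hf k).aemeasurable)
    fun k => (hf k).comp (measurable_pi_apply k)).trans ?_
  refine Finset.prod_congr rfl fun k _ => ?_
  exact (measurePreserving_eval μ k).lintegral_comp (hf k)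

theorem pi_withDensity {Y : Type*} [MeasurableSpace Y] {b : ℕ} (μ : Measure Y)
    [IsProbabilityMeasure μ] {f : Y → ℝ≥0∞} (hf : Measurable f)
    [IsProbabilityMeasure (μ.withDensity f)] :
    (Measure.pi fun _ : Fin b => μ.withDensity f)
      = (Measure.pi fun _ : Fin b => μ).withDensity fun c => ∏ k, f (c k) := by
  refine Measure.pi_eq fun s hs => ?_
  rw [withDensity_apply _ (MeasurableSet.univ_pi hs), ← lintegral_indicator
    (MeasurableSet.univ_pi hs)]
  have e : (Set.univ.pi s).indicator (fun c : Fin b → Y => ∏ k, f (c k))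
      = fun c => ∏ k, (s k).indicator f (c k) := by
    funext c
    by_cases h : ∀ k, c k ∈ s k
    · rw [Set.indicator_of_mem (by simpa using h)]
      exact Finset.prod_congr rfl fun k _ => (Set.indicator_of_mem (h k) _).symm
    · rw [Set.indicator_of_notMem (by simpa using h)]
      push Not at h
      obtain ⟨k, hk⟩ := h
      exact (Finset.prod_eq_zero (Finset.mem_univ k) (Set.indicator_of_notMem hk _)).symm
  rw [e, lintegral_pi_prod (fun _ => μ) fun k => hf.indicator (hs k)]
  exact Finset.prod_congr rfl fun k _ => by
    rw [withDensity_apply _ (hs k), lintegral_indicator (hs k)]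

theorem measurable_sigma {Y : ℕ → Type*} [∀ b, MeasurableSpace (Y b)] {Z : Type*}
    [MeasurableSpace Z] {f : (Σ b, Y b) → Z} (hf : ∀ b, Measurable fun y => f ⟨b, y⟩) :
    Measurable f := fun _ hS =>
  MeasurableSpace.measurableSet_iInf.mpr fun b => hf b hS

/-- The measure on a disjoint union obtained by drawing the index `b` from `ν`, then a point of the
`b`-th summand from `κ b`. -/
def sigmaMeasure (ν : Measure ℕ) {Y : ℕ → Type u} [∀ b, MeasurableSpace (Y b)]
    (κ : ∀ b, Measure (Y b)) : Measure (Σ b, Y b) :=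
  ν.bind fun b => (κ b).map (Sigma.mk b)

section Sigma

variable {ν : Measure ℕ} {Y : ℕ → Type u} [∀ b, MeasurableSpace (Y b)]

theorem mixture_apply {q : ℕ} (κ : ∀ b, Kernel (Fin q) (Y b)) (x : Fin q) :
    mixture ν κ x = sigmaMeasure ν fun b => κ b x := rfl

instance [IsProbabilityMeasure ν] (κ : ∀ b, Measure (Y b)) [∀ b, IsProbabilityMeasure (κ b)] :
    IsProbabilityMeasure (sigmaMeasure ν κ) := by
  have h (b : ℕ) : IsProbabilityMeasure ((κ b).map (Sigma.mk b : Y b → Σ b, Y b)) :=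
    Measure.isProbabilityMeasure_map (measurable_sigmaMk' b).aemeasurable
  exact isProbabilityMeasure_bind (Measurable.of_discrete).aemeasurable (ae_of_all _ h)

theorem lintegral_sigmaMeasure (κ : ∀ b, Measure (Y b)) {f : (Σ b, Y b) → ℝ≥0∞}
    (hf : Measurable f) :
    ∫⁻ z, f z ∂sigmaMeasure ν κ = ∫⁻ b, ∫⁻ y, f ⟨b, y⟩ ∂κ b ∂ν := by
  rw [sigmaMeasure, Measure.lintegral_bind (Measurable.of_discrete).aemeasurable hf.aemeasurable]
  exact lintegral_congr fun b => lintegral_map hf (measurable_sigmaMk' b)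

theorem sigmaMeasure_withDensity (κ : ∀ b, Measure (Y b)) {f : ∀ b, Y b → ℝ≥0∞}
    (hf : ∀ b, Measurable (f b)) :
    sigmaMeasure ν (fun b => (κ b).withDensity (f b))
      = (sigmaMeasure ν κ).withDensity fun z => f z.1 z.2 := by
  have hm : Measurable fun z : Σ b, Y b => f z.1 z.2 := measurable_sigma hf
  ext E hE
  rw [withDensity_apply _ hE, ← lintegral_indicator hE,
    lintegral_sigmaMeasure _ (hm.indicator hE), ← lintegral_indicator_one hE,
    lintegral_sigmaMeasure _ (measurable_one.indicator hE)]
  refine lintegral_congr fun b => ?_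
  have hEb : MeasurableSet (Sigma.mk b ⁻¹' E) := measurable_sigmaMk' b hE
  have e1 : (fun y => E.indicator (1 : (Σ b, Y b) → ℝ≥0∞) ⟨b, y⟩)
      = (Sigma.mk b ⁻¹' E).indicator 1 := rfl
  have e2 : (fun y => E.indicator (fun z : Σ b, Y b => f z.1 z.2) ⟨b, y⟩)
      = (Sigma.mk b ⁻¹' E).indicator (f b) := rfl
  rw [e1, e2, lintegral_indicator_one hEb, lintegral_indicator hEb, withDensity_apply _ hEb]

theorem integrable_sigmaMeasure [SFinite ν] (κ : ∀ b, Measure (Y b)) [∀ b, SFinite (κ b)]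
    {f : (Σ b, Y b) → ℝ} (hf : Measurable f) (h : ∀ b, Integrable (fun y => f ⟨b, y⟩) (κ b))
    (hi : Integrable (fun b => ∫ y, |f ⟨b, y⟩| ∂κ b) ν) :
    Integrable f (sigmaMeasure ν κ) := by
  refine ⟨hf.aestronglyMeasurable, ?_⟩
  rw [hasFiniteIntegral_iff_enorm, lintegral_sigmaMeasure κ hf.enorm]
  have h2 := hi.2
  rw [hasFiniteIntegral_iff_enorm] at h2
  convert h2 using 3 with b
  rw [Real.enorm_of_nonneg (integral_nonneg fun _ => abs_nonneg _),
    ← ofReal_integral_norm_eq_lintegral_enorm (h b)]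
  rfl

theorem integral_sigmaMeasure [SFinite ν] (κ : ∀ b, Measure (Y b))
    [∀ b, IsProbabilityMeasure (κ b)] {f : (Σ b, Y b) → ℝ} (hm : Measurable f)
    (hf : Integrable f (sigmaMeasure ν κ)) :
    ∫ z, f z ∂sigmaMeasure ν κ = ∫ b, ∫ y, f ⟨b, y⟩ ∂κ b ∂ν := by
  have hp (b : ℕ) : IsProbabilityMeasure ((κ b).map (Sigma.mk b : Y b → Σ b, Y b)) :=
    Measure.isProbabilityMeasure_map (measurable_sigmaMk' b).aemeasurable
  let K : Kernel ℕ (Σ b, Y b) := Kernel.ofFunOfCountable fun b => (κ b).map (Sigma.mk b)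
  have hK : IsMarkovKernel K := ⟨hp⟩
  have h1 := (integral_measure_comp (κ := K) (μ := ν) hf).2
  exact h1.trans (integral_congr_ae (ae_of_all _ fun b =>
    integral_map (measurable_sigmaMk' b).aemeasurable hm.aestronglyMeasurable))

end Sigma

/-! ### Channel operations and affinities -/

/-- The channel `M ∘ P_λ`. -/
def Channel.noisy {q : ℕ} [NeZero q] (lam : PottsParam q) (M : Channel.{u} q) : Channel.{u} q where
  Out := M.Out
  ker := M.ker ∘ₖ potts lam

/-- The channel `W ⋆ M`: conditionally independent uses of `W` and `M` on the same input. -/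
def Channel.star {q : ℕ} (W M : Channel.{u} q) : Channel.{u} q where
  Out := W.Out × M.Out
  ker := W.ker ×ₖ M.ker

section Ops

variable {q : ℕ} [NeZero q] (lam : PottsParam q) (br : Branching) (W M : Channel.{u} q)

theorem comp_potts_apply {Y : Type*} [MeasurableSpace Y] (κ : Kernel (Fin q) Y) (i : Fin q) :
    (κ ∘ₖ potts lam) i = ∑ j,
      ENNReal.ofReal ((lam : ℝ) * (if i = j then 1 else 0) + (1 - lam) / q) • κ j := by
  ext E hE
  rw [Kernel.comp_apply' _ _ _ hE, lintegral_fintype]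
  simp only [Measure.coe_finsetSum, Finset.sum_apply, Measure.smul_apply, smul_eq_mul]
  refine Finset.sum_congr rfl fun j _ => ?_
  rw [mul_comm]
  congr 1
  change (pottsPMF lam i).toMeasure {j} = _
  rw [PMF.toMeasure_apply_singleton _ _ (measurableSet_singleton j)]
  rfl

/-- The Potts channel, acting on the simplex. -/
def pottsSimplex (x : stdSimplex ℝ (Fin q)) : stdSimplex ℝ (Fin q) :=
  ⟨pottsMap lam x.1, fun i => by
    have e : pottsMap lam x.1 i
        = ∑ j, ((lam : ℝ) * (if i = j then 1 else 0) + (1 - lam) / q) * x.1 j := by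
      simp [pottsMap, add_mul, Finset.sum_add_distrib, Finset.mul_sum]
    rw [e]
    exact Finset.sum_nonneg fun j _ => mul_nonneg (potts_nonneg lam i j) (x.2.1 j),
    by rw [sum_pottsMap, x.2.2]⟩

theorem continuous_pottsSimplex : Continuous (pottsSimplex lam) := by
  refine Continuous.subtype_mk ?_ _
  exact continuous_pi fun i => (continuous_const.mul (continuous_coord i)).add
    (continuous_const.mul (continuous_finsetSum _ fun j _ => continuous_coord j))

theorem outLaw_noisy : (M.noisy lam).outLaw = M.outLaw := by
  rw [Channel.outLaw_eq, Channel.outLaw_eq]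
  congr 1
  change ∑ i, (M.ker ∘ₖ potts lam) i = _
  simp only [comp_potts_apply]
  rw [Finset.sum_comm]
  refine Finset.sum_congr rfl fun j _ => ?_
  rw [← Finset.sum_smul, ← ENNReal.ofReal_sum_of_nonneg fun i _ => potts_nonneg lam i j]
  have hq : (q : ℝ) ≠ 0 := by exact_mod_cast NeZero.ne q
  simp [Finset.sum_add_distrib, mul_div_cancel₀ _ hq]

theorem post_noisy : (M.noisy lam).post =ᵐ[M.outLaw] fun y => pottsSimplex lam (M.post y) := by
  rw [← outLaw_noisy lam M]
  refine Channel.post_ae_eq (M.noisy lam) (π := fun y => pottsSimplex lam (M.post y))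
    ((continuous_pottsSimplex lam).measurable.comp M.measurable_post) fun i => ?_
  rw [outLaw_noisy]
  change (M.ker ∘ₖ potts lam) i = (M.outLaw.withDensity fun y : M.Out =>
    (q : ℝ≥0∞) * ENNReal.ofReal ((pottsSimplex lam (M.post y)).1 i) : Measure M.Out)
  rw [comp_potts_apply]
  have hm (j) : Measurable fun y => (q : ℝ≥0∞) * ENNReal.ofReal ((M.post y).1 j) :=
    (M.measurable_post_apply j).ennreal_ofReal.const_mul _
  ext E hE
  simp only [Measure.coe_finsetSum, Finset.sum_apply, Measure.smul_apply, smul_eq_mul]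
  have e (y : M.Out) : (q : ℝ≥0∞) * ENNReal.ofReal ((pottsSimplex lam (M.post y)).1 i)
      = ∑ j, ENNReal.ofReal ((lam : ℝ) * (if i = j then 1 else 0) + (1 - lam) / q)
        * (q * ENNReal.ofReal ((M.post y).1 j)) := by
    have e1 : (pottsSimplex lam (M.post y)).1 i
        = ∑ j, ((lam : ℝ) * (if i = j then 1 else 0) + (1 - lam) / q) * (M.post y).1 j := by
      simp [pottsSimplex, pottsMap, add_mul, Finset.sum_add_distrib, Finset.mul_sum]
    rw [e1, ENNReal.ofReal_sum_of_nonneg fun j _ =>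
      mul_nonneg (potts_nonneg lam i j) ((M.post y).2.1 j), Finset.mul_sum]
    refine Finset.sum_congr rfl fun j _ => ?_
    rw [ENNReal.ofReal_mul (potts_nonneg lam i j), mul_left_comm]
  rw [withDensity_apply _ hE]
  simp only [e]
  rw [lintegral_finsetSum _ fun j _ => (hm j).const_mul _]
  refine Finset.sum_congr rfl fun j _ => ?_
  rw [lintegral_const_mul _ (hm j), M.ker_eq_withDensity j, withDensity_apply _ hE]

theorem integral_postLaw_noisy {f : stdSimplex ℝ (Fin q) → ℝ} (hf : Continuous f) :
    ∫ x, f x ∂((M.noisy lam).postLaw : Measure (stdSimplex ℝ (Fin q)))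
      = ∫ x, f (pottsSimplex lam x) ∂(M.postLaw : Measure (stdSimplex ℝ (Fin q))) := by
  rw [Channel.integral_postLaw _ _ hf.measurable,
    Channel.integral_postLaw _ (fun x => f (pottsSimplex lam x))
      (hf.comp (continuous_pottsSimplex lam)).measurable, outLaw_noisy]
  refine integral_congr_ae ?_
  filter_upwards [post_noisy lam M] with y hy
  rw [hy]

variable {M} in
/-- The Hellinger integral of a channel, with respect to the output law of the uniform input. -/
theorem ofReal_bc_self (i j : Fin q) : ENNReal.ofReal (M.bc i j) = ∫⁻ y,
    ((q * ENNReal.ofReal ((M.post y).1 i)) * (q * ENNReal.ofReal ((M.post y).1 j))) ^ (1 / 2 : ℝ)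
      ∂M.outLaw :=
  M.ofReal_bc (f := fun i y => q * ENNReal.ofReal ((M.post y).1 i))
    (fun i => (M.measurable_post_apply i).ennreal_ofReal.const_mul _) M.ker_eq_withDensity i j

theorem ofReal_bc_mk {Y : Type u} [MeasurableSpace Y] (κ : Kernel (Fin q) Y) [IsMarkovKernel κ]
    {μ : Measure Y} [SigmaFinite μ] {f : Fin q → Y → ℝ≥0∞} (hf : ∀ i, Measurable (f i))
    (h : ∀ i, κ i = μ.withDensity (f i)) (i j : Fin q) :
    ENNReal.ofReal (Channel.bc ⟨Y, κ⟩ i j) = ∫⁻ y, (f i y * f j y) ^ (1 / 2 : ℝ) ∂μ :=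
  Channel.ofReal_bc (⟨Y, κ⟩ : Channel.{u} q) hf h i j

/-- Affinities are multiplicative over conditionally independent observations. -/
theorem bc_star (i j : Fin q) : (W.star M).bc i j = W.bc i j * M.bc i j := by
  have hm (M : Channel.{u} q) (j) :
      Measurable fun y => (q : ℝ≥0∞) * ENNReal.ofReal ((M.post y).1 j) :=
    (M.measurable_post_apply j).ennreal_ofReal.const_mul _
  rw [← ENNReal.ofReal_eq_ofReal_iff (Channel.bc_nonneg _ _ _)
    (mul_nonneg (W.bc_nonneg _ _) (M.bc_nonneg _ _)), ENNReal.ofReal_mul (W.bc_nonneg _ _),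
    ofReal_bc_self (M := M), ofReal_bc_self (M := W)]
  refine (ofReal_bc_mk (W.ker ×ₖ M.ker) (μ := W.outLaw.prod M.outLaw)
    (f := fun i (y : W.Out × M.Out) => (q * ENNReal.ofReal ((W.post y.1).1 i))
      * (q * ENNReal.ofReal ((M.post y.2).1 i)))
    (fun i => ((hm W i).comp measurable_fst).mul ((hm M i).comp measurable_snd)) (fun i => by
      rw [Kernel.prod_apply, W.ker_eq_withDensity, M.ker_eq_withDensity,
        prod_withDensity (hm W i) (hm M i)]) i j).trans ?_
  have hp (M : Channel.{u} q) : Measurable fun y => ((q : ℝ≥0∞) * ENNReal.ofReal ((M.post y).1 i)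
      * (q * ENNReal.ofReal ((M.post y).1 j))) ^ (1 / 2 : ℝ) :=
    ((hm M i).mul (hm M j)).pow_const _
  rw [← lintegral_prod_mul (hp W).aemeasurable (hp M).aemeasurable]
  refine lintegral_congr fun y => ?_
  rw [mul_mul_mul_comm, ENNReal.mul_rpow_of_nonneg _ _ (by norm_num)]

theorem ofReal_bc_mixture (N : Channel.{u} q) (i j : Fin q) :
    ENNReal.ofReal (Channel.bc ⟨Σ b, Fin b → N.Out, mixture br.law fun b => starPow N.ker b⟩ i j)
      = ∫⁻ b, ENNReal.ofReal (N.bc i j ^ b) ∂br.law := by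
  have hm (j) : Measurable fun y => (q : ℝ≥0∞) * ENNReal.ofReal ((N.post y).1 j) :=
    (N.measurable_post_apply j).ennreal_ofReal.const_mul _
  have hprod (b : ℕ) (i) : Measurable fun c : Fin b → N.Out =>
      ∏ k, (q : ℝ≥0∞) * ENNReal.ofReal ((N.post (c k)).1 i) :=
    Finset.measurable_prod _ fun k _ => (hm i).comp (measurable_pi_apply k)
  have hsig (i) : Measurable fun z : Σ b, Fin b → N.Out =>
      ∏ k, (q : ℝ≥0∞) * ENNReal.ofReal ((N.post (z.2 k)).1 i) :=
    measurable_sigma fun b => hprod b i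
  refine (ofReal_bc_mk (mixture br.law fun b => starPow N.ker b)
    (μ := sigmaMeasure br.law fun b => Measure.pi fun _ : Fin b => N.outLaw) hsig (fun i => by
      change sigmaMeasure br.law (fun b => Measure.pi fun _ : Fin b => N.ker i) = _
      rw [← sigmaMeasure_withDensity _ fun b => hprod b i]
      congr 1
      funext b
      have hp : IsProbabilityMeasure
          (N.outLaw.withDensity fun y => (q : ℝ≥0∞) * ENNReal.ofReal ((N.post y).1 i)) := by
        rw [← N.ker_eq_withDensity i]; infer_instance
      rw [← pi_withDensity _ (hm i), N.ker_eq_withDensity i]) i j).trans ?_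
  refine (lintegral_sigmaMeasure _ (((hsig i).mul (hsig j)).pow_const _)).trans ?_
  refine lintegral_congr fun b => ?_
  rw [ENNReal.ofReal_pow (N.bc_nonneg i j), ofReal_bc_self]
  have e (c : Fin b → N.Out) : ((∏ k, (q : ℝ≥0∞) * ENNReal.ofReal ((N.post (c k)).1 i))
      * ∏ k, (q : ℝ≥0∞) * ENNReal.ofReal ((N.post (c k)).1 j)) ^ (1 / 2 : ℝ)
      = ∏ k, ((q : ℝ≥0∞) * ENNReal.ofReal ((N.post (c k)).1 i)
        * (q * ENNReal.ofReal ((N.post (c k)).1 j))) ^ (1 / 2 : ℝ) := by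
    rw [← Finset.prod_mul_distrib, ENNReal.prod_rpow_of_nonneg (by norm_num)]
  refine (lintegral_congr e).trans ?_
  refine (lintegral_pi_prod (fun _ : Fin b => N.outLaw)
    fun _ => ((hm i).mul (hm j)).pow_const _).trans ?_
  simp

/-- The generating function of the offspring distribution governs the affinities of the belief
propagation operator. -/
theorem ofReal_bc_bp (i j : Fin q) : ENNReal.ofReal ((bp lam br M).bc i j)
    = ∫⁻ b, ENNReal.ofReal ((M.noisy lam).bc i j ^ b) ∂br.law :=
  ofReal_bc_mixture br (M.noisy lam) i j

end Ops

/-! ### Monotonicity under degradation and symmetry -/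

section Degradation

variable {q : ℕ} {P : Channel.{u} q} {Q : Channel.{v} q}

theorem Degraded.refl (P : Channel.{u} q) : Degraded P P :=
  ⟨Kernel.id, inferInstance, by rw [Kernel.id_comp]⟩

theorem Degraded.trans {R : Channel.{w} q}
    (h₁ : Degraded P Q) (h₂ : Degraded Q R) : Degraded P R := by
  obtain ⟨D, hD, h⟩ := h₁
  obtain ⟨D', hD', h'⟩ := h₂
  exact ⟨D ∘ₖ D', inferInstance, by rw [h, h', Kernel.comp_assoc]⟩

theorem Degraded.of_map {f : Q.Out → P.Out} (hf : Measurable f) (h : P.ker = Q.ker.map f) :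
    Degraded P Q :=
  ⟨Kernel.deterministic f hf, inferInstance, by rw [h, Kernel.deterministic_comp_eq_map]⟩

/-- Every channel is a degradation of the noiseless one. -/
theorem degraded_ident (P : Channel.{u} q) : Degraded P (Channel.ident q) :=
  ⟨P.ker, P.markov, (Kernel.comp_id _).symm⟩

theorem Degraded.noisy [NeZero q] (lam : PottsParam q) (h : Degraded P Q) :
    Degraded (P.noisy lam) (Q.noisy lam) := by
  obtain ⟨D, hD, h⟩ := h
  refine ⟨D, hD, ?_⟩
  change P.ker ∘ₖ potts lam = D ∘ₖ (Q.ker ∘ₖ potts lam)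
  rw [h, Kernel.comp_assoc]

theorem Degraded.star {W : Channel.{u} q} {W' : Channel.{v} q} (hW : Degraded W W')
    (h : Degraded P Q) : Degraded (W.star P) (W'.star Q) := by
  obtain ⟨D, hD, h⟩ := h
  obtain ⟨D', hD', h'⟩ := hW
  refine ⟨D' ∥ₖ D, (inferInstance : IsMarkovKernel (D' ∥ₖ D)), ?_⟩
  change W.ker ×ₖ P.ker = (D' ∥ₖ D) ∘ₖ (W'.ker ×ₖ Q.ker)
  rw [Kernel.parallelComp_comp_prod, h, h']

/-- Independent applications of a kernel to the entries of a tuple. -/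
def piKernel {Y : Type u} {Z : Type v} [MeasurableSpace Y] [MeasurableSpace Z] (D : Kernel Y Z)
    [IsMarkovKernel D] (b : ℕ) : Kernel (Fin b → Y) (Fin b → Z) where
  toFun c := Measure.pi fun k => D (c k)
  measurable' := by
    refine .measure_of_isPiSystem_of_isProbabilityMeasure generateFrom_pi.symm isPiSystem_pi ?_
    rintro _ ⟨s, hs, rfl⟩
    simp only [Measure.pi_pi]
    exact Finset.measurable_prod _ fun k _ =>
      (D.measurable_coe (hs k (Set.mem_univ k))).comp (measurable_pi_apply k)

theorem piKernel_comp {Y : Type u} {Z : Type v} [MeasurableSpace Y] [MeasurableSpace Z]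
    (D : Kernel Y Z) [IsMarkovKernel D] (b : ℕ) (μ : Measure Y) [IsProbabilityMeasure μ] :
    piKernel D b ∘ₘ (Measure.pi fun _ => μ) = Measure.pi fun _ => D ∘ₘ μ := by
  refine (Measure.pi_eq fun s hs => ?_).symm
  rw [Measure.bind_apply (MeasurableSet.univ_pi hs) (piKernel D b).measurable.aemeasurable]
  have e (c : Fin b → Y) : piKernel D b c (Set.univ.pi s) = ∏ k, D (c k) (s k) :=
    Measure.pi_pi _ _
  simp only [e]
  rw [lintegral_pi_prod (fun _ => μ) fun k => D.measurable_coe (hs k)]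
  exact Finset.prod_congr rfl fun k _ =>
    (Measure.bind_apply (hs k) D.measurable.aemeasurable).symm

theorem Degraded.mixture (ν : Measure ℕ) (h : Degraded P Q) :
    ∃ K : Kernel (Σ b, Fin b → Q.Out) (Σ b, Fin b → P.Out), IsMarkovKernel K ∧
      mixture ν (fun b => starPow P.ker b) = K ∘ₖ mixture ν (fun b => starPow Q.ker b) := by
  obtain ⟨D, hD, h⟩ := h
  let K : Kernel (Σ b, Fin b → Q.Out) (Σ b, Fin b → P.Out) :=
    { toFun := fun z => (piKernel D z.1 z.2).map (Sigma.mk z.1)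
      measurable' := measurable_sigma fun b =>
        (Measure.measurable_map _ (measurable_sigmaMk' b)).comp (piKernel D b).measurable }
  have hK : IsMarkovKernel K := ⟨fun z => by
    have : IsProbabilityMeasure (Measure.pi fun k => D (z.2 k)) := inferInstance
    exact Measure.isProbabilityMeasure_map (μ := Measure.pi fun k => D (z.2 k))
      (measurable_sigmaMk' z.1).aemeasurable⟩
  refine ⟨K, hK, ?_⟩
  ext x E hE
  have hx : P.ker x = D ∘ₘ Q.ker x := by rw [h, Kernel.comp_apply]
  have hE' (b : ℕ) : MeasurableSet (Sigma.mk b ⁻¹' E) := measurable_sigmaMk' b hE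
  rw [Kernel.comp_apply' _ _ _ hE, mixture_apply, mixture_apply,
    ← lintegral_indicator_one hE, lintegral_sigmaMeasure _ (measurable_one.indicator hE),
    lintegral_sigmaMeasure _ (K.measurable_coe hE)]
  refine lintegral_congr fun b => ?_
  have e1 : (fun y => E.indicator (1 : (Σ b, Fin b → P.Out) → ℝ≥0∞) ⟨b, y⟩)
      = (Sigma.mk b ⁻¹' E).indicator 1 := rfl
  rw [e1, lintegral_indicator_one (hE' b)]
  change (Measure.pi fun _ : Fin b => P.ker x)
      ((fun c : Fin b → P.Out => (⟨b, c⟩ : Σ b, Fin b → P.Out)) ⁻¹' E)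
    = ∫⁻ c, K ⟨b, c⟩ E ∂(Measure.pi fun _ : Fin b => Q.ker x)
  rw [hx, ← piKernel_comp D b (Q.ker x),
    Measure.bind_apply (hE' b) (piKernel D b).measurable.aemeasurable]
  exact lintegral_congr fun c => (Measure.map_apply (measurable_sigmaMk' b) hE).symm

theorem Degraded.bp [NeZero q] (lam : PottsParam q) (br : Branching) (h : Degraded P Q) :
    Degraded (bp lam br P) (bp lam br Q) :=
  (h.noisy lam).mixture br.law

theorem Degraded.bc_le [NeZero q] (h : Degraded P Q) (i j : Fin q) : Q.bc i j ≤ P.bc i j :=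
  mul_le_mul_of_nonneg_left (h.integral_le (concaveOn_sqrt_mul i j)
    (((continuous_apply i).mul (continuous_apply j)).sqrt).continuousOn) (Nat.cast_nonneg _)

end Degradation

section Symmetry

variable {q : ℕ}

/-- The channel with its input alphabet permuted. -/
def Channel.relabel (M : Channel.{u} q) (τ : Equiv.Perm (Fin q)) : Channel.{u} q where
  Out := M.Out
  ker := M.ker.comap τ .of_discrete

/-- A weak form of the symmetry of a channel: every permutation of the input alphabet can be
simulated by processing the output. Unlike the existence of a group action on the outputs, it is
immediately preserved by all operations that are monotone under degradation. -/
def Channel.IsSymm (M : Channel.{u} q) : Prop := ∀ τ, Degraded (M.relabel τ) M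

theorem Degraded.relabel {P : Channel.{u} q} {Q : Channel.{v} q} (h : Degraded P Q)
    (τ : Equiv.Perm (Fin q)) : Degraded (P.relabel τ) (Q.relabel τ) := by
  obtain ⟨D, hD, h⟩ := h
  refine ⟨D, hD, ?_⟩
  ext x : 1
  change P.ker (τ x) = (D ∘ₖ (Q.ker.comap τ .of_discrete)) x
  rw [h, Kernel.comp_apply, Kernel.comp_apply, Kernel.comap_apply]

theorem Channel.IsFMS.isSymm {P : Channel.{u} q} (h : P.IsFMS) : P.IsSymm := by
  obtain ⟨ι, hm, hι⟩ := h
  intro τ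
  have h1 : P.ker.comap τ .of_discrete = P.ker.map (ι τ) := by
    ext x E hE
    rw [Kernel.comap_apply, Kernel.map_apply' _ (hm τ) _ hE, hι _ (hm τ hE) x τ,
      Set.image_preimage_eq _ (ι τ).surjective]
  exact Degraded.of_map (hm τ) h1

theorem isSymm_ident : (Channel.ident q).IsSymm := fun _ => degraded_ident _

theorem Channel.IsSymm.star {W M : Channel.{u} q} (hW : W.IsSymm) (hM : M.IsSymm) :
    (W.star M).IsSymm := by
  intro τ
  obtain ⟨D, hD, h⟩ := (hW τ).star (hM τ)
  refine ⟨D, hD, Eq.trans ?_ h⟩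
  ext x : 1
  change (W.ker ×ₖ M.ker) (τ x) = ((W.relabel τ).ker ×ₖ (M.relabel τ).ker) x
  rw [Kernel.prod_apply, Kernel.prod_apply]
  rfl

theorem relabel_noisy_ker [NeZero q] (lam : PottsParam q) (M : Channel.{u} q)
    (τ : Equiv.Perm (Fin q)) (i : Fin q) :
    (M.noisy lam).ker (τ i) = ((M.relabel τ).noisy lam).ker i := by
  change (M.ker ∘ₖ potts lam) (τ i) = ((M.relabel τ).ker ∘ₖ potts lam) i
  rw [comp_potts_apply, comp_potts_apply, ← Equiv.sum_comp τ]
  simp only [EmbeddingLike.apply_eq_iff_eq]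
  rfl

theorem Channel.IsSymm.noisy [NeZero q] (lam : PottsParam q) {M : Channel.{u} q}
    (hM : M.IsSymm) : (M.noisy lam).IsSymm := by
  intro τ
  obtain ⟨D, hD, h⟩ := (hM τ).noisy lam
  exact ⟨D, hD, Eq.trans (Kernel.ext fun i => relabel_noisy_ker lam M τ i) h⟩

theorem Channel.IsSymm.bp [NeZero q] (lam : PottsParam q) (br : Branching) {M : Channel.{u} q}
    (hM : M.IsSymm) : (bp lam br M).IsSymm := by
  intro τ
  obtain ⟨D, hD, h⟩ := (hM τ).bp lam br
  refine ⟨D, hD, Eq.trans (Kernel.ext fun i => ?_) h⟩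
  change sigmaMeasure br.law (fun b => Measure.pi fun _ : Fin b => (M.noisy lam).ker (τ i))
    = sigmaMeasure br.law (fun b => Measure.pi fun _ : Fin b => ((M.relabel τ).noisy lam).ker i)
  rw [relabel_noisy_ker]
  rfl

variable [NeZero q]

theorem bc_relabel (M : Channel.{u} q) (τ : Equiv.Perm (Fin q)) (i j : Fin q) :
    (M.relabel τ).bc i j = M.bc (τ i) (τ j) := by
  rw [← ENNReal.ofReal_eq_ofReal_iff (Channel.bc_nonneg _ _ _) (Channel.bc_nonneg _ _ _),
    ofReal_bc_self (M := M)]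
  exact ofReal_bc_mk (M.ker.comap τ .of_discrete) (μ := M.outLaw)
    (f := fun i y => q * ENNReal.ofReal ((M.post y).1 (τ i)))
    (fun i => (M.measurable_post_apply _).ennreal_ofReal.const_mul _)
    (fun i => M.ker_eq_withDensity (τ i)) i j

/-- For a symmetric channel, the affinity does not depend on the pair of input letters. -/
theorem Channel.IsSymm.bc_eq {M : Channel.{u} q} (h : M.IsSymm) {i j k l : Fin q} (hij : i ≠ j)
    (hkl : k ≠ l) : M.bc i j = M.bc k l := by
  have key {i j k l : Fin q} (hij : i ≠ j) (hkl : k ≠ l) : M.bc i j ≤ M.bc k l := by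
    obtain ⟨τ, h1, h2⟩ : ∃ τ : Equiv.Perm (Fin q), τ i = k ∧ τ j = l := by
      refine ⟨(Equiv.swap i k).trans (Equiv.swap (Equiv.swap i k j) l), ?_, by simp⟩
      have h1 : k ≠ Equiv.swap i k j := by
        intro h
        have := congrArg (Equiv.swap i k) h
        simp at this
        exact hij this
      simp [Equiv.swap_apply_of_ne_of_ne h1 hkl]
    have := (h τ).bc_le i j
    rwa [bc_relabel, h1, h2] at this
  exact le_antisymm (key hij hkl) (key hkl hij)

theorem bc_self (M : Channel.{u} q) (i : Fin q) : M.bc i i = 1 := by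
  rw [← ENNReal.ofReal_eq_ofReal_iff (Channel.bc_nonneg _ _ _) zero_le_one, ofReal_bc_self,
    ENNReal.ofReal_one]
  have e (y : M.Out) : ((q : ℝ≥0∞) * ENNReal.ofReal ((M.post y).1 i)
      * (q * ENNReal.ofReal ((M.post y).1 i))) ^ (1 / 2 : ℝ)
      = q * ENNReal.ofReal ((M.post y).1 i) := by
    rw [← sq, ← ENNReal.rpow_natCast, ← ENNReal.rpow_mul]; norm_num
  simp only [e]
  rw [← setLIntegral_univ, ← withDensity_apply _ MeasurableSet.univ, ← M.ker_eq_withDensity i,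
    measure_univ]

theorem bc_le_one (M : Channel.{u} q) (i j : Fin q) : M.bc i j ≤ 1 := by
  have h1 : Degraded (⟨Unit, Kernel.const _ (Measure.dirac ())⟩ : Channel.{0} q) M :=
    Degraded.of_map (f := fun _ => ()) measurable_const (by
      ext x : 1
      rw [Kernel.map_apply _ measurable_const, Measure.map_const]
      simp)
  refine (h1.bc_le i j).trans ?_
  rw [← ENNReal.ofReal_le_ofReal_iff zero_le_one, ENNReal.ofReal_one]
  rw [ofReal_bc_mk (Kernel.const _ (Measure.dirac ())) (μ := Measure.dirac ()) (f := fun _ _ => 1)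
    (fun _ => measurable_const) (fun i => by simp) i j]
  simp

theorem integral_phi (M : Channel.{u} q) :
    ∫ x, phi x.1 ∂(M.postLaw : Measure (stdSimplex ℝ (Fin q)))
      = (q : ℝ)⁻¹ * ∑ i, ∑ j, M.bc i j := by
  have hq : (q : ℝ) ≠ 0 := by exact_mod_cast NeZero.ne q
  have hc (i j : Fin q) : Continuous fun x : stdSimplex ℝ (Fin q) => √(x.1 i * x.1 j) :=
    ((continuous_coord i).mul (continuous_coord j)).sqrt
  have e (x : stdSimplex ℝ (Fin q)) : phi x.1 = ∑ i, ∑ j, √(x.1 i * x.1 j) := by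
    rw [phi, sq, Finset.sum_mul_sum]
    simp only [Real.sqrt_mul (x.2.1 _)]
  simp only [e, Channel.bc, ← Finset.mul_sum]
  rw [inv_mul_cancel_left₀ hq, integral_finsetSum _ fun i _ => integrable_of_continuous _
    (continuous_finsetSum _ fun j _ => hc i j)]
  exact Finset.sum_congr rfl fun i _ =>
    integral_finsetSum _ fun j _ => integrable_of_continuous _ (hc i j)

theorem Channel.IsSymm.integral_phi {M : Channel.{u} q} (h : M.IsSymm) {i j : Fin q}
    (hij : i ≠ j) : ∫ x, phi x.1 ∂(M.postLaw : Measure (stdSimplex ℝ (Fin q)))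
      = 1 + (q - 1) * M.bc i j := by
  have hq : (q : ℝ) ≠ 0 := by exact_mod_cast NeZero.ne q
  have e (k l : Fin q) : M.bc k l = (if k = l then 1 - M.bc i j else 0) + M.bc i j := by
    split_ifs with hkl
    · rw [hkl, bc_self]; ring
    · rw [zero_add, h.bc_eq hkl hij]
  rw [PottsBP.integral_phi]
  conv_lhs => enter [2, 2, k, 2, l]; rw [e k l]
  simp only [Finset.sum_add_distrib, Finset.sum_ite_eq, Finset.mem_univ, if_true,
    Finset.sum_const, Finset.card_univ, Fintype.card_fin, nsmul_eq_mul]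
  field_simp
  ring

/-- Along a degradation of symmetric channels, the increment of the second moment of the posterior
is controlled by that of the affinity. -/
theorem sqMoment_sub_le {P : Channel.{u} q} {Q : Channel.{v} q} (h : Degraded P Q)
    (hP : P.IsSymm) (hQ : Q.IsSymm) {i j : Fin q} (hij : i ≠ j) :
    Q.sqMoment - P.sqMoment ≤ 4 * (q - 1) * (P.bc i j - Q.bc i j) := by
  have hc : Continuous fun x : stdSimplex ℝ (Fin q) => phi x.1 :=
    continuous_phi.comp continuous_subtype_val
  have h1 := h.integral_le concaveOn_phi_add (continuous_phi.add ((continuous_finsetSum _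
    fun i _ => (continuous_apply i).pow 2).div_const 4)).continuousOn
  rw [integral_add (integrable_of_continuous _ hc)
      ((integrable_of_continuous _ continuous_sum_sq).div_const 4),
    integral_add (integrable_of_continuous _ hc)
      ((integrable_of_continuous _ continuous_sum_sq).div_const 4), integral_div, integral_div,
    hP.integral_phi hij, hQ.integral_phi hij] at h1
  rw [Channel.sqMoment, Channel.sqMoment]
  linarith

/-- The contraction of the gap between affinities under the Potts channel. -/
theorem bc_noisy_sub_le (hq : 2 ≤ q) (lam : PottsParam q) (hC : CH q lam ≠ ⊤)
    {P : Channel.{u} q} {Q : Channel.{v} q} (h : Degraded P Q)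
    (hP : P.IsSymm) (hQ : Q.IsSymm) {i j : Fin q} (hij : i ≠ j) :
    (P.noisy lam).bc i j - (Q.noisy lam).bc i j
      ≤ (lam : ℝ) ^ 2 * (CH q lam).toReal * (P.bc i j - Q.bc i j) := by
  have hc : Continuous fun x : stdSimplex ℝ (Fin q) => phi x.1 :=
    continuous_phi.comp continuous_subtype_val
  have hK : Continuous fun x : stdSimplex ℝ (Fin q) => phi (pottsMap lam x.1) :=
    hc.comp (continuous_pottsSimplex lam)
  have hK' : Continuous (pottsMap (q := q) lam) := by unfold pottsMap; fun_prop
  have h1 := h.integral_le (concaveOn_phi_sub hq lam hC) ((continuous_const.mul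
    continuous_phi).sub (continuous_phi.comp hK')).continuousOn
  rw [integral_sub ((integrable_of_continuous _ hc).const_mul _) (integrable_of_continuous _ hK),
    integral_sub ((integrable_of_continuous _ hc).const_mul _) (integrable_of_continuous _ hK),
    integral_const_mul, integral_const_mul] at h1
  have eQ := integral_postLaw_noisy lam Q hc
  have eP := integral_postLaw_noisy lam P hc
  rw [(hP.noisy lam).integral_phi hij] at eP
  rw [(hQ.noisy lam).integral_phi hij] at eQ
  change _ - ∫ x, phi (pottsSimplex lam x).1 ∂(Q.postLaw : Measure (stdSimplex ℝ (Fin q)))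
    ≤ _ - ∫ x, phi (pottsSimplex lam x).1 ∂(P.postLaw : Measure (stdSimplex ℝ (Fin q))) at h1
  rw [← eQ, ← eP, hP.integral_phi hij, hQ.integral_phi hij] at h1
  have hq1 : (0 : ℝ) < q - 1 := by
    have : (2 : ℝ) ≤ q := by exact_mod_cast hq
    linarith
  refine le_of_mul_le_mul_left ?_ hq1
  linarith

theorem bhattacharyya_eq (W : Channel.{u} q) (e : Fin 2 ↪ Fin q) :
    (W.restrict e).bhattacharyya = W.bc (e 0) (e 1) := by
  have h1 : (W.restrict e).bhattacharyya = (W.restrict e).bc 0 1 := by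
    rw [Channel.bhattacharyya, integral_const_mul, Channel.bc, Nat.cast_ofNat]
    congr 2
    funext x
    have hx : x.1 0 + x.1 1 = 1 := by rw [← Fin.sum_univ_two]; exact x.2.2
    rcases le_total (x.1 0) (x.1 1) with h | h
    · rw [min_eq_left h, ← hx, add_sub_cancel_left]
    · rw [min_eq_right h, ← hx, add_sub_cancel_right, mul_comm]
  rw [h1, ← ENNReal.ofReal_eq_ofReal_iff (Channel.bc_nonneg _ _ _) (Channel.bc_nonneg _ _ _),
    ofReal_bc_self (M := W)]
  exact ofReal_bc_mk (W.ker.comap e .of_discrete) (μ := W.outLaw)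
    (f := fun i y => q * ENNReal.ofReal ((W.post y).1 (e i)))
    (fun i => (W.measurable_post_apply _).ennreal_ofReal.const_mul _)
    (fun i => W.ker_eq_withDensity (e i)) 0 1

end Symmetry

/-! ### Moments and generating function of the offspring distribution -/

section Branching

theorem hasSum_poisson_shift (r : ℝ≥0) {f : ℕ → ℝ} {s : ℝ}
    (h : HasSum (fun n : ℕ => Real.exp (-r) * r ^ n / (n.factorial : ℝ) * f n) s) :
    HasSum (fun n : ℕ => Real.exp (-r) * r ^ n / (n.factorial : ℝ) * (n * f (n - 1))) (r * s) := by
  have h1 : HasSum (fun n : ℕ => Real.exp (-r) * (r : ℝ) ^ (n + 1) / ((n + 1).factorial : ℝ)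
      * (((n + 1 : ℕ) : ℝ) * f (n + 1 - 1))) (r * s) := by
    have e : (fun n : ℕ => Real.exp (-r) * (r : ℝ) ^ (n + 1) / ((n + 1).factorial : ℝ)
        * (((n + 1 : ℕ) : ℝ) * f (n + 1 - 1)))
        = fun n : ℕ => r * (Real.exp (-r) * r ^ n / (n.factorial : ℝ) * f n) := by
      funext n
      rw [Nat.factorial_succ, Nat.add_sub_cancel, pow_succ]
      push_cast
      have : (n.factorial : ℝ) ≠ 0 := by exact_mod_cast n.factorial_ne_zero
      have : (n : ℝ) + 1 ≠ 0 := by positivity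
      field_simp
    rw [e]
    exact h.mul_left _
  have := (hasSum_nat_add_iff (f := fun n : ℕ =>
    Real.exp (-r) * (r : ℝ) ^ n / (n.factorial : ℝ) * (n * f (n - 1))) 1).1 h1
  simpa using this

theorem integral_poisson_of_hasSum (r : ℝ≥0) {f : ℕ → ℝ} (hf : ∀ n, 0 ≤ f n) {s : ℝ}
    (h : HasSum (fun n : ℕ => Real.exp (-r) * r ^ n / (n.factorial : ℝ) * f n) s) :
    Integrable f (poissonMeasure r) ∧ ∫ n, f n ∂poissonMeasure r = s := by
  refine ⟨integrable_poissonMeasure_iff.2 ?_, ?_⟩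
  · simpa only [Real.norm_of_nonneg (hf _)] using h.summable
  · rw [integral_poissonMeasure]
    exact h.tsum_eq

/-- The second factorial moment `E[b (b - 1)]` of the offspring distribution. -/
def Branching.fact2 : Branching → ℝ
  | .regular d => d * (d - 1)
  | .poisson d => d ^ 2

theorem Branching.integral_cast (br : Branching) :
    Integrable (fun b : ℕ => (b : ℝ)) br.law ∧ ∫ b : ℕ, (b : ℝ) ∂br.law = br.mean := by
  cases br with
  | regular d =>
    refine ⟨integrable_dirac (by simp), ?_⟩
    simp [Branching.law, Branching.mean]
  | poisson d =>
    have h := hasSum_poisson_shift d (f := fun _ => 1) (by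
      simpa using hasSum_one_poissonMeasure d)
    simp only [mul_one] at h
    exact integral_poisson_of_hasSum d (fun n => Nat.cast_nonneg n) h

theorem Branching.integral_fact2 (br : Branching) :
    Integrable (fun b : ℕ => (b : ℝ) * (b - 1)) br.law
      ∧ ∫ b : ℕ, (b : ℝ) * (b - 1) ∂br.law = br.fact2 := by
  cases br with
  | regular d =>
    refine ⟨integrable_dirac enorm_lt_top, ?_⟩
    simp [Branching.law, Branching.fact2]
  | poisson d =>
    have h := hasSum_poisson_shift d (hasSum_poisson_shift d (f := fun _ => 1) (by
      simpa using hasSum_one_poissonMeasure d))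
    have e (n : ℕ) : (n : ℝ) * ((n - 1 : ℕ) : ℝ) = n * (n - 1) := by
      cases n <;> simp
    simp only [mul_one, e] at h
    have hn (n : ℕ) : (0 : ℝ) ≤ n * (n - 1) := by
      rw [← e]; positivity
    have := integral_poisson_of_hasSum d hn h
    rwa [← sq] at this

/-- The generating function `E[z ^ b]` of the offspring distribution. -/
def Branching.gen : Branching → ℝ → ℝ
  | .regular d, z => z ^ d
  | .poisson d, z => Real.exp (d * (z - 1))

theorem Branching.gen_nonneg (br : Branching) {z : ℝ} (hz : 0 ≤ z) : 0 ≤ br.gen z := by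
  cases br with
  | regular d => exact pow_nonneg hz d
  | poisson d => exact (Real.exp_pos _).le

theorem Branching.lintegral_pow (br : Branching) {z : ℝ} (hz : 0 ≤ z) :
    ∫⁻ b, ENNReal.ofReal (z ^ b) ∂br.law = ENNReal.ofReal (br.gen z) := by
  cases br with
  | regular d => simp [Branching.law, Branching.gen]
  | poisson d =>
    have h : HasSum (fun n : ℕ => Real.exp (-d) * d ^ n / (n.factorial : ℝ) * z ^ n)
        (Real.exp (d * (z - 1))) := by
      have h1 := (NormedSpace.expSeries_div_hasSum_exp ((d : ℝ) * z)).mul_left (Real.exp (-d))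
      rw [← Real.exp_eq_exp_ℝ, ← Real.exp_add] at h1
      have e1 : (fun n : ℕ => Real.exp (-d) * (d : ℝ) ^ n / (n.factorial : ℝ) * z ^ n)
          = fun n : ℕ => Real.exp (-d) * (((d : ℝ) * z) ^ n / (n.factorial : ℝ)) := by
        funext n; rw [mul_pow]; ring
      have e2 : (d : ℝ) * (z - 1) = -d + d * z := by ring
      rw [e1, e2]
      exact h1
    obtain ⟨h1, h2⟩ := integral_poisson_of_hasSum d (fun n => pow_nonneg hz n) h
    change ∫⁻ b, ENNReal.ofReal (z ^ b) ∂poissonMeasure d = ENNReal.ofReal (Real.exp (d * (z - 1)))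
    rw [← ofReal_integral_eq_lintegral_ofReal h1 (ae_of_all _ fun n => pow_nonneg hz n), h2]

theorem pow_sub_pow_le_mul {z w : ℝ} (hz : 0 ≤ z) (hzw : z ≤ w) (n : ℕ) :
    w ^ (n + 1) - z ^ (n + 1) ≤ (n + 1) * w ^ n * (w - z) := by
  induction n with
  | zero => simp
  | succ n ih =>
    have h1 : z ^ (n + 1) ≤ w ^ (n + 1) := pow_le_pow_left₀ hz hzw _
    have hw := hz.trans hzw
    calc w ^ (n + 1 + 1) - z ^ (n + 1 + 1)
        = w * (w ^ (n + 1) - z ^ (n + 1)) + z ^ (n + 1) * (w - z) := by ring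
      _ ≤ w * ((n + 1) * w ^ n * (w - z)) + w ^ (n + 1) * (w - z) := by
          have := sub_nonneg.2 hzw
          gcongr
      _ = _ := by push_cast; ring

/-- The mean value bound for the generating function. In the regular case
`z ^ (d - 1) ≤ exp (-(d - 1) (1 - z))` brings the derivative into the form of the Poisson case. -/
theorem Branching.gen_sub_le (br : Branching) (hbr : 0 < br.mean) {z w : ℝ} (hz : 0 ≤ z)
    (hzw : z ≤ w) : br.gen w - br.gen z
      ≤ br.mean * Real.exp (-(br.fact2 / br.mean * (1 - w))) * (w - z) := by
  cases br with
  | regular d =>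
    simp only [Branching.mean, Branching.gen, Branching.fact2] at hbr ⊢
    obtain ⟨n, rfl⟩ : ∃ n, d = n + 1 := ⟨d - 1, by
      have : 0 < d := by exact_mod_cast hbr
      omega⟩
    refine (pow_sub_pow_le_mul hz hzw n).trans ?_
    have h0 : ((n + 1 : ℕ) : ℝ) ≠ 0 := hbr.ne'
    rw [mul_div_cancel_left₀ _ h0]
    push_cast
    have h1 : w ^ n ≤ Real.exp (-(((n : ℝ) + 1 - 1) * (1 - w))) := by
      have h2 : w ≤ Real.exp (w - 1) := by linarith [Real.add_one_le_exp (w - 1)]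
      refine (pow_le_pow_left₀ (hz.trans hzw) h2 n).trans_eq ?_
      rw [← Real.exp_nat_mul]
      congr 1; ring
    have := sub_nonneg.2 hzw
    gcongr
  | poisson d =>
    simp only [Branching.mean, Branching.gen, Branching.fact2] at hbr ⊢
    have e : (d : ℝ) ^ 2 / d = d := by field_simp
    rw [e]
    have h1 := Real.add_one_le_exp (d * (z - 1) - d * (w - 1))
    have h2 : Real.exp (d * (z - 1)) = Real.exp (d * (w - 1))
        * Real.exp (d * (z - 1) - d * (w - 1)) := by rw [← Real.exp_add]; congr 1; ring
    have h3 : -((d : ℝ) * (1 - w)) = d * (w - 1) := by ring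
    rw [h3, h2]
    have h4 := mul_le_mul_of_nonneg_left h1 (Real.exp_pos (d * (w - 1))).le
    linarith

theorem bc_bp {q : ℕ} [NeZero q] (lam : PottsParam q) (br : Branching) (M : Channel.{u} q)
    (i j : Fin q) : (bp lam br M).bc i j = br.gen ((M.noisy lam).bc i j) := by
  rw [← ENNReal.ofReal_eq_ofReal_iff (Channel.bc_nonneg _ _ _)
    (br.gen_nonneg (Channel.bc_nonneg _ _ _)), ofReal_bc_bp,
    br.lintegral_pow (Channel.bc_nonneg _ _ _)]

end Branching

/-! ### Linear estimators -/

section Estimator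

variable {q : ℕ}

/-- There is a real-valued function of the output of the channel whose conditional mean and second
moment given the input `i` are `m i` and `s i`. -/
def HasEstimator (M : Channel.{u} q) (m s : Fin q → ℝ) : Prop :=
  ∃ T : M.Out → ℝ, Measurable T ∧ ∀ i, MemLp T 2 (M.ker i) ∧
    ∫ y, T y ∂M.ker i = m i ∧ ∫ y, T y ^ 2 ∂M.ker i = s i

theorem HasEstimator.of_map {P : Channel.{u} q} {Q : Channel.{v} q} {f : Q.Out → P.Out}
    (hf : Measurable f) (h : P.ker = Q.ker.map f) {m s : Fin q → ℝ} (hP : HasEstimator P m s) :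
    HasEstimator Q m s := by
  obtain ⟨T, hT, h1⟩ := hP
  refine ⟨T ∘ f, hT.comp hf, fun i => ?_⟩
  obtain ⟨h2, h3, h4⟩ := h1 i
  rw [h, Kernel.map_apply _ hf] at h2 h3 h4
  rw [integral_map hf.aemeasurable hT.aestronglyMeasurable] at h3
  rw [integral_map hf.aemeasurable (hT.pow_const 2).aestronglyMeasurable] at h4
  exact ⟨(memLp_map_measure_iff hT.aestronglyMeasurable hf.aemeasurable).1 h2, h3, h4⟩

theorem HasEstimator.star {M : Channel.{u} q} {m s : Fin q → ℝ} (h : HasEstimator M m s)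
    (W : Channel.{u} q) : HasEstimator (W.star M) m s :=
  h.of_map (f := Prod.snd) measurable_snd (by
    change M.ker = (W.ker ×ₖ M.ker).map Prod.snd
    rw [← Kernel.snd_eq, Kernel.snd_prod])

variable [NeZero q]

theorem HasEstimator.noisy (lam : PottsParam q) {M : Channel.{u} q} {m s : Fin q → ℝ}
    (h : HasEstimator M m s) :
    HasEstimator (M.noisy lam) (pottsMap lam m) (pottsMap lam s) := by
  obtain ⟨T, hT, h1⟩ := h
  refine ⟨T, hT, fun i => ?_⟩
  change MemLp T 2 ((M.ker ∘ₖ potts lam) i) ∧ ∫ y, T y ∂((M.ker ∘ₖ potts lam) i) = _ ∧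
    ∫ y, T y ^ 2 ∂((M.ker ∘ₖ potts lam) i) = _
  have hsum {f : M.Out → ℝ} (hf : ∀ j, Integrable f (M.ker j)) :
      Integrable f ((M.ker ∘ₖ potts lam) i) ∧
      ∫ y, f y ∂((M.ker ∘ₖ potts lam) i) = pottsMap lam (fun j => ∫ y, f y ∂M.ker j) i := by
    have h2 (j) : Integrable f
        (ENNReal.ofReal ((lam : ℝ) * (if i = j then 1 else 0) + (1 - lam) / q) • M.ker j) :=
      (hf j).smul_measure ENNReal.ofReal_ne_top
    rw [comp_potts_apply]
    refine ⟨integrable_finsetSum_measure.2 fun j _ => h2 j, ?_⟩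
    rw [integral_finsetSum_measure fun j _ => h2 j]
    simp only [integral_smul_measure, ENNReal.toReal_ofReal (potts_nonneg lam i _)]
    simp [pottsMap, add_mul, Finset.sum_add_distrib, Finset.mul_sum]
  have h3 := hsum fun j => (h1 j).1.integrable one_le_two
  have h4 := hsum fun j => (h1 j).1.integrable_sq
  refine ⟨(memLp_two_iff_integrable_sq hT.aestronglyMeasurable).2 h4.1, ?_, ?_⟩
  · rw [h3.2]; simp only [(h1 _).2.1]
  · rw [h4.2]; simp only [(h1 _).2.2]

theorem pi_sum_moments {Y : Type*} [MeasurableSpace Y] (μ : Measure Y) [IsProbabilityMeasure μ]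
    {T : Y → ℝ} (hT : MemLp T 2 μ) (b : ℕ) :
    MemLp (fun c : Fin b → Y => ∑ k, T (c k)) 2 (Measure.pi fun _ => μ) ∧
    ∫ c : Fin b → Y, ∑ k, T (c k) ∂(Measure.pi fun _ => μ) = b * ∫ y, T y ∂μ ∧
    ∫ c : Fin b → Y, (∑ k, T (c k)) ^ 2 ∂(Measure.pi fun _ => μ)
      = b * ∫ y, T y ^ 2 ∂μ + b * (b - 1) * (∫ y, T y ∂μ) ^ 2 := by
  have hL : MemLp (fun c : Fin b → Y => ∑ k, T (c k)) 2 (Measure.pi fun _ => μ) :=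
    memLp_finsetSum _ fun k _ => hT.comp_measurePreserving (measurePreserving_eval _ k)
  have hE : ∫ c : Fin b → Y, ∑ k, T (c k) ∂(Measure.pi fun _ => μ) = b * ∫ y, T y ∂μ := by
    rw [integral_finsetSum _ fun k _ => integrable_comp_eval (hT.integrable one_le_two)]
    simp only [integral_comp_eval (μ := fun _ : Fin b => μ) hT.1]
    simp
  refine ⟨hL, hE, ?_⟩
  have hv := variance_sum_pi (μ := fun _ : Fin b => μ) (X := fun _ => T) fun _ => hT
  have e : (∑ i : Fin b, fun ω : Fin b → Y => T (ω i)) = fun c => ∑ k, T (c k) := by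
    funext c; simp
  rw [e, variance_eq_sub hL, variance_eq_sub hT, hE] at hv
  simp only [Pi.pow_apply, Finset.sum_const, Finset.card_univ, Fintype.card_fin,
    nsmul_eq_mul] at hv
  linarith

/-- Summing an estimator over the children of a vertex. -/
theorem HasEstimator.bp (lam : PottsParam q) (br : Branching) {M : Channel.{u} q}
    {m s : Fin q → ℝ} (h : HasEstimator M m s) :
    HasEstimator (bp lam br M) (fun i => br.mean * pottsMap lam m i)
      (fun i => br.mean * pottsMap lam s i + br.fact2 * pottsMap lam m i ^ 2) := by
  obtain ⟨T, hT, h1⟩ := h.noisy lam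
  let S : (Σ b, Fin b → (M.noisy lam).Out) → ℝ := fun z => ∑ k, T (z.2 k)
  have hSb (b : ℕ) : Measurable fun c : Fin b → (M.noisy lam).Out => ∑ k, T (c k) :=
    Finset.measurable_fun_sum _ fun k _ => hT.comp (measurable_pi_apply k)
  have hS : Measurable S := measurable_sigma hSb
  refine ⟨S, hS, fun i => ?_⟩
  obtain ⟨h2, h3, h4⟩ := h1 i
  change MemLp S 2 (sigmaMeasure br.law fun b => Measure.pi fun _ : Fin b => (M.noisy lam).ker i) ∧
    ∫ z, S z ∂(sigmaMeasure br.law fun b => Measure.pi fun _ : Fin b => (M.noisy lam).ker i) = _ ∧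
    ∫ z, S z ^ 2 ∂(sigmaMeasure br.law fun b => Measure.pi fun _ : Fin b => (M.noisy lam).ker i) = _
  have hb (b : ℕ) := pi_sum_moments ((M.noisy lam).ker i) h2 b
  have hi : Integrable (fun b : ℕ => (b : ℝ) * pottsMap lam s i
      + b * (b - 1) * pottsMap lam m i ^ 2) br.law :=
    (br.integral_cast.1.mul_const _).add (br.integral_fact2.1.mul_const _)
  have hint : Integrable (fun z => S z ^ 2)
      (sigmaMeasure br.law fun b => Measure.pi fun _ : Fin b => (M.noisy lam).ker i) := by
    refine integrable_sigmaMeasure _ (hS.pow_const 2) (fun b => (hb b).1.integrable_sq) ?_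
    refine hi.congr (ae_of_all _ fun b => ?_)
    have := (hb b).2.2
    rw [h3, h4] at this
    simp only [abs_sq]
    exact this.symm
  have hL := (memLp_two_iff_integrable_sq hS.aestronglyMeasurable).2 hint
  refine ⟨hL, ?_, ?_⟩
  · rw [integral_sigmaMeasure _ hS (hL.integrable one_le_two)]
    have e (b : ℕ) := (hb b).2.1
    rw [h3] at e
    simp only [S, e]
    rw [integral_mul_const, br.integral_cast.2]
  · rw [integral_sigmaMeasure _ (hS.pow_const 2) hint]
    have e (b : ℕ) := (hb b).2.2
    rw [h3, h4] at e
    simp only [S, e]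
    rw [integral_add (br.integral_cast.1.mul_const _) (br.integral_fact2.1.mul_const _),
      integral_mul_const, integral_mul_const, br.integral_cast.2, br.integral_fact2.2]

/-- An estimator that separates two input letters bounds their affinity away from one. -/
theorem HasEstimator.le_one_sub_bc {M : Channel.{u} q} {m s : Fin q → ℝ} (h : HasEstimator M m s)
    {i j : Fin q} {a : ℝ} (hi : m i = a) (hj : m j = -a) (hs : 0 < s i + s j) :
    a ^ 2 / (s i + s j) ≤ 1 - M.bc i j := by
  obtain ⟨T, hT, h1⟩ := h
  have hq : (0 : ℝ) < q := by exact_mod_cast Nat.pos_of_ne_zero (NeZero.ne q)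
  have hm (k) : Measurable fun y => (q : ℝ≥0∞) * ENNReal.ofReal ((M.post y).1 k) :=
    (M.measurable_post_apply k).ennreal_ofReal.const_mul _
  have hfin (k) : ∀ᵐ y ∂M.outLaw, (q : ℝ≥0∞) * ENNReal.ofReal ((M.post y).1 k) < ⊤ :=
    ae_of_all _ fun y => ENNReal.mul_lt_top (ENNReal.natCast_lt_top q) ENNReal.ofReal_lt_top
  have htr (k) (y : M.Out) : ((q : ℝ≥0∞) * ENNReal.ofReal ((M.post y).1 k)).toReal
      = q * (M.post y).1 k := by
    rw [ENNReal.toReal_mul, ENNReal.toReal_natCast, ENNReal.toReal_ofReal ((M.post y).2.1 k)]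
  have hw (k) {f : M.Out → ℝ} (hf : Integrable f (M.ker k)) :
      Integrable (fun y => q * (M.post y).1 k * f y) M.outLaw ∧
      ∫ y, q * (M.post y).1 k * f y ∂M.outLaw = ∫ y, f y ∂M.ker k := by
    rw [M.ker_eq_withDensity k] at hf ⊢
    rw [integral_withDensity_eq_integral_toReal_smul (hm k) (hfin k)]
    have h2 := (integrable_withDensity_iff_integrable_smul' (hm k) (hfin k)).1 hf
    simp only [htr, smul_eq_mul] at h2 ⊢
    exact ⟨h2, trivial⟩
  obtain ⟨hi1, hi2, hi3⟩ := h1 i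
  obtain ⟨hj1, hj2, hj3⟩ := h1 j
  have a1 := hw i (hi1.integrable one_le_two)
  have a2 := hw j (hj1.integrable one_le_two)
  have a3 := hw i hi1.integrable_sq
  have a4 := hw j hj1.integrable_sq
  have a5 := hw i (integrable_const (1 : ℝ))
  have a6 := hw j (integrable_const (1 : ℝ))
  have hc : Continuous fun x : stdSimplex ℝ (Fin q) => √(x.1 i * x.1 j) :=
    ((continuous_coord i).mul (continuous_coord j)).sqrt
  have a7 : Integrable (fun y => √((M.post y).1 i * (M.post y).1 j)) M.outLaw := by
    have := integrable_of_continuous (M.postLaw : Measure (stdSimplex ℝ (Fin q))) hc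
    exact (integrable_map_measure hc.measurable.aestronglyMeasurable
      M.measurable_post.aemeasurable).1 this
  -- The value of `t` that is optimal in the pointwise inequality below.
  set t : ℝ := a / (s i + s j) with ht
  have hpt (y : M.Out) : 2 * t * (q * (M.post y).1 i * T y - q * (M.post y).1 j * T y)
      ≤ 2 * t ^ 2 * (q * (M.post y).1 i * T y ^ 2 + q * (M.post y).1 j * T y ^ 2)
        + (q * (M.post y).1 i * 1 + q * (M.post y).1 j * 1
          - 2 * q * √((M.post y).1 i * (M.post y).1 j)) := by
    have hx := (M.post y).2.1 i
    have hy := (M.post y).2.1 j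
    set x := (M.post y).1 i
    set z := (M.post y).1 j
    have ex := Real.sq_sqrt hx
    have ez := Real.sq_sqrt hy
    rw [Real.sqrt_mul hx]
    have h2 : 2 * t * T y * (x - z) ≤ 2 * t ^ 2 * T y ^ 2 * (x + z) + (x + z - 2 * (√x * √z)) := by
      nth_rewrite 1 2 3 [← ex, ← ez]
      nlinarith [sq_nonneg (t * T y * (√x + √z) - (√x - √z)), sq_nonneg (t * T y * (√x - √z))]
    have h3 := mul_le_mul_of_nonneg_left h2 hq.le
    linarith
  have b1 := (a1.1.sub a2.1).const_mul (2 * t)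
  have b2 := (a3.1.add a4.1).const_mul (2 * t ^ 2)
  have b3 := a5.1.add a6.1
  have b4 := a7.const_mul (2 * (q : ℝ))
  have hI := integral_mono b1 (b2.add (b3.sub b4)) hpt
  have c1 : ∫ y, 2 * t * (q * (M.post y).1 i * T y - q * (M.post y).1 j * T y) ∂M.outLaw
      = 2 * t * (a - -a) := by
    rw [integral_const_mul, integral_sub a1.1 a2.1, a1.2, a2.2, hi2, hj2, hi, hj]
  have c2 : ∫ y, 2 * t ^ 2 * (q * (M.post y).1 i * T y ^ 2 + q * (M.post y).1 j * T y ^ 2) ∂M.outLaw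
      = 2 * t ^ 2 * (s i + s j) := by
    rw [integral_const_mul, integral_add a3.1 a4.1, a3.2, a4.2, hi3, hj3]
  have c3 : ∫ y, (q * (M.post y).1 i * 1 + q * (M.post y).1 j * 1) ∂M.outLaw = 2 := by
    rw [integral_add a5.1 a6.1, a5.2, a6.2]
    simp
    norm_num
  have c4 : ∫ y, 2 * q * √((M.post y).1 i * (M.post y).1 j) ∂M.outLaw = 2 * M.bc i j := by
    rw [integral_const_mul, Channel.bc, M.integral_postLaw _ hc.measurable]; ring
  have c5 := integral_add b2 (b3.sub b4)
  have c6 := integral_sub b3 b4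
  have hI' : 2 * t * (a - -a) ≤ 2 * t ^ 2 * (s i + s j) + (2 - 2 * M.bc i j) := by
    exact c1.symm.trans_le (hI.trans_eq (c5.trans
      (congrArg₂ (· + ·) c2 (c6.trans (congrArg₂ (· - ·) c3 c4)))))
  have e1 : 2 * t * (a - -a) = 4 * (a ^ 2 / (s i + s j)) := by rw [ht]; ring
  have e2 : 2 * t ^ 2 * (s i + s j) = 2 * (a ^ 2 / (s i + s j)) := by
    rw [ht]; field_simp
  rw [e1, e2] at hI'
  linarith

end Estimator

/-! ### The Kesten–Stigum estimate and the decay of the gap -/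

section Gap

theorem tendsto_affine_recursion {x : ℕ → ℝ} {r s : ℝ} (hr : |r| < 1)
    (h : ∀ k, x (k + 1) = r * x k + s) : Tendsto x atTop (𝓝 (s / (1 - r))) := by
  have h1 : 1 - r ≠ 0 := by linarith [(abs_lt.1 hr).2] |> fun h : (0 : ℝ) < 1 - r => h.ne'
  have e (k : ℕ) : x k = r ^ k * (x 0 - s / (1 - r)) + s / (1 - r) := by
    induction k with
    | zero => simp
    | succ k ih => rw [h, ih]; field_simp; ring
  have h2 := ((tendsto_pow_atTop_nhds_zero_of_abs_lt_one hr).mul_const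
    (x 0 - s / (1 - r))).add_const (s / (1 - r))
  rw [zero_mul, zero_add] at h2
  exact h2.congr fun k => (e k).symm

variable {q : ℕ}

theorem PottsParam.abs_le_one (hq : 2 ≤ q) (lam : PottsParam q) : |(lam : ℝ)| ≤ 1 := by
  have h2 : (2 : ℝ) ≤ q := by exact_mod_cast hq
  refine abs_le.2 ⟨le_trans ?_ lam.2.1, lam.2.2⟩
  rw [neg_le_neg_iff, div_le_one (by linarith)]
  linarith

/-- The inverse of `c^H` is positive above the Kesten–Stigum threshold, also for negative `λ`. -/
theorem inv_cH_pos (hq : 2 ≤ q) (lam : PottsParam q) {d : ℝ} (hd : 0 ≤ d)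
    (h : 1 < d * (lam : ℝ) ^ 2) :
    0 < 2 / (q : ℝ) + (q - 2) / q * ((d * (lam : ℝ) ^ 2 - 1) / (d * lam - 1)) := by
  have h2 : (2 : ℝ) ≤ q := by exact_mod_cast hq
  have hab := abs_le.1 (lam.abs_le_one hq)
  have hR : -(1 / ((q : ℝ) - 1)) ≤ (d * (lam : ℝ) ^ 2 - 1) / (d * lam - 1) := by
    have hlow := lam.2.1
    rcases lt_or_ge 0 (lam : ℝ) with hl | hl
    · have h3 : 0 < d * (lam : ℝ) - 1 := by
        have : d * (lam : ℝ) ^ 2 ≤ d * lam := mul_le_mul_of_nonneg_left (by nlinarith) hd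
        linarith
      have h4 : 0 ≤ (d * (lam : ℝ) ^ 2 - 1) / (d * lam - 1) := div_nonneg (by linarith) h3.le
      have h5 : 0 ≤ 1 / ((q : ℝ) - 1) := div_nonneg zero_le_one (by linarith)
      linarith
    · refine hlow.trans ?_
      have h3 : d * (lam : ℝ) - 1 < 0 := by
        have := mul_nonpos_of_nonneg_of_nonpos hd hl
        linarith
      rw [le_div_iff_of_neg h3]
      nlinarith
  have h6 : (0 : ℝ) < q - 1 := by linarith
  have h7 : ((q : ℝ) - 2) / q * -(1 / ((q : ℝ) - 1))
      ≤ (q - 2) / q * ((d * (lam : ℝ) ^ 2 - 1) / (d * lam - 1)) :=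
    mul_le_mul_of_nonneg_left hR (div_nonneg (by linarith) (by linarith))
  have h8 : 2 / (q : ℝ) + (q - 2) / q * -(1 / ((q : ℝ) - 1)) = 1 / (q - 1) := by
    have : (q : ℝ) ≠ 0 := by linarith
    field_simp
    ring
  have h9 : 0 < 1 / ((q : ℝ) - 1) := by positivity
  linarith

/-- A non-trivial symmetric channel has a bounded estimator with mean proportional to
`1_x - 1_y`. -/
theorem Channel.IsFMS.exists_estimator {P : Channel.{u} q} (h : P.IsFMS) (hP : ¬ P.IsTrivial) :
    ∃ x y : Fin q, x ≠ y ∧ ∃ a : ℝ, a ≠ 0 ∧ ∃ s : Fin q → ℝ, HasEstimator P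
      (fun i => a * ((if i = x then 1 else 0) - (if i = y then 1 else 0))) s := by
  obtain ⟨ι, hm, hι⟩ := h
  simp only [Channel.IsTrivial, not_forall] at hP
  obtain ⟨x, y, hxy⟩ := hP
  obtain ⟨E, hE, hne⟩ : ∃ E, MeasurableSet E ∧ P.ker x E ≠ P.ker y E := by
    by_contra! hcon
    exact hxy (Measure.ext hcon)
  have hne' : x ≠ y := by rintro rfl; exact hne rfl
  -- The estimator is the difference of the indicators of `E` and of its image under the
  -- transposition of `x` and `y`.
  set τ := Equiv.swap x y
  have hF : MeasurableSet (ι τ '' E) := by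
    have : ι τ '' E = ι τ⁻¹ ⁻¹' E := by
      rw [map_inv]
      exact (ι τ).image_eq_preimage_symm E
    rw [this]
    exact hm _ hE
  have hFk (i) : P.ker i (ι τ '' E) = P.ker (τ i) E := by
    rw [hι E hE (τ i) τ]
    simp [τ]
  set T : P.Out → ℝ := fun z => E.indicator 1 z - (ι τ '' E).indicator 1 z with hTdef
  have hT : Measurable T := (measurable_one.indicator hE).sub (measurable_one.indicator hF)
  have hTb (z) : ‖T z‖ ≤ 1 := by
    simp only [hTdef, Set.indicator, Pi.one_apply]
    split_ifs <;> norm_num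
  refine ⟨x, y, hne', (P.ker x).real E - (P.ker y).real E, ?_,
    fun i => ∫ z, T z ^ 2 ∂P.ker i, T, hT, fun i =>
    ⟨MemLp.of_bound hT.aestronglyMeasurable 1 (ae_of_all _ hTb), ?_, rfl⟩⟩
  · rw [sub_ne_zero]
    intro h
    exact hne ((ENNReal.toReal_eq_toReal_iff' (measure_ne_top _ _) (measure_ne_top _ _)).1 h)
  · rw [integral_sub ((integrable_const 1).indicator hE) ((integrable_const 1).indicator hF),
      integral_indicator_one hE, integral_indicator_one hF, measureReal_def (P.ker i) (ι τ '' E),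
      hFk, ← measureReal_def]
    by_cases hix : i = x
    · subst hix; simp [τ, hne']
    · by_cases hiy : i = y
      · subst hiy; simp [τ, hne'.symm]
      · simp [τ, hix, hiy, Equiv.swap_apply_of_ne_of_ne hix hiy]

variable [NeZero q]

theorem HasEstimator.div_le_one_sub_bc {M : Channel.{u} q} {m s : Fin q → ℝ}
    (h : HasEstimator M m s) {i j : Fin q} {a : ℝ} (hi : m i = a) (hj : m j = -a) :
    a ^ 2 / (s i + s j) ≤ 1 - M.bc i j := by
  rcases lt_or_ge 0 (s i + s j) with hs | hs
  · exact h.le_one_sub_bc hi hj hs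
  · exact (div_nonpos_of_nonneg_of_nonpos (sq_nonneg a) hs).trans
      (sub_nonneg.2 (bc_le_one M i j))

/-- The normalized second moments of the estimator obtained by summing over the vertices at
distance `k`. -/
def secondMoment (lam : ℝ) (br : Branching) (δ v₀ : Fin q → ℝ) : ℕ → Fin q → ℝ
  | 0 => v₀
  | k + 1 => fun i => pottsMap lam (secondMoment lam br δ v₀ k) i / (br.mean * lam ^ 2)
      + br.fact2 / br.mean ^ 2 * δ i ^ 2

/-- Signed counting of the vertices at distance `k` carries a non-vanishing amount of information
about the root above the Kesten–Stigum threshold, and the amount is computed exactly in the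
limit. -/
theorem exists_affinity_bound (hq : 2 ≤ q) (lam : PottsParam q) (br : Branching)
    (hKS : 1 < br.mean * (lam : ℝ) ^ 2) (P : ℕ → Channel.{u} q)
    (hstep : ∀ k m s, HasEstimator (P k) m s → HasEstimator (P (k + 1))
      (fun i => br.mean * pottsMap lam m i)
      (fun i => br.mean * pottsMap lam s i + br.fact2 * pottsMap lam m i ^ 2))
    {x y : Fin q} (hxy : x ≠ y) {a : ℝ} (ha : a ≠ 0) {s₀ : Fin q → ℝ}
    (h₀ : HasEstimator (P 0)
      (fun i => a * ((if i = x then 1 else 0) - (if i = y then 1 else 0))) s₀) :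
    ∃ B : ℕ → ℝ, (∀ k, B k ≤ 1 - ((P k).noisy lam).bc x y) ∧
      Tendsto (fun k => br.fact2 / br.mean * B k) atTop
        (𝓝 (cH q lam br.mean * ((br.mean * (lam : ℝ) ^ 2 - 1) / 2))) := by
  have hq0 : (q : ℝ) ≠ 0 := by exact_mod_cast NeZero.ne q
  have hab := lam.abs_le_one hq
  set l : ℝ := (lam : ℝ) with hl
  set d : ℝ := br.mean with hd
  have hd0 : 0 ≤ d := by rw [hd]; cases br <;> simp [Branching.mean]
  have hl1 : l ^ 2 ≤ 1 := by rw [← sq_abs]; exact pow_le_one₀ (abs_nonneg _) hab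
  have hd1 : 1 < d := hKS.trans_le (by nlinarith)
  have hdl1 : 1 < |d * l| := by
    rw [abs_mul, abs_of_nonneg hd0]
    have : l ^ 2 ≤ |l| := by rw [← sq_abs]; nlinarith [abs_nonneg l]
    nlinarith
  have hl0 : l ≠ 0 := by rintro h; rw [h] at hKS; norm_num at hKS
  have hdne : d ≠ 0 := by linarith
  have hE := inv_cH_pos hq lam hd0 hKS
  have hβ : 0 < br.fact2 := by
    cases br with
    | regular n =>
      simp only [Branching.mean] at hd
      simp only [Branching.fact2, ← hd]
      exact mul_pos (by linarith) (by linarith)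
    | poisson r =>
      simp only [Branching.mean] at hd
      simp only [Branching.fact2, ← hd]
      positivity
  set β := br.fact2 with hβdef
  let δ : Fin q → ℝ := fun i => (if i = x then 1 else 0) - (if i = y then 1 else 0)
  have hδs : ∑ i, δ i = 0 := by simp [δ]
  have hδ2 : ∑ i, δ i ^ 2 = 2 := by
    have e (i) : δ i ^ 2 = (if i = x then 1 else 0) + (if i = y then 1 else 0) := by
      simp only [δ]
      split_ifs with h1 h2
      · exact absurd (h1.symm.trans h2) hxy
      all_goals norm_num
    simp only [e, Finset.sum_add_distrib, Finset.sum_ite_eq', Finset.mem_univ, if_true]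
    norm_num
  have hδx : δ x = 1 := by simp [δ, hxy]
  have hδy : δ y = -1 := by simp [δ, hxy.symm]
  let w := secondMoment l br δ (fun i => s₀ i / a ^ 2)
  have hKδ (c : ℝ) (i) : pottsMap l (fun i => c * δ i) i = c * (l * δ i) := by
    simp only [pottsMap, ← Finset.mul_sum, hδs]; ring
  have hKs (c : ℝ) (v : Fin q → ℝ) (i) : pottsMap l (fun i => c * v i) i = c * pottsMap l v i := by
    simp only [pottsMap, ← Finset.mul_sum]; ring
  have hdl : d * l ≠ 0 := mul_ne_zero hdne hl0
  have hest (k : ℕ) : HasEstimator (P k) (fun i => a * (d * l) ^ k * δ i)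
      (fun i => a ^ 2 * (d * l) ^ (2 * k) * w k i) := by
    induction k with
    | zero =>
      have e : (fun i => a ^ 2 * (d * l) ^ (2 * 0) * w 0 i) = s₀ := by
        funext i
        simp only [w, secondMoment]
        field_simp
        simp
      rw [e]
      simpa only [pow_zero, mul_one] using h₀
    | succ k ih =>
      have h1 := hstep k _ _ ih
      simp only [hKδ, hKs] at h1
      have e1 : (fun i => d * (a * (d * l) ^ k * (l * δ i)))
          = fun i => a * (d * l) ^ (k + 1) * δ i := by funext i; ring
      have e2 : (fun i => d * (a ^ 2 * (d * l) ^ (2 * k) * pottsMap l (w k) i)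
          + β * (a * (d * l) ^ k * (l * δ i)) ^ 2)
          = fun i => a ^ 2 * (d * l) ^ (2 * (k + 1)) * w (k + 1) i := by
        funext i
        simp only [w, secondMoment, ← hd, ← hβdef]
        have e3 : (d * l) ^ (2 * (k + 1)) = (d * l) ^ (2 * k) * (d * l) ^ 2 := by ring
        have e4 : ((d * l) ^ k) ^ 2 = (d * l) ^ (2 * k) := by ring
        rw [e3, mul_pow (a * (d * l) ^ k), mul_pow a, e4]
        field_simp
      rwa [e1, e2] at h1
  -- The mean of the second moments, and their deviation from it, satisfy affine recursions.
  let A : ℕ → ℝ := fun k => (∑ i, w k i) / q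
  have hA (k) : A (k + 1) = 1 / (d * l ^ 2) * A k + β / d ^ 2 * (2 / q) := by
    have : ∑ i, w (k + 1) i = (∑ i, w k i) / (d * l ^ 2) + β / d ^ 2 * 2 := by
      change ∑ i, (pottsMap l (w k) i / (d * l ^ 2) + β / d ^ 2 * δ i ^ 2) = _
      rw [Finset.sum_add_distrib, ← Finset.sum_div, sum_pottsMap, ← Finset.mul_sum, hδ2]
    simp only [A, this]; ring
  let D : ℕ → ℝ := fun k => w k x + w k y - 2 * A k
  have hK (k i) : pottsMap l (w k) i = l * w k i + (1 - l) * A k := by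
    simp only [pottsMap, A]; ring
  have hD (k) : D (k + 1) = 1 / (d * l) * D k + β / d ^ 2 * (2 - 4 / q) := by
    have e (i) : w (k + 1) i = pottsMap l (w k) i / (d * l ^ 2) + β / d ^ 2 * δ i ^ 2 := rfl
    simp only [D]
    rw [hA, e, e, hδx, hδy, hK, hK]
    field_simp
    ring
  have hAlim := tendsto_affine_recursion (by
    rw [abs_of_pos (by positivity)]; exact (div_lt_one (by linarith)).2 hKS) hA
  have hDlim := tendsto_affine_recursion (by
    rw [abs_div, abs_one]; exact (div_lt_one (by linarith)).2 hdl1) hD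
  refine ⟨fun k => l ^ 2 / (l * D k + 2 * A k), fun k => ?_, ?_⟩
  · have h1 := (hest k).noisy lam
    have h2 := h1.div_le_one_sub_bc (i := x) (j := y) (a := a * (d * l) ^ k * l)
      (by rw [hKδ, hδx]; ring) (by rw [hKδ, hδy]; ring)
    refine le_of_eq_of_le ?_ h2
    rw [hKs, hKs, hK, hK]
    have e : a ^ 2 * (d * l) ^ (2 * k) * (l * w k x + (1 - l) * A k)
        + a ^ 2 * (d * l) ^ (2 * k) * (l * w k y + (1 - l) * A k)
        = (a * (d * l) ^ k) ^ 2 * (l * D k + 2 * A k) := by simp only [D]; ring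
    have e2 : (a * (d * l) ^ k * l) ^ 2 = (a * (d * l) ^ k) ^ 2 * l ^ 2 := by ring
    have h3 : (a * (d * l) ^ k) ^ 2 ≠ 0 := by positivity
    rw [e, e2, mul_div_mul_left _ _ h3]
  · have hdl2 : d * l ^ 2 - 1 ≠ 0 := by linarith
    have hdl3 : d * l - 1 ≠ 0 := by
      intro h
      rw [sub_eq_zero] at h
      rw [h] at hdl1
      norm_num at hdl1
    set E : ℝ := 2 / (q : ℝ) + (q - 2) / q * ((d * l ^ 2 - 1) / (d * l - 1)) with hEdef
    have hlim := (hDlim.const_mul l).add (hAlim.const_mul 2)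
    have hval : l * (β / d ^ 2 * (2 - 4 / q) / (1 - 1 / (d * l)))
        + 2 * (β / d ^ 2 * (2 / q) / (1 - 1 / (d * l ^ 2)))
        = 2 * (β / d ^ 2) * (d * l ^ 2 / (d * l ^ 2 - 1)) * E := by
      have f1 : 1 - 1 / (d * l) = (d * l - 1) / (d * l) := by field_simp
      have f2 : 1 - 1 / (d * l ^ 2) = (d * l ^ 2 - 1) / (d * l ^ 2) := by field_simp
      rw [f1, f2, hEdef]
      generalize d * l - 1 = r₁ at hdl3
      generalize d * l ^ 2 - 1 = r₂ at hdl2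
      field_simp
      ring
    rw [hval] at hlim
    have hpos : 0 < 2 * (β / d ^ 2) * (d * l ^ 2 / (d * l ^ 2 - 1)) * E := by
      have : 0 < d * l ^ 2 - 1 := by linarith
      positivity
    have := ((tendsto_const_nhds (x := l ^ 2)).div hlim hpos.ne').const_mul (β / d)
    have hcH : cH q l d = E⁻¹ := rfl
    suffices h : cH q l d * ((d * l ^ 2 - 1) / 2)
        = β / d * (l ^ 2 / (2 * (β / d ^ 2) * (d * l ^ 2 / (d * l ^ 2 - 1)) * E)) by
      rw [h]; exact this
    rw [hcH]
    have hβ' := hβ.ne'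
    have hE' := hE.ne'
    field_simp

theorem tendsto_zero_of_ratio {D ρ : ℕ → ℝ} {r : ℝ} (hD : ∀ k, 0 ≤ D k)
    (h : ∀ k, D (k + 1) ≤ ρ k * D k) (hρ : Tendsto ρ atTop (𝓝 r)) (hr : r < 1) :
    Tendsto D atTop (𝓝 0) := by
  obtain ⟨t, ht0, ht1⟩ : ∃ t : ℝ, max r 0 < t ∧ t < 1 := exists_between (max_lt hr one_pos)
  obtain ⟨N, hN⟩ := eventually_atTop.1 (hρ.eventually_lt_const ((le_max_left r 0).trans_lt ht0))
  have htp : 0 ≤ t := (le_max_right r 0).trans ht0.le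
  have hb (n : ℕ) : D (n + N) ≤ t ^ n * D N := by
    induction n with
    | zero => simp
    | succ n ih =>
      have h1 := h (n + N)
      have h2 : ρ (n + N) ≤ t := (hN (n + N) (Nat.le_add_left _ _)).le
      calc D (n + 1 + N) = D (n + N + 1) := by congr 1; ring
        _ ≤ ρ (n + N) * D (n + N) := h1
        _ ≤ t * D (n + N) := mul_le_mul_of_nonneg_right h2 (hD _)
        _ ≤ t * (t ^ n * D N) := mul_le_mul_of_nonneg_left ih htp
        _ = _ := by ring
  rw [← tendsto_add_atTop_iff_nat N]
  refine squeeze_zero (fun n => hD _) hb ?_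
  simpa using (tendsto_pow_atTop_nhds_zero_of_lt_one htp ht1).mul_const (D N)

/-- The affinities of two nested sequences of symmetric channels, both obtained by iterating the
belief propagation operator in the presence of an extra observation of affinity `w`, approach each
other in the high signal-to-noise regime. -/
theorem tendsto_bc_sub (hq : 2 ≤ q) (lam : PottsParam q) (br : Branching)
    (hKS : 1 < br.mean * (lam : ℝ) ^ 2) {P : ℕ → Channel.{u} q} {Q : ℕ → Channel.{v} q}
    (hPQ : ∀ k, Degraded (P k) (Q k)) (hP : ∀ k, (P k).IsSymm) (hQ : ∀ k, (Q k).IsSymm)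
    (hstep : ∀ k m s, HasEstimator (P k) m s → HasEstimator (P (k + 1))
      (fun i => br.mean * pottsMap lam m i)
      (fun i => br.mean * pottsMap lam s i + br.fact2 * pottsMap lam m i ^ 2))
    {x y : Fin q} (hxy : x ≠ y) {a : ℝ} (ha : a ≠ 0) {s₀ : Fin q → ℝ}
    (h₀ : HasEstimator (P 0)
      (fun i => a * ((if i = x then 1 else 0) - (if i = y then 1 else 0))) s₀)
    {w : ℝ} (hw : 0 ≤ w)
    (hPw : ∀ k, (P (k + 1)).bc x y = w * br.gen (((P k).noisy lam).bc x y))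
    (hQw : ∀ k, (Q (k + 1)).bc x y = w * br.gen (((Q k).noisy lam).bc x y))
    (hsnr : highSNR q lam br.mean * ENNReal.ofReal w < 1) :
    Tendsto (fun k => (P k).bc x y - (Q k).bc x y) atTop (𝓝 0) := by
  rcases hw.eq_or_lt with hw0 | hw0
  -- If `w = 0`, then `C^H` may be infinite, but both affinities vanish.
  · rw [← tendsto_add_atTop_iff_nat 1]
    simp [hPw, hQw, ← hw0]
  have hEpos : 0 < br.mean * (lam : ℝ) ^ 2
      * Real.exp (-(cH q lam br.mean * ((br.mean * (lam : ℝ) ^ 2 - 1) / 2))) :=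
    mul_pos (by linarith) (Real.exp_pos _)
  have hC : CH q lam ≠ ⊤ := by
    intro h
    rw [highSNR, h, ENNReal.mul_top (by simpa using hEpos),
      ENNReal.top_mul (by simpa using hw0)] at hsnr
    exact absurd hsnr (by simp)
  set C := (CH q lam).toReal with hCdef
  have hC0 : 0 ≤ C := ENNReal.toReal_nonneg
  have hr : w * (br.mean * Real.exp (-(cH q lam br.mean
      * ((br.mean * (lam : ℝ) ^ 2 - 1) / 2)))) * ((lam : ℝ) ^ 2 * C) < 1 := by
    rw [highSNR, ← ENNReal.ofReal_toReal hC, ← ENNReal.ofReal_mul hEpos.le,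
      ← ENNReal.ofReal_mul (mul_nonneg hEpos.le hC0), ENNReal.ofReal_lt_one] at hsnr
    calc _ = _ := by ring
      _ < 1 := hsnr
  have hmean : 0 < br.mean := by
    by_contra! h
    have := mul_nonpos_of_nonpos_of_nonneg h (sq_nonneg (lam : ℝ))
    linarith
  have hfact : 0 ≤ br.fact2 / br.mean := by
    refine div_nonneg ?_ hmean.le
    rw [← br.integral_fact2.2]
    refine integral_nonneg fun b => ?_
    cases b with
    | zero => simp
    | succ n => push_cast; simp; positivity
  obtain ⟨B, hB, hBlim⟩ := exists_affinity_bound hq lam br hKS P hstep hxy ha h₀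
  have hlim : Tendsto (fun k => w * (br.mean * Real.exp (-(br.fact2 / br.mean * B k)))
      * ((lam : ℝ) ^ 2 * C)) atTop (𝓝 (w * (br.mean * Real.exp (-(cH q lam br.mean
      * ((br.mean * (lam : ℝ) ^ 2 - 1) / 2)))) * ((lam : ℝ) ^ 2 * C))) :=
    ((((Real.continuous_exp.tendsto _).comp hBlim.neg).const_mul _).const_mul _).mul_const _
  refine tendsto_zero_of_ratio (fun k => sub_nonneg.2 ((hPQ k).bc_le x y)) (fun k => ?_) hlim hr
  have h1 := br.gen_sub_le hmean (((Q k).noisy lam).bc_nonneg x y)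
    (((hPQ k).noisy lam).bc_le x y)
  have h2 := bc_noisy_sub_le hq lam hC (hPQ k) (hP k) (hQ k) hxy
  have h3 : Real.exp (-(br.fact2 / br.mean * (1 - ((P k).noisy lam).bc x y)))
      ≤ Real.exp (-(br.fact2 / br.mean * B k)) :=
    Real.exp_le_exp.2 (neg_le_neg (mul_le_mul_of_nonneg_left (hB k) hfact))
  have h4 : 0 ≤ ((P k).noisy lam).bc x y - ((Q k).noisy lam).bc x y :=
    sub_nonneg.2 (((hPQ k).noisy lam).bc_le x y)
  rw [hPw, hQw, ← mul_sub, mul_assoc w, mul_assoc w]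
  refine mul_le_mul_of_nonneg_left (h1.trans ?_) hw
  calc _ ≤ br.mean * Real.exp (-(br.fact2 / br.mean * B k))
        * (((P k).noisy lam).bc x y - ((Q k).noisy lam).bc x y) := by gcongr
    _ ≤ br.mean * Real.exp (-(br.fact2 / br.mean * B k))
        * ((lam : ℝ) ^ 2 * C * ((P k).bc x y - (Q k).bc x y)) := by gcongr
    _ = _ := by ring

end Gap

theorem concaveOn_stdSimplex_sum {q : ℕ} {f : ℝ → ℝ} (hf : ConcaveOn ℝ (Set.Ici 0) f) :
    ConcaveOn ℝ (stdSimplex ℝ (Fin q)) fun π => ∑ i, f (π i) := by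
  refine ⟨convex_stdSimplex ℝ _, fun x hx y hy a b ha hb hab => ?_⟩
  simp only [Finset.smul_sum, ← Finset.sum_add_distrib]
  exact Finset.sum_le_sum fun i _ => hf.2 (hx.1 i) (hy.1 i) ha hb hab

/-- If the affinities of nested symmetric channels approach each other, then so do the laws of the
posteriors. -/
theorem tendsto_integral_sub {q : ℕ} [NeZero q] {P : ℕ → Channel.{u} q} {Q : ℕ → Channel.{v} q}
    (h : ∀ k, Degraded (P k) (Q k)) (hP : ∀ k, (P k).IsSymm) (hQ : ∀ k, (Q k).IsSymm)
    {x y : Fin q} (hxy : x ≠ y) (hbc : Tendsto (fun k => (P k).bc x y - (Q k).bc x y) atTop (𝓝 0))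
    {f : stdSimplex ℝ (Fin q) → ℝ} (hf : Continuous f) :
    Tendsto (fun k => ∫ z, f z ∂((Q k).postLaw : Measure (stdSimplex ℝ (Fin q)))
      - ∫ z, f z ∂((P k).postLaw : Measure (stdSimplex ℝ (Fin q)))) atTop (𝓝 0) := by
  rw [Metric.tendsto_nhds]
  intro ε hε
  obtain ⟨K, hK, hb⟩ := exists_integral_sub_le f hf (half_pos hε)
  have h1 : Tendsto (fun k => K * (4 * (q - 1) * ((P k).bc x y - (Q k).bc x y))) atTop (𝓝 0) := by
    simpa using (hbc.const_mul (4 * ((q : ℝ) - 1))).const_mul K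
  filter_upwards [h1.eventually_lt_const (half_pos hε)] with k hk
  rw [Real.dist_eq, sub_zero]
  have h2 := mul_le_mul_of_nonneg_left (sqMoment_sub_le (h k) (hP k) (hQ k) hxy) hK
  linarith [hb (P k) (Q k) (h k)]

/-! ### Views of the broadcasting process as iterated belief propagation -/

section Views

theorem Tree.map_map {A B : Type u} {A' B' : Type v} {A'' B'' : Type w} (f : A → A') (g : B → B')
    (f' : A' → A'') (g' : B' → B'') (k : ℕ) (t : Tree A B k) :
    Tree.map f' g' k (Tree.map f g k t) = Tree.map (f' ∘ f) (g' ∘ g) k t := by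
  induction k with
  | zero => rfl
  | succ k ih =>
    obtain ⟨a, b, c⟩ := t
    simp only [Tree.map, ih]
    rfl

theorem sigmaMeasure_map {ν : Measure ℕ} {Y : ℕ → Type u} [∀ b, MeasurableSpace (Y b)]
    {Z : ℕ → Type v} [∀ b, MeasurableSpace (Z b)] (κ : ∀ b, Measure (Y b)) {f : ∀ b, Y b → Z b}
    (hf : ∀ b, Measurable (f b)) :
    (sigmaMeasure ν κ).map (fun z => (⟨z.1, f z.1 z.2⟩ : Σ b, Z b))
      = sigmaMeasure ν fun b => (κ b).map (f b) := by
  have hm : Measurable fun z : Σ b, Y b => (⟨z.1, f z.1 z.2⟩ : Σ b, Z b) :=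
    measurable_sigma fun b => (measurable_sigmaMk' b).comp (hf b)
  ext E hE
  rw [← lintegral_indicator_one hE, ← lintegral_indicator_one hE,
    lintegral_map (measurable_one.indicator hE) hm,
    lintegral_sigmaMeasure _ (measurable_one.indicator hE)]
  refine (lintegral_sigmaMeasure κ ((measurable_one.indicator hE).comp hm)).trans ?_
  refine lintegral_congr fun b => Eq.symm ?_
  exact lintegral_map ((measurable_one.indicator hE).comp (measurable_sigmaMk' b)) (hf b)

theorem Channel.mk_congr {q : ℕ} {Y : Type u} [MeasurableSpace Y] {κ η : Kernel (Fin q) Y}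
    {hκ : IsMarkovKernel κ} {hη : IsMarkovKernel η} (h : κ = η) :
    (@Channel.mk q Y _ κ hκ : Channel.{u} q) = @Channel.mk q Y _ η hη := by
  subst h; rfl

variable {q : ℕ} [NeZero q] (lam : PottsParam q) (br : Branching) (W : Channel.{u} q)

/-- The channel from the color of the root to all survey observations up to depth `k`, together with
the function `g` of the color and the survey observation at each vertex at distance exactly `k`; the
survey observations at distance exactly `k` are revealed through `g` only. -/
def treeView {B : Type u} [MeasurableSpace B] {g : Fin q × W.Out → B} (hg : Measurable g) (k : ℕ) :
    Channel.{u} q where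
  Out := Tree W.Out B k
  ker := (botsKernel lam br W k).map (Tree.map Prod.snd g k)
  markov := Kernel.IsMarkovKernel.map _ (Tree.measurable_map measurable_snd hg k)

/-- Each generation of the tree contributes one survey observation at the root, and one step of the
belief propagation operator. -/
theorem treeView_succ {B : Type u} [MeasurableSpace B] {g : Fin q × W.Out → B} (hg : Measurable g)
    (k : ℕ) : treeView lam br W hg (k + 1) = W.star (bp lam br (treeView lam br W hg k)) := by
  have hm := Tree.measurable_map (measurable_snd (α := Fin q) (β := W.Out)) hg k
  have hM : IsMarkovKernel ((botsKernel lam br W k).map (Tree.map Prod.snd g k)) :=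
    (treeView lam br W hg k).markov
  have h : ((Kernel.id ×ₖ W.ker) ×ₖ
        mixture br.law (fun b => starPow (botsKernel lam br W k ∘ₖ potts lam) b)).map
        (Prod.map Prod.snd fun z : Σ b, Fin b → Tree (Fin q × W.Out) (Fin q × W.Out) k =>
          (⟨z.1, fun i => Tree.map Prod.snd g k (z.2 i)⟩ : Σ b, Fin b → Tree W.Out B k))
      = W.ker ×ₖ mixture br.law (fun b =>
        starPow ((botsKernel lam br W k).map (Tree.map Prod.snd g k) ∘ₖ potts lam) b) := by
    have hF (b : ℕ) : Measurable fun c : Fin b → Tree (Fin q × W.Out) (Fin q × W.Out) k =>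
        fun i => Tree.map Prod.snd g k (c i) :=
      measurable_pi_lambda _ fun i => hm.comp (measurable_pi_apply i)
    have hS : Measurable fun z : Σ b, Fin b → Tree (Fin q × W.Out) (Fin q × W.Out) k =>
        (⟨z.1, fun i => Tree.map Prod.snd g k (z.2 i)⟩ : Σ b, Fin b → Tree W.Out B k) :=
      measurable_sigma fun b => (measurable_sigmaMk' b).comp (hF b)
    ext x : 1
    rw [Kernel.map_apply _ (measurable_snd.prodMap hS), Kernel.prod_apply, Kernel.prod_apply,
      Kernel.prod_apply, ← Measure.map_prod_map _ _ measurable_snd hS, ← Measure.snd,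
      Measure.snd_prod, mixture_apply, mixture_apply, sigmaMeasure_map _ hF]
    congr 2
    funext b
    rw [← Kernel.map_comp]
    change (Measure.pi fun _ => (botsKernel lam br W k ∘ₖ potts lam) x).map _
      = Measure.pi fun _ => ((botsKernel lam br W k ∘ₖ potts lam).map (Tree.map Prod.snd g k)) x
    rw [Kernel.map_apply _ hm, Measure.pi_map_pi fun _ => hm.aemeasurable]
  exact Channel.mk_congr (Y := W.Out × Σ b, Fin b → Tree W.Out B k) h

theorem treeView_zero_snd : treeView lam br W measurable_snd 0 = W := by
  have h : (Kernel.id ×ₖ W.ker).map Prod.snd = W.ker := by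
    rw [← Kernel.snd_eq, Kernel.snd_prod]
  exact Channel.mk_congr (Y := W.Out) h

/-- With the color of the root revealed, the channel is noiseless up to an observation that can be
simulated from the color. -/
theorem isSymm_treeView_zero_id : (treeView lam br W measurable_id 0).IsSymm := by
  have h : Degraded (Channel.ident q) (treeView lam br W measurable_id 0) := by
    refine Degraded.of_map (f := fun t : Fin q × W.Out => t.1) measurable_fst ?_
    change Kernel.id = ((Kernel.id ×ₖ W.ker).map id).map Prod.fst
    rw [Kernel.map_id, ← Kernel.fst_eq, Kernel.fst_prod]
  exact fun τ => (degraded_ident _).trans h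

theorem degraded_treeView {B B' : Type u} [MeasurableSpace B] [MeasurableSpace B']
    {g : Fin q × W.Out → B} (hg : Measurable g) {f : B → B'} (hf : Measurable f) (k : ℕ) :
    Degraded (treeView lam br W (hf.comp hg) k) (treeView lam br W hg k) := by
  have hm := Tree.measurable_map (measurable_snd (α := Fin q) (β := W.Out)) hg k
  have hm' := Tree.measurable_map (measurable_id (α := W.Out)) hf k
  refine Degraded.of_map (f := Tree.map id f k) hm' ?_
  change (botsKernel lam br W k).map (Tree.map Prod.snd (f ∘ g) k)
    = ((botsKernel lam br W k).map (Tree.map Prod.snd g k)).map (Tree.map id f k)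
  rw [← Kernel.map_comp_right _ hm hm']
  congr 1
  funext t
  exact (Tree.map_map Prod.snd g id f k t).symm

theorem isSymm_treeView (hW : W.IsSymm) {B : Type u} [MeasurableSpace B] {g : Fin q × W.Out → B}
    (hg : Measurable g) (h : (treeView lam br W hg 0).IsSymm) (k : ℕ) :
    (treeView lam br W hg k).IsSymm := by
  induction k with
  | zero => exact h
  | succ k ih => rw [treeView_succ]; exact hW.star (ih.bp lam br)

/-- The channel from the color of the root to the survey observations up to depth `k` together with
the colors at distance `k`. -/
def boundaryView (k : ℕ) : Channel.{u} q where
  Out := Tree W.Out W.Out k × Tree Unit (Fin q) k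
  ker := (botsKernel lam br W k).map fun t => (surveys W k t, leafColors W k t)
  markov := Kernel.IsMarkovKernel.map _
    ((measurable_surveys W k).prodMk (measurable_leafColors W k))

theorem degraded_boundaryView (k : ℕ) :
    Degraded (treeView lam br W measurable_snd k) (boundaryView lam br W k) := by
  refine Degraded.of_map (f := fun t : Tree W.Out W.Out k × Tree Unit (Fin q) k => t.1)
    measurable_fst ?_
  change (botsKernel lam br W k).map (surveys W k) = ((botsKernel lam br W k).map
    fun t => (surveys W k t, leafColors W k t)).map Prod.fst
  rw [← Kernel.map_comp_right _ ((measurable_surveys W k).prodMk (measurable_leafColors W k))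
    measurable_fst]
  rfl

theorem boundaryView_degraded (k : ℕ) :
    Degraded (boundaryView lam br W k) (treeView lam br W measurable_id k) := by
  have hm := Tree.measurable_map (measurable_snd (α := Fin q) (β := W.Out))
    (measurable_id (α := Fin q × W.Out)) k
  have h1 := Tree.measurable_map (measurable_id (α := W.Out))
    (measurable_snd (α := Fin q) (β := W.Out)) k
  have h2 := Tree.measurable_map (measurable_const : Measurable fun _ : W.Out => ())
    (measurable_fst (α := Fin q) (β := W.Out)) k
  refine Degraded.of_map (f := fun t : Tree W.Out (Fin q × W.Out) k =>
    (Tree.map id Prod.snd k t, Tree.map (fun _ => ()) Prod.fst k t)) (h1.prodMk h2) ?_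
  change (botsKernel lam br W k).map (fun t => (surveys W k t, leafColors W k t))
    = ((botsKernel lam br W k).map (Tree.map Prod.snd id k)).map
      (fun t => (Tree.map id Prod.snd k t, Tree.map (fun _ => ()) Prod.fst k t))
  rw [← Kernel.map_comp_right _ hm (h1.prodMk h2)]
  congr 1
  funext t
  simp only [Function.comp_apply, Tree.map_map]
  rfl

end Views

/-! ### Conditional entropy, and boundary irrelevance -/

section Entropy

variable {q : ℕ} [NeZero q]

/-- The conditional entropy of the input given a function of the output is the expected entropy of
the posterior of the resulting channel. -/
theorem condEntropy_eq {Ω : Type u} {β : Type v} [MeasurableSpace Ω] [MeasurableSpace β]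
    (κ : Kernel (Fin q) Ω) [IsMarkovKernel κ] {X : Ω → Fin q} (hX : Measurable X)
    (hκ : ∀ x, ∀ᵐ t ∂κ x, X t = x) {Z : Ω → β} (hZ : Measurable Z) {P : Channel.{v} q}
    (e : P = @Channel.mk q β _ (κ.map Z) (Kernel.IsMarkovKernel.map κ hZ)) :
    condEntropy (κ ∘ₘ unif q) X Z
      = ∫ π, ∑ i, Real.negMulLog (π.1 i) ∂(P.postLaw : Measure (stdSimplex ℝ (Fin q))) := by
  subst e
  have : IsMarkovKernel (κ.map Z) := Kernel.IsMarkovKernel.map κ hZ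
  have hmap : (κ ∘ₘ unif q).map Z = κ.map Z ∘ₘ unif q := Measure.map_comp _ _ hZ
  have hjoint : (κ ∘ₘ unif q).map (fun t => (Z t, X t))
      = (κ ∘ₘ unif q).map Z ⊗ₘ posterior (κ.map Z) (unif q) := by
    rw [hmap, compProd_posterior_eq_map_swap, Measure.compProd_eq_comp_prod,
      Measure.map_comp _ _ measurable_swap, Measure.map_comp _ _ (hZ.prodMk hX)]
    congr 1
    ext x : 1
    rw [Kernel.map_apply _ (hZ.prodMk hX), Kernel.map_apply _ measurable_swap, Kernel.prod_apply,
      Kernel.id_apply, Kernel.map_apply _ hZ, Measure.prod_swap, Measure.prod_dirac,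
      Measure.map_map (by fun_prop) hZ]
    refine Measure.map_congr ?_
    filter_upwards [hκ x] with t ht
    simp [ht]
  have hae := condDistrib_ae_eq_of_measure_eq_compProd Z hX.aemeasurable hjoint
  have hc : Continuous fun π : stdSimplex ℝ (Fin q) => ∑ i, Real.negMulLog (π.1 i) :=
    continuous_finsetSum _ fun i _ => Real.continuous_negMulLog.comp (continuous_coord i)
  rw [condEntropy, Channel.integral_postLaw _ _ hc.measurable]
  refine (integral_congr_ae ?_).trans (congrArg (fun μ : Measure β =>
    ∫ z, ∑ i, Real.negMulLog ((posterior (κ.map Z) (unif q) z).real {i}) ∂μ) hmap)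
  filter_upwards [hae] with z hz
  rw [hz]

variable (lam : PottsParam q) (br : Branching) (W : Channel.{u} q)

theorem ae_rootColor (k : ℕ) (x : Fin q) : ∀ᵐ t ∂botsKernel lam br W k x, rootColor W k t = x := by
  have h0 : ∀ᵐ t ∂(Kernel.id ×ₖ W.ker) x, t.1 = x := by
    rw [Kernel.prod_apply, Kernel.id_apply]
    exact Measure.quasiMeasurePreserving_fst.ae ((ae_dirac_iff (measurableSet_singleton x)).2 rfl)
  cases k with
  | zero => exact h0
  | succ k =>
    have h1 : ∀ᵐ t ∂((Kernel.id ×ₖ W.ker) ×ₖ mixture br.law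
        (fun b => starPow (botsKernel lam br W k ∘ₖ potts lam) b)) x, t.1.1 = x := by
      rw [Kernel.prod_apply]
      exact Measure.quasiMeasurePreserving_fst.ae h0
    exact h1

/-- The mutual information between the root and the boundary is squeezed between zero and the
difference of the entropies of the posteriors of two channels obtained by iterated belief
propagation. -/
theorem boundaryInfo_mem_Icc (k : ℕ) : boundaryInfo lam br W k ∈ Set.Icc 0
    (∫ π, ∑ i, Real.negMulLog (π.1 i)
        ∂((treeView lam br W measurable_snd k).postLaw : Measure (stdSimplex ℝ (Fin q)))
      - ∫ π, ∑ i, Real.negMulLog (π.1 i)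
        ∂((treeView lam br W measurable_id k).postLaw : Measure (stdSimplex ℝ (Fin q)))) := by
  have e1 : condEntropy (botsLaw lam br W k) (rootColor W k) (surveys W k) = _ :=
    condEntropy_eq (botsKernel lam br W k) (measurable_rootColor W k)
    (ae_rootColor lam br W k) (measurable_surveys W k)
    (P := treeView lam br W measurable_snd k) rfl
  have e2 : condEntropy (botsLaw lam br W k) (rootColor W k)
      (fun t => (surveys W k t, leafColors W k t)) = _ :=
    condEntropy_eq (botsKernel lam br W k) (measurable_rootColor W k)
    (ae_rootColor lam br W k) ((measurable_surveys W k).prodMk (measurable_leafColors W k))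
    (P := boundaryView lam br W k) rfl
  have hcv := concaveOn_stdSimplex_sum (q := q) Real.concaveOn_negMulLog
  have hct : ContinuousOn (fun π : Fin q → ℝ => ∑ i, Real.negMulLog (π i))
      (stdSimplex ℝ (Fin q)) :=
    (continuous_finsetSum _ fun i _ =>
      Real.continuous_negMulLog.comp (continuous_apply i)).continuousOn
  have i1 := (degraded_boundaryView lam br W k).integral_le hcv hct
  have i2 := (boundaryView_degraded lam br W k).integral_le hcv hct
  rw [boundaryInfo, e1, e2]
  exact ⟨sub_nonneg.2 i1, sub_le_sub_left i2 _⟩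

/-- Here the surveys alone are compared with the surveys and the full labels at distance `k`, which
contain the boundary colors. -/
theorem boundaryIrrelevantFor_of_lt (hq : 2 ≤ q) (hKS : 1 < br.mean * (lam : ℝ) ^ 2)
    (hW : W.IsFMS) (hW' : ¬ W.IsTrivial) {i j : Fin q} (hij : i ≠ j)
    (hsnr : highSNR q lam br.mean * ENNReal.ofReal (W.bc i j) < 1) :
    BoundaryIrrelevantFor lam br W := by
  obtain ⟨x, y, hxy, a, ha, s, hs⟩ := hW.exists_estimator hW'
  rw [hW.isSymm.bc_eq hij hxy] at hsnr
  have hdeg (k : ℕ) : Degraded (treeView lam br W measurable_snd k)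
      (treeView lam br W measurable_id k) :=
    degraded_treeView lam br W measurable_id measurable_snd k
  have hP := isSymm_treeView lam br W hW.isSymm measurable_snd
    (by rw [treeView_zero_snd]; exact hW.isSymm)
  have hQ := isSymm_treeView lam br W hW.isSymm measurable_id
    (isSymm_treeView_zero_id lam br W)
  have hbc := tendsto_bc_sub hq lam br hKS hdeg hP hQ
    (fun k m s h => by rw [treeView_succ]; exact (h.bp lam br).star W) hxy ha
    (by rw [treeView_zero_snd]; exact hs) (W.bc_nonneg x y)
    (fun k => by rw [treeView_succ, bc_star, bc_bp])
    (fun k => by rw [treeView_succ, bc_star, bc_bp]) hsnr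
  have hc : Continuous fun π : stdSimplex ℝ (Fin q) => ∑ i, Real.negMulLog (π.1 i) :=
    continuous_finsetSum _ fun i _ => Real.continuous_negMulLog.comp (continuous_coord i)
  have hlim := (tendsto_integral_sub hdeg hP hQ hxy hbc hc).neg
  simp only [neg_sub, neg_zero] at hlim
  exact squeeze_zero (fun k => (boundaryInfo_mem_Icc lam br W k).1)
    (fun k => (boundaryInfo_mem_Icc lam br W k).2) hlim

end Entropy

/-! ### Channels with a prescribed law of the posterior -/

section OfPosterior

variable {q : ℕ}

theorem measurable_natCast_mul_coord (i : Fin q) :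
    Measurable fun x : stdSimplex ℝ (Fin q) => (q : ℝ≥0∞) * ENNReal.ofReal (x.1 i) :=
  (continuous_coord i).measurable.ennreal_ofReal.const_mul _

/-- The action of the symmetric group on the simplex by permutation of the coordinates. -/
def simplexPerm (q : ℕ) : Equiv.Perm (Fin q) →* Equiv.Perm (stdSimplex ℝ (Fin q)) where
  toFun τ :=
    { toFun := fun x => ⟨fun i => x.1 (τ⁻¹ i), fun i => x.2.1 _, by
        rw [Equiv.sum_comp τ⁻¹ x.1]; exact x.2.2⟩
      invFun := fun x => ⟨fun i => x.1 (τ i), fun i => x.2.1 _, by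
        rw [Equiv.sum_comp τ x.1]; exact x.2.2⟩
      left_inv := fun x => Subtype.ext (funext fun i => by simp)
      right_inv := fun x => Subtype.ext (funext fun i => by simp) }
  map_one' := rfl
  map_mul' _ _ := by
    ext x i
    simp [mul_inv_rev]

theorem continuous_simplexPerm (τ : Equiv.Perm (Fin q)) : Continuous (simplexPerm q τ) :=
  Continuous.subtype_mk (continuous_pi fun i => continuous_coord (τ⁻¹ i)) _

variable [NeZero q]

theorem Channel.integral_coord (P : Channel.{u} q) (i : Fin q) :
    ∫ x, x.1 i ∂(P.postLaw : Measure (stdSimplex ℝ (Fin q))) = (q : ℝ)⁻¹ := by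
  have hm : Measurable fun y => ENNReal.ofReal ((P.post y).1 i) :=
    (P.measurable_post_apply i).ennreal_ofReal
  have h1 : (q : ℝ≥0∞) * ∫⁻ y, ENNReal.ofReal ((P.post y).1 i) ∂P.outLaw = 1 := by
    rw [← lintegral_const_mul _ hm, ← setLIntegral_univ, ← withDensity_apply _ MeasurableSet.univ,
      ← P.ker_eq_withDensity i, measure_univ]
  rw [P.integral_postLaw _ (continuous_coord i).measurable,
    integral_eq_lintegral_of_nonneg_ae (ae_of_all _ fun y => (P.post y).2.1 i)
      (P.measurable_post_apply i).aestronglyMeasurable,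
    ENNReal.eq_inv_of_mul_eq_one_left ((mul_comm _ _).trans h1), ENNReal.toReal_inv,
    ENNReal.toReal_natCast]

variable (μ : ProbabilityMeasure (stdSimplex ℝ (Fin q)))

/-- The channel which outputs its own posterior, for a law of the posterior with uniform mean. -/
def Channel.ofPostLaw (h : ∀ i, ∫ x, x.1 i ∂(μ : Measure (stdSimplex ℝ (Fin q))) = (q : ℝ)⁻¹) :
    Channel.{0} q where
  Out := stdSimplex ℝ (Fin q)
  ker := Kernel.ofFunOfCountable fun i =>
    (μ : Measure (stdSimplex ℝ (Fin q))).withDensity fun x => q * ENNReal.ofReal (x.1 i)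
  markov := ⟨fun i => ⟨by
    change (μ : Measure (stdSimplex ℝ (Fin q))).withDensity
      (fun x => (q : ℝ≥0∞) * ENNReal.ofReal (x.1 i)) Set.univ = 1
    rw [withDensity_apply _ MeasurableSet.univ, setLIntegral_univ,
      lintegral_const_mul _ (continuous_coord i).measurable.ennreal_ofReal,
      ← ofReal_integral_eq_lintegral_ofReal (integrable_of_continuous _ (continuous_coord i))
        (ae_of_all _ fun x => x.2.1 i), h, ENNReal.ofReal_inv_of_pos (by
          exact_mod_cast Nat.pos_of_ne_zero (NeZero.ne q)), ENNReal.ofReal_natCast,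
      ENNReal.mul_inv_cancel cast_ne_zero (ENNReal.natCast_ne_top q)]⟩⟩

variable {μ} (h : ∀ i, ∫ x, x.1 i ∂(μ : Measure (stdSimplex ℝ (Fin q))) = (q : ℝ)⁻¹)

theorem Channel.postLaw_ofPostLaw : (Channel.ofPostLaw μ h).postLaw = μ := by
  have hout : (Channel.ofPostLaw μ h).outLaw = (μ : Measure (stdSimplex ℝ (Fin q))) := by
    refine (Channel.outLaw_eq_withDensity (Channel.ofPostLaw μ h)
      (μ := (μ : Measure (stdSimplex ℝ (Fin q))))
      (f := fun i (x : stdSimplex ℝ (Fin q)) => (q : ℝ≥0∞) * ENNReal.ofReal (x.1 i))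
      measurable_natCast_mul_coord fun i => rfl).trans ?_
    have e (x : stdSimplex ℝ (Fin q)) :
        (q : ℝ≥0∞)⁻¹ * ∑ i, (q : ℝ≥0∞) * ENNReal.ofReal (x.1 i) = 1 := by
      rw [← Finset.mul_sum, ← ENNReal.ofReal_sum_of_nonneg fun i _ => x.2.1 i, x.2.2,
        ENNReal.ofReal_one, mul_one,
        ENNReal.inv_mul_cancel cast_ne_zero (ENNReal.natCast_ne_top q)]
    exact (congrArg (Measure.withDensity _) (funext e)).trans withDensity_one
  have hpost := Channel.post_ae_eq (Channel.ofPostLaw μ h)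
    (π := fun x : stdSimplex ℝ (Fin q) => x) measurable_id fun i => by rw [hout]; rfl
  refine Subtype.ext ?_
  change (Channel.ofPostLaw μ h).outLaw.map (Channel.ofPostLaw μ h).post = _
  rw [Measure.map_congr hpost, hout]
  exact Measure.map_id

theorem Channel.isFMS_ofPostLaw (hμ : ∀ τ, (μ : Measure (stdSimplex ℝ (Fin q))).map
    (simplexPerm q τ) = μ) : (Channel.ofPostLaw μ h).IsFMS := by
  have key (E : Set (stdSimplex ℝ (Fin q))) (hE : MeasurableSet E) (x : Fin q)
      (τ : Equiv.Perm (Fin q)) : (μ : Measure (stdSimplex ℝ (Fin q))).withDensity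
        (fun z => (q : ℝ≥0∞) * ENNReal.ofReal (z.1 x)) E
      = (μ : Measure (stdSimplex ℝ (Fin q))).withDensity
        (fun z => (q : ℝ≥0∞) * ENNReal.ofReal (z.1 (τ x))) (simplexPerm q τ '' E) := by
    have hE' : MeasurableSet (simplexPerm q τ '' E) := by
      rw [Equiv.image_eq_preimage_symm, ← Equiv.Perm.inv_def, ← map_inv]
      exact (continuous_simplexPerm _).measurable hE
    rw [withDensity_apply _ hE, withDensity_apply _ hE']
    conv_rhs => rw [← hμ τ]
    rw [setLIntegral_map hE' (measurable_natCast_mul_coord _)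
      (continuous_simplexPerm τ).measurable, Set.preimage_image_eq _ (simplexPerm q τ).injective]
    refine lintegral_congr fun z => ?_
    simp [simplexPerm]
  exact ⟨simplexPerm q, fun τ => (continuous_simplexPerm τ).measurable, key⟩

end OfPosterior

/-! ### The limit of belief propagation, and stability -/

section Stability

variable {q : ℕ} [NeZero q]

theorem Degraded.sqMoment_le {P : Channel.{u} q} {Q : Channel.{v} q} (h : Degraded P Q) :
    P.sqMoment ≤ Q.sqMoment := by
  have hs : ConcaveOn ℝ (Set.Ici 0) fun x : ℝ => -x ^ 2 := (convexOn_pow 2).neg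
  have h1 := h.integral_le (concaveOn_stdSimplex_sum hs)
    (continuous_finsetSum _ fun i _ => ((continuous_apply i).pow 2).neg).continuousOn
  simp only [Finset.sum_neg_distrib, integral_neg] at h1
  exact neg_le_neg_iff.1 h1

theorem Degraded.integral_eq {P : Channel.{u} q} {Q : Channel.{v} q} (h : Degraded P Q)
    (h' : Degraded Q P) {f : stdSimplex ℝ (Fin q) → ℝ} (hf : Continuous f) :
    ∫ x, f x ∂(Q.postLaw : Measure (stdSimplex ℝ (Fin q)))
      = ∫ x, f x ∂(P.postLaw : Measure (stdSimplex ℝ (Fin q))) := by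
  refine eq_of_abs_sub_le_all fun ε hε => ?_
  obtain ⟨K, -, hK⟩ := exists_integral_sub_le f hf hε
  have := hK P Q h
  rwa [le_antisymm h'.sqMoment_le h.sqMoment_le, sub_self, mul_zero, add_zero] at this

/-- Permuting the inputs of a channel permutes the coordinates of its posterior. -/
theorem integral_postLaw_relabel (M : Channel.{u} q) (τ : Equiv.Perm (Fin q))
    {f : stdSimplex ℝ (Fin q) → ℝ} (hf : Continuous f) :
    ∫ x, f x ∂((M.relabel τ).postLaw : Measure (stdSimplex ℝ (Fin q)))
      = ∫ x, f (simplexPerm q τ⁻¹ x) ∂(M.postLaw : Measure (stdSimplex ℝ (Fin q))) := by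
  have hout : (M.relabel τ).outLaw = M.outLaw := by
    rw [Channel.outLaw_eq, Channel.outLaw_eq]
    congr 1
    exact Equiv.sum_comp τ fun i => M.ker i
  have hpost := Channel.post_ae_eq (M.relabel τ) (π := fun y => simplexPerm q τ⁻¹ (M.post y))
    ((continuous_simplexPerm _).measurable.comp M.measurable_post) fun i => by
      rw [hout]
      refine (M.ker_eq_withDensity (τ i)).trans ?_
      simp [simplexPerm]
      rfl
  rw [Channel.integral_postLaw _ _ hf.measurable, Channel.integral_postLaw _
    (fun x => f (simplexPerm q τ⁻¹ x)) (hf.comp (continuous_simplexPerm _)).measurable]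
  rw [hout] at hpost ⊢
  refine integral_congr_ae ?_
  filter_upwards [hpost] with y hy
  rw [hy]

theorem Channel.IsSymm.integral_simplexPerm {M : Channel.{u} q} (hM : M.IsSymm)
    (τ : Equiv.Perm (Fin q)) {f : stdSimplex ℝ (Fin q) → ℝ} (hf : Continuous f) :
    ∫ x, f (simplexPerm q τ x) ∂(M.postLaw : Measure (stdSimplex ℝ (Fin q)))
      = ∫ x, f x ∂(M.postLaw : Measure (stdSimplex ℝ (Fin q))) := by
  have h1 := integral_postLaw_relabel M τ⁻¹ hf
  rw [inv_inv] at h1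
  rw [← h1]
  refine Degraded.integral_eq ?_ (hM τ⁻¹) hf
  obtain ⟨D, hD, h⟩ := (hM τ).relabel τ⁻¹
  refine ⟨D, hD, Eq.trans ?_ h⟩
  ext x : 1
  change M.ker x = M.ker (τ (τ⁻¹ x))
  simp

/-- A sequence of channels, each of which is a degradation of the preceding one, converges
weakly. -/
theorem exists_tendsto_postLaw {Q : ℕ → Channel.{u} q} (h : ∀ k, Degraded (Q (k + 1)) (Q k)) :
    ∃ μ, Tendsto (fun k => (Q k).postLaw) atTop (𝓝 μ) := by
  have hdeg {j k : ℕ} (hjk : j ≤ k) : Degraded (Q k) (Q j) := by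
    induction k, hjk using Nat.le_induction with
    | base => exact Degraded.refl _
    | succ k _ ih => exact (h k).trans ih
  have hanti : Antitone fun k => (Q k).sqMoment := fun j k hjk => (hdeg hjk).sqMoment_le
  have hbdd : BddBelow (Set.range fun k => (Q k).sqMoment) := ⟨0, by
    rintro _ ⟨k, rfl⟩
    exact integral_nonneg fun x => Finset.sum_nonneg fun i _ => sq_nonneg _⟩
  have hcau := (tendsto_atTop_ciInf hanti hbdd).cauchySeq
  have hconv (f : stdSimplex ℝ (Fin q) → ℝ) (hf : Continuous f) : CauchySeq fun k =>
      ∫ x, f x ∂((Q k).postLaw : Measure (stdSimplex ℝ (Fin q))) := by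
    rw [Metric.cauchySeq_iff']
    intro ε hε
    obtain ⟨K, hK, hb⟩ := exists_integral_sub_le f hf (half_pos hε)
    obtain ⟨N, hN⟩ := Metric.cauchySeq_iff'.1 hcau (ε / 2 / (K + 1)) (by positivity)
    refine ⟨N, fun n hn => ?_⟩
    have h1 := hb (Q n) (Q N) (hdeg hn)
    have h2 := (le_abs_self _).trans_lt ((abs_sub_comm _ _).trans_lt (hN n hn))
    rw [lt_div_iff₀ (by positivity)] at h2
    have h3 : K * ((Q N).sqMoment - (Q n).sqMoment)
        ≤ ((Q N).sqMoment - (Q n).sqMoment) * (K + 1) := by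
      have := sub_nonneg.2 (hanti hn)
      simp only at this
      nlinarith
    rw [dist_comm, Real.dist_eq]
    linarith
  -- Any limit along an ultrafilter is a limit.
  let U := Ultrafilter.of (atTop : Filter ℕ)
  obtain ⟨μ, -, hμ⟩ := isCompact_univ.ultrafilter_le_nhds (U.map fun k => (Q k).postLaw) (by simp)
  refine ⟨μ, ?_⟩
  rw [ProbabilityMeasure.tendsto_iff_forall_integral_tendsto]
  intro f
  obtain ⟨L, hL⟩ := cauchySeq_tendsto_of_complete (hconv f f.continuous)
  have h1 := (ProbabilityMeasure.tendsto_iff_forall_integral_tendsto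
    (F := (U : Filter ℕ)) (μs := fun k => (Q k).postLaw)).1 hμ f
  rwa [← tendsto_nhds_unique (hL.mono_left (Ultrafilter.of_le _)) h1]

variable (lam : PottsParam q) (br : Branching)

theorem degraded_iterate_bp {P : Channel.{u} q} {Q : Channel.{v} q} (h : Degraded P Q) (k : ℕ) :
    Degraded ((bp lam br)^[k] P) ((bp lam br)^[k] Q) := by
  induction k with
  | zero => exact h
  | succ k ih => rw [Function.iterate_succ_apply', Function.iterate_succ_apply']; exact ih.bp lam br

theorem isSymm_iterate_bp {P : Channel.{u} q} (h : P.IsSymm) (k : ℕ) :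
    ((bp lam br)^[k] P).IsSymm := by
  induction k with
  | zero => exact h
  | succ k ih => rw [Function.iterate_succ_apply']; exact ih.bp lam br

/-- The iterates of belief propagation from the noiseless channel converge, and their limit inherits
the symmetry: the law of the limiting posterior is invariant under permutations. -/
theorem exists_limit_iterate_bp : ∃ M : Channel.{0} q, M.IsFMS ∧
    WeakTendsto (fun k => (bp lam br)^[k] (Channel.ident q)) M := by
  obtain ⟨μ, hμ⟩ := exists_tendsto_postLaw (Q := fun k => (bp lam br)^[k] (Channel.ident q))
    fun k => by
      rw [Function.iterate_succ_apply]
      exact degraded_iterate_bp lam br (degraded_ident _) k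
  have hint (f : stdSimplex ℝ (Fin q) → ℝ) (hf : Continuous f) :=
    ProbabilityMeasure.tendsto_iff_forall_integral_tendsto.1 hμ
      (BoundedContinuousFunction.mkOfCompact ⟨f, hf⟩)
  have hmean (i : Fin q) : ∫ x, x.1 i ∂(μ : Measure (stdSimplex ℝ (Fin q))) = (q : ℝ)⁻¹ :=
    tendsto_nhds_unique (hint _ (continuous_coord i))
      (tendsto_const_nhds.congr fun k => (Channel.integral_coord _ i).symm)
  refine ⟨Channel.ofPostLaw μ hmean, Channel.isFMS_ofPostLaw hmean fun τ => ?_, ?_⟩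
  · have : IsProbabilityMeasure ((μ : Measure (stdSimplex ℝ (Fin q))).map (simplexPerm q τ)) :=
      Measure.isProbabilityMeasure_map (continuous_simplexPerm τ).measurable.aemeasurable
    refine ext_of_forall_integral_eq_of_IsFiniteMeasure fun f => ?_
    rw [integral_map (continuous_simplexPerm τ).measurable.aemeasurable
      f.continuous.measurable.aestronglyMeasurable]
    refine tendsto_nhds_unique (hint _ (f.continuous.comp (continuous_simplexPerm τ))) ?_
    refine (hint _ f.continuous).congr fun k => ?_
    exact ((isSymm_iterate_bp lam br isSymm_ident k).integral_simplexPerm τ f.continuous).symm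
  · rw [WeakTendsto, Channel.postLaw_ofPostLaw]
    exact hμ

theorem bpStable_of_lt (hq : 2 ≤ q) (hKS : 1 < br.mean * (lam : ℝ) ^ 2)
    (hsnr : highSNR q lam br.mean < 1) : BPStable.{u} q lam br := by
  obtain ⟨M, hM, hlim⟩ := exists_limit_iterate_bp lam br
  refine ⟨M, hM, hlim, fun P hP hP' => ?_⟩
  obtain ⟨x, y, hxy, a, ha, s, hs⟩ := hP.exists_estimator hP'
  have hdeg := degraded_iterate_bp lam br (degraded_ident P)
  have hP := isSymm_iterate_bp lam br hP.isSymm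
  have hQ := isSymm_iterate_bp lam br (isSymm_ident (q := q))
  have hbc := tendsto_bc_sub hq lam br hKS hdeg hP hQ
    (fun k m s h => by rw [Function.iterate_succ_apply']; exact h.bp lam br) hxy ha hs zero_le_one
    (fun k => by rw [Function.iterate_succ_apply', bc_bp, one_mul])
    (fun k => by rw [Function.iterate_succ_apply', bc_bp, one_mul])
    (by rwa [ENNReal.ofReal_one, mul_one])
  rw [WeakTendsto, ProbabilityMeasure.tendsto_iff_forall_integral_tendsto] at hlim ⊢
  intro f
  simpa using (hlim f).sub (tendsto_integral_sub hdeg hP hQ hxy hbc f.continuous)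

end Stability

end

end PottsBP

universe u in
theorem mainTheorem3 (q : ℕ) [NeZero q] (hq : 2 ≤ q) (lam : PottsBP.PottsParam q)
    (br : PottsBP.Branching) (hKS : 1 < br.mean * (lam : ℝ) ^ 2) :
    (PottsBP.highSNR q lam br.mean < 1 →
      PottsBP.BoundaryIrrelevance.{u} q lam br ∧ PottsBP.BPStable.{u} q lam br) ∧
    (∀ W : PottsBP.Channel.{u} q, W.IsFMS → ¬ W.IsTrivial → ∀ e : Fin 2 ↪ Fin q,
      PottsBP.highSNR q lam br.mean * ENNReal.ofReal (W.restrict e).bhattacharyya < 1 →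
        PottsBP.BoundaryIrrelevantFor lam br W) := by
  refine ⟨fun h => ⟨fun W hW hW' => ?_, PottsBP.bpStable_of_lt lam br hq hKS h⟩,
    fun W hW hW' e h => ?_⟩
  · have hne : (⟨0, by omega⟩ : Fin q) ≠ ⟨1, by omega⟩ := by simp
    refine PottsBP.boundaryIrrelevantFor_of_lt lam br W hq hKS hW hW' hne (lt_of_le_of_lt ?_ h)
    exact mul_le_of_le_one_right' (ENNReal.ofReal_le_one.2 (PottsBP.bc_le_one W _ _))
  · rw [PottsBP.bhattacharyya_eq] at h
    exact PottsBP.boundaryIrrelevantFor_of_lt lam br W hq hKS hW hW'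
      (e.injective.ne (by decide)) h
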